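/- **Setting.** Let $S$ be one of the four resource monads with symmetric tensor: the linear, semicartesian, relevant or cartesian one. For a small category $C$, the category $SC$ has as objects the finite lists $\langle a_1,\dots,a_n\rangle$ of objects of $C$. A morphism $\langle a_1,\dots,a_n\rangle\to\langle b_1,\dots,b_m\rangle$ is a tuple $\langle\alpha,f_1,\dots,f_m\rangle$ with $f_i:a_{\alpha(i)}\to b_i$ in $C$, where $\alpha:[m]\to[n]$ is respectively a bijection, an injection, a surjection, or an arbitrary function. The tensor of $SC$ is concatenation $\oplus$ of lists. Let $A$ be a small category. The category of types $D=D_A$ has as objects $a::=o\in A\mid\langle a_1,\dots,a_k\rangle\Rightarrow a$. Its morphisms are those of $A$ between atoms, and $\varphi\Rightarrow f:(\vec a\Rightarrow a)\to(\vec a'\Rightarrow a')$ for $\varphi:\vec a'\to\vec a$ in $SD$ and $f:a\to a'$ in $D$. Contexts are the objects of $(SD)^n$, with the pointwise tensor $\otimes$. A distributor $D\nrightarrow (SD)^n$ is a functor $((SD)^n)^{o}\times D\to\mathrm{Set}$. Let $M$ be an untyped $\lambda$-term (up to renaming of bound variables) and $\vec x=\langle x_1,\dots,x_n\rangle$ a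 list of distinct variables with $\vec x\supseteq FV(M)$. **Denotation.** The denotation $[\![M]\!]_{\vec x}:D\nrightarrow(SD)^n$ is given by - $[\![x_i]\!]_{\vec x}(\Delta,a)=(SD)^n(\Delta,\langle\langle\rangle,\dots,\langle a\rangle,\dots,\langle\rangle\rangle)$, with $\langle a\rangle$ in position $i$; - $[\![\lambda x.M]\!]_{\vec x}(\Delta,\vec a\Rightarrow a)=[\![M]\!]_{\vec x\oplus\langle x\rangle}(\Delta\oplus\langle\vec a\rangle,a)$, and $[\![\lambda x.M]\!]_{\vec x}(\Delta,o)=\emptyset$ for $o\in A$; - $[\![MN]\!]_{\vec x}(\Delta,a)=\int^{\vec a=\langle a_1,\dots,a_k\rangle\in SD}\int^{\Gamma_0,\dots,\Gamma_k\in(SD)^n}[\![M]\!]_{\vec x}(\Gamma_0,\vec a\Rightarrow a)\times\prod_{i=1}^k[\![N]\!]_{\vec x}(\Gamma_i,a_i)\times(SD)^n(\Delta,\bigotimes_{j=0}^k\Gamma_j)$. **Typing derivations.** Derivations of $\Delta\vdash M:a$ are generated by three rules: - a morphism $\Delta\to\langle\langle\rangle,\dots,\langle a\rangle,\dots,\langle\rangle\rangle$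 (with $\langle a\rangle$ in position $i$) derives $\Delta\vdash x_i:a$; - from $\Delta,x:\vec a\vdash M:a$ derive $\Delta\vdash\lambda x.M:\vec a\Rightarrow a$; - from $\Gamma_0\vdash M:\langle a_1,\dots,a_k\rangle\Rightarrow a$, derivations of $\Gamma_i\vdash N:a_i$ for $1\le i\le k$, and $\eta:\Delta\to\bigotimes_{j=0}^k\Gamma_j$, derive $\Delta\vdash MN:a$. Write a derivation ending with the last rule as $(\pi_0,(\pi_i)_i,\eta)$. For $g:a\to a'$ and $\theta:\Delta'\to\Delta$ there are actions $\pi\mapsto[g]\pi$ and $\pi\mapsto\pi\{\theta\}$, defined by recursion on $\pi$. At variables they are composition of the morphism with $\langle g\rangle$ and with $\theta$. At abstractions, $(\lambda\pi)\{\theta\}=\lambda(\pi\{\theta\oplus\langle 1\rangle\})$ and $[\varphi\Rightarrow g](\lambda\pi)=\lambda(([g]\pi)\{1\oplus\langle\varphi\rangle\})$. At applications, $(\pi_0,(\pi_i)_i,\eta)\{\theta\}=(\pi_0,(\pi_i)_i,\eta\circ\theta)$ and $[g](\pi_0,(\pi_i)_i,\eta)=([1\Rightarrow g]\pi_0,(\pi_i)_i,\eta)$.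 Let $\sim$ be the smallest congruence on derivations such that - $(\pi_0,([f_i]\pi_{\alpha(i)})_i,(1\otimes\alpha^\star)\circ\eta)\sim([\langle\alpha,\vec f\rangle\Rightarrow1]\pi_0,(\pi_i)_i,\eta)$ for $\langle\alpha,\vec f\rangle:\vec a\to\vec b$ in $SD$, where $\alpha^\star:\bigotimes_i\Gamma_i\to\bigotimes_j\Gamma_{\alpha(j)}$ is the structural morphism induced by $\alpha$; - $(\pi_0\{\theta_0\},(\pi_i\{\theta_i\})_i,\eta)\sim(\pi_0,(\pi_i)_i,(\bigotimes_j\theta_j)\circ\eta)$ for morphisms of contexts $\theta_j$. Let $T_D(M)_{\vec x}:D\nrightarrow(SD)^n$ be the distributor whose value at $(\Delta,a)$ is the set of $\sim$-classes of derivations of $\Delta\vdash M:a$, with the action $\tilde\pi\mapsto\widetilde{[g]\pi\{\theta\}}$. **Theorem.** Let $M,N$ be $\lambda$-terms with $M\to_\beta N$ (one step of $\beta$-reduction, anywhere in the term), and let $\vec x\supseteq FV(M)\cup FV(N)$. Then there is a natural isomorphism of distributors $$[\![M]\!]_{\vec x}\cong[\![N]\!]_{\vec x}.$$ Likewise there is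 a natural isomorphism $T_D(M)_{\vec x}\cong T_D(N)_{\vec x}$. That is, the equivalence classes of typing derivations of $\Delta\vdash M:a$ and those of $\Delta\vdash N:a$ are in bijection, naturally in $\Delta$ and $a$. -/

import Mathlib

open CategoryTheory

universe v u

namespace ITD

/-! ### Resource monads -/

/-- The resource monads with a symmetric tensor product: free symmetric strict monoidal,
free semicartesian, free relevant and free cartesian (strict monoidal) completion. -/
inductive Resource : Type
  | linear
  | semicartesian
  | relevant
  | cartesian

/-- The functions between finite index sets that a resource monad allows as reindexings:
bijections, injections, surjections, or all functions. -/
def Resource.Adm (S : Resource) {I J : Type} (α : I → J) : Prop :=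
  match S with
  | .linear => Function.Bijective α
  | .semicartesian => Function.Injective α
  | .relevant => Function.Surjective α
  | .cartesian => True

theorem Resource.Adm.of_bijective (S : Resource) {I J : Type} {α : I → J}
    (h : Function.Bijective α) : S.Adm α := by
  cases S
  exacts [h, h.1, h.2, trivial]

theorem Resource.Adm.id (S : Resource) (I : Type) : S.Adm (fun i : I => i) :=
  .of_bijective S Function.bijective_id

theorem Resource.Adm.comp {S : Resource} {I J K : Type} {β : J → K} {α : I → J}
    (hβ : S.Adm β) (hα : S.Adm α) : S.Adm (fun i => β (α i)) := by
  cases S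
  · exact Function.Bijective.comp hβ hα
  · exact Function.Injective.comp hβ hα
  · exact Function.Surjective.comp hβ hα
  · trivial

/-- Admissible functions are closed under dependent sums of index sets. -/
theorem Resource.Adm.sigma {S : Resource} {I J : Type} {P : I → Type} {Q : J → Type}
    {α : I → J} (hα : S.Adm α) {β : ∀ i, P i → Q (α i)} (hβ : ∀ i, S.Adm (β i)) :
    S.Adm (fun p : (i : I) × P i => (⟨α p.1, β p.1 p.2⟩ : (j : J) × Q j)) := by
  have inj : Function.Injective α → (∀ i, Function.Injective (β i)) →
      Function.Injective (fun p : (i : I) × P i => (⟨α p.1, β p.1 p.2⟩ : (j : J) × Q j)) :=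
    fun h1 h2 => Function.Injective.sigma_map h1 h2
  have surj : Function.Surjective α → (∀ i, Function.Surjective (β i)) →
      Function.Surjective (fun p : (i : I) × P i => (⟨α p.1, β p.1 p.2⟩ : (j : J) × Q j)) :=
    fun h1 h2 => Function.Surjective.sigma_map h1 h2
  cases S
  · exact ⟨inj hα.1 fun i => (hβ i).1, surj hα.2 fun i => (hβ i).2⟩
  · exact inj hα hβ
  · exact surj hα hβ
  · trivial

/-- Objects of the free `S`-monoidal category `S C`: finite lists of objects of `C`. -/
structure SList (S : Resource) (C : Type u) : Type u where
  len : ℕ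
  get : Fin len → C

namespace SList

variable {S : Resource} {C : Type u}

/-- The strict tensor product `a₁ ⊕ ⋯ ⊕ aₘ` of `S C`: concatenation of lists. -/
def concat {m : ℕ} (a : Fin m → SList S C) : SList S C where
  len := ∑ i, (a i).len
  get p := (a (finSigmaFinEquiv.symm p).1).get (finSigmaFinEquiv.symm p).2

theorem concat_get {m : ℕ} (a : Fin m → SList S C) (q : (i : Fin m) × Fin (a i).len) :
    (concat a).get (finSigmaFinEquiv q) = (a q.1).get q.2 :=
  congrArg (fun q : (i : Fin m) × Fin (a i).len => (a q.1).get q.2)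
    (Equiv.symm_apply_apply finSigmaFinEquiv q)

variable [Category.{v} C]

/-- A morphism `⟨a₁, …, aₙ⟩ ⟶ ⟨b₁, …, bₘ⟩` of `S C`: an admissible `α : [m] → [n]` and
morphisms `a_{α i} ⟶ b_i` of `C`. -/
@[ext]
structure Hom (a b : SList S C) : Type v where
  idx : Fin b.len → Fin a.len
  adm : S.Adm idx
  map : ∀ i, a.get (idx i) ⟶ b.get i

instance : Category.{v} (SList S C) where
  Hom := Hom
  id a := ⟨fun i => i, .id S _, fun i => 𝟙 (a.get i)⟩
  comp f g := ⟨fun i => f.idx (g.idx i), f.adm.comp g.adm, fun i => f.map (g.idx i) ≫ g.map i⟩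
  id_comp f := by simp
  comp_id f := by simp
  assoc f g h := by simp

/-- An admissible `α : [m'] → [m]` and morphisms `θ_j : a_{α j} ⟶ b_j` induce
`a₁ ⊕ ⋯ ⊕ aₘ ⟶ b₁ ⊕ ⋯ ⊕ bₘ'`. For `α` the identity this is `θ₁ ⊕ ⋯ ⊕ θₘ`; for `θ` the
identities it is the structural morphism `α⋆`. -/
def concatMap {m m' : ℕ} {a : Fin m → SList S C} {b : Fin m' → SList S C}
    (α : Fin m' → Fin m) (hα : S.Adm α) (θ : ∀ j, a (α j) ⟶ b j) : concat a ⟶ concat b where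
  idx p := finSigmaFinEquiv (n := fun i => (a i).len)
    ⟨α (finSigmaFinEquiv.symm p).1,
      (θ (finSigmaFinEquiv.symm p).1).idx (finSigmaFinEquiv.symm p).2⟩
  adm :=
    (Resource.Adm.of_bijective S (Equiv.bijective finSigmaFinEquiv)).comp
      ((Resource.Adm.sigma (S := S) (Q := fun i => Fin (a i).len) hα fun j => (θ j).adm).comp
        (Resource.Adm.of_bijective S (Equiv.bijective finSigmaFinEquiv.symm)))
  map p := eqToHom (concat_get a _) ≫
    (θ (finSigmaFinEquiv.symm p).1).map (finSigmaFinEquiv.symm p).2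

end SList

/-! ### The category of types -/

/-- Objects of the category of types `D_A`: atoms, and arrows `⟨a₁, …, a_k⟩ ⇒ a`. -/
inductive Ty (S : Resource) (A : Type u) : Type u
  | atom (o : A) : Ty S A
  | arr (k : ℕ) (as : Fin k → Ty S A) (a : Ty S A) : Ty S A

namespace Ty

variable {S : Resource} {A : Type u} [SmallCategory A]

/-- Morphisms of `D_A`. There is a morphism `⟨α, f⟩ ⇒ g` from `a⃗ ⇒ a` to `a⃗' ⇒ a'` for every
morphism of lists `⟨α, f⟩ : a⃗' ⟶ a⃗` and every `g : a ⟶ a'`. -/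
inductive Hom : Ty S A → Ty S A → Type u
  | atom {o o' : A} (f : o ⟶ o') : Hom (.atom o) (.atom o')
  | arr {k k' : ℕ} {as : Fin k → Ty S A} {as' : Fin k' → Ty S A} {a a' : Ty S A}
      (α : Fin k → Fin k') (hα : S.Adm α) (f : ∀ i, Hom (as' (α i)) (as i)) (g : Hom a a') :
      Hom (.arr k as a) (.arr k' as' a')

def Hom.id : (a : Ty S A) → Hom a a
  | .atom o => .atom (𝟙 o)
  | .arr _ as a => .arr (fun i => i) (.id S _) (fun i => Hom.id (as i)) (Hom.id a)

def Hom.comp : {b a c : Ty S A} → Hom a b → Hom b c → Hom a c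
  | .atom _, _, _, .atom f, .atom g => .atom (f ≫ g)
  | .arr _ _ _, _, _, .arr α hα fs f, .arr β hβ gs g =>
      .arr (fun i => β (α i)) (hβ.comp hα) (fun i => Hom.comp (gs (α i)) (fs i)) (Hom.comp f g)

theorem Hom.id_comp_and_comp_id {a b : Ty S A} (f : Hom a b) :
    Hom.comp (Hom.id a) f = f ∧ Hom.comp f (Hom.id b) = f := by
  induction f with
  | atom f => simp [Hom.comp, Hom.id]
  | arr α hα f g ihf ihg => simp [Hom.comp, Hom.id, ihf, ihg]

theorem Hom.assoc {b c : Ty S A} (g : Hom b c) :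
    ∀ {a d : Ty S A} (f : Hom a b) (h : Hom c d),
      Hom.comp (Hom.comp f g) h = Hom.comp f (Hom.comp g h) := by
  induction g with
  | atom g =>
      intro a d f h
      cases f; cases h
      simp [Hom.comp]
  | arr β hβ gs g ihs ih =>
      intro a d f h
      cases f; cases h
      simp [Hom.comp, ihs, ih]

instance : Category.{u} (Ty S A) where
  Hom := Hom
  id := Hom.id
  comp := Hom.comp
  id_comp f := (Hom.id_comp_and_comp_id f).1
  comp_id f := (Hom.id_comp_and_comp_id f).2
  assoc f g h := Hom.assoc g f h

/-- The object part of `ι : (S D)ᵒ × D → D`. -/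
abbrev arrow (as : SList S (Ty S A)) (a : Ty S A) : Ty S A := .arr as.len as.get a

/-- The morphism part of `ι : (S D)ᵒ × D → D`. -/
def arrowMap {as as' : SList S (Ty S A)} {a a' : Ty S A} (φ : as' ⟶ as) (g : a ⟶ a') :
    arrow as a ⟶ arrow as' a' :=
  Hom.arr φ.idx φ.adm φ.map g

theorem arrowMap_id (as : SList S (Ty S A)) (a : Ty S A) :
    arrowMap (𝟙 as) (𝟙 a) = 𝟙 (arrow as a) := rfl

theorem arrowMap_comp {as as' as'' : SList S (Ty S A)} {a a' a'' : Ty S A}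
    (φ : as' ⟶ as) (ψ : as'' ⟶ as') (g : a ⟶ a') (h : a' ⟶ a'') :
    arrowMap φ g ≫ arrowMap ψ h = arrowMap (ψ ≫ φ) (g ≫ h) := by
  show Hom.comp _ _ = _
  simp only [arrowMap, Hom.comp]
  rfl

end Ty

/-! ### Contexts -/

/-- Intersection type contexts: the category `(S D)ⁿ`. -/
abbrev Ctx (S : Resource) (A : Type u) (n : ℕ) : Type u := Fin n → SList S (Ty S A)

namespace Ctx

variable {S : Resource} {A : Type u} [SmallCategory A] {n : ℕ}

/-- The context `⟨⟩, …, ⟨a⟩, …, ⟨⟩` with `⟨a⟩` in position `p`. -/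
def single (p : Fin n) (a : Ty S A) : Ctx S A n :=
  fun j => ⟨if j = p then 1 else 0, fun _ => a⟩

def singleMap (p : Fin n) {a b : Ty S A} (g : a ⟶ b) : single p a ⟶ single p b :=
  fun _ => ⟨fun i => i, .id S _, fun _ => g⟩

/-- Extension of a context by one variable. The new variable is put in front. -/
abbrev ext (as : SList S (Ty S A)) (Δ : Ctx S A n) : Ctx S A (n + 1) :=
  Fin.cons (α := fun _ => SList S (Ty S A)) as Δ

def extMap {as as' : SList S (Ty S A)} {Δ Δ' : Ctx S A n} (φ : as ⟶ as') (η : Δ ⟶ Δ') :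
    ext as Δ ⟶ ext as' Δ' :=
  Fin.cases (motive := fun i => ext as Δ i ⟶ ext as' Δ' i) φ η

theorem extMap_id (as : SList S (Ty S A)) (Δ : Ctx S A n) :
    extMap (𝟙 as) (𝟙 Δ) = 𝟙 (ext as Δ) := by
  funext i
  exact Fin.cases rfl (fun _ => rfl) i

theorem extMap_comp {as as' as'' : SList S (Ty S A)} {Δ Δ' Δ'' : Ctx S A n} (φ : as ⟶ as')
    (ψ : as' ⟶ as'') (η : Δ ⟶ Δ') (θ : Δ' ⟶ Δ'') :
    extMap φ η ≫ extMap ψ θ = extMap (φ ≫ ψ) (η ≫ θ) := by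
  funext i
  exact Fin.cases rfl (fun _ => rfl) i

/-- The tensor product `⨂_{j} Γ_j` of contexts: pointwise concatenation. -/
def tensor {m : ℕ} (Γ : Fin m → Ctx S A n) : Ctx S A n :=
  fun i => SList.concat fun j => Γ j i

/-- The morphism `⨂_j Γ_j ⟶ ⨂_j Γ'_j` induced by an admissible `α` and `θ_j : Γ_{α j} ⟶ Γ'_j`. -/
def tensorMap {m m' : ℕ} {Γ : Fin m → Ctx S A n} {Γ' : Fin m' → Ctx S A n}
    (α : Fin m' → Fin m) (hα : S.Adm α) (θ : ∀ j, Γ (α j) ⟶ Γ' j) : tensor Γ ⟶ tensor Γ' :=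
  fun i => SList.concatMap α hα fun j => θ j i

/-- The tensor product `Γ₀ ⊗ Γ₁ ⊗ ⋯ ⊗ Γ_k`. -/
abbrev tensor₀ {k : ℕ} (Γ₀ : Ctx S A n) (Γ : Fin k → Ctx S A n) : Ctx S A n :=
  tensor (Fin.cons (α := fun _ => Ctx S A n) Γ₀ Γ)

/-- `θ₀ ⊗ θ₁ ⊗ ⋯ ⊗ θ_k`. -/
def tensorMap₀ {k : ℕ} {Γ₀ Γ₀' : Ctx S A n} {Γ Γ' : Fin k → Ctx S A n}
    (θ₀ : Γ₀ ⟶ Γ₀') (θ : ∀ j, Γ j ⟶ Γ' j) : tensor₀ Γ₀ Γ ⟶ tensor₀ Γ₀' Γ' :=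
  tensorMap (fun j => j) (.id S _)
    (Fin.cases (motive := fun j => (Fin.cons (α := fun _ => Ctx S A n) Γ₀ Γ j : Ctx S A n) ⟶
      (Fin.cons (α := fun _ => Ctx S A n) Γ₀' Γ' j : Ctx S A n)) θ₀ θ)

theorem adm_cons {k k' : ℕ} {α : Fin k' → Fin k} (hα : S.Adm α) :
    S.Adm (Fin.cons (α := fun _ => Fin (k + 1)) 0 fun j => (α j).succ) := by
  have inj : Function.Injective α →
      Function.Injective (Fin.cons (α := fun _ => Fin (k + 1)) 0 fun j => (α j).succ) := by
    intro h
    refine Fin.cons_injective_iff.2 ⟨?_, fun i j hij => h (Fin.succ_injective _ hij)⟩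
    rintro ⟨j, hj⟩
    exact Fin.succ_ne_zero _ hj
  have surj : Function.Surjective α →
      Function.Surjective (Fin.cons (α := fun _ => Fin (k + 1)) 0 fun j => (α j).succ) := by
    intro h j
    refine Fin.cases ⟨0, rfl⟩ (fun j => ?_) j
    obtain ⟨i, rfl⟩ := h j
    exact ⟨i.succ, rfl⟩
  cases S
  · exact ⟨inj hα.1, surj hα.2⟩
  · exact inj hα
  · exact surj hα
  · trivial

/-- `1 ⊗ α⋆ : Γ₀ ⊗ ⨂_i Γ_i ⟶ Γ₀ ⊗ ⨂_j Γ_{α j}`. -/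
def star {k k' : ℕ} (α : Fin k' → Fin k) (hα : S.Adm α) (Γ₀ : Ctx S A n)
    (Γ : Fin k → Ctx S A n) : tensor₀ Γ₀ Γ ⟶ tensor₀ Γ₀ fun j => Γ (α j) :=
  tensorMap (Fin.cons (α := fun _ => Fin (k + 1)) 0 fun j => (α j).succ) (adm_cons hα)
    (Fin.cases (motive := fun j =>
      (Fin.cons (α := fun _ => Ctx S A n) Γ₀ Γ
        (Fin.cons (α := fun _ => Fin (k + 1)) 0 (fun j => (α j).succ) j : Fin (k + 1)) :
          Ctx S A n) ⟶
      (Fin.cons (α := fun _ => Ctx S A n) Γ₀ (fun j => Γ (α j)) j : Ctx S A n))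
      (𝟙 Γ₀) fun j => 𝟙 (Γ (α j)))

end Ctx

/-! ### Distributors -/

/-- Distributors `D ⇸ (S D)ⁿ`. -/
abbrev Dist (S : Resource) (A : Type u) [SmallCategory A] (n : ℕ) : Type (u + 1) :=
  (Ctx S A n)ᵒᵖ × Ty S A ⥤ Type u

namespace Dist

variable {S : Resource} {A : Type u} [SmallCategory A] {n : ℕ}

/-- A distributor from its values and its two-sided action. -/
def ofAction (obj : Ctx S A n → Ty S A → Type u)
    (act : ∀ {Δ Δ' : Ctx S A n} {a a' : Ty S A}, (a ⟶ a') → (Δ' ⟶ Δ) → obj Δ a → obj Δ' a')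
    (act_id : ∀ {Δ : Ctx S A n} {a : Ty S A} (x : obj Δ a), act (𝟙 a) (𝟙 Δ) x = x)
    (act_comp : ∀ {Δ Δ' Δ'' : Ctx S A n} {a a' a'' : Ty S A} (f : a ⟶ a') (g : a' ⟶ a'')
      (η : Δ' ⟶ Δ) (θ : Δ'' ⟶ Δ') (x : obj Δ a),
      act (f ≫ g) (θ ≫ η) x = act g θ (act f η x)) :
    Dist S A n where
  obj X := obj X.1.unop X.2
  map f := ↾(act f.2 f.1.unop)
  map_id X := by ext x; exact act_id x
  map_comp f g := by ext x; exact act_comp f.2 g.2 f.1.unop g.1.unop x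

/-- The set `P(Δ, a)`. -/
abbrev at' (P : Dist S A n) (Δ : Ctx S A n) (a : Ty S A) : Type u := P.obj (Opposite.op Δ, a)

/-- The action of `g : a ⟶ a'` and `η : Δ' ⟶ Δ` on `P`. -/
def act (P : Dist S A n) {Δ Δ' : Ctx S A n} {a a' : Ty S A} (g : a ⟶ a') (η : Δ' ⟶ Δ)
    (x : P.at' Δ a) : P.at' Δ' a' :=
  P.map (Prod.mkHom η.op g) x

theorem act_id (P : Dist S A n) {Δ : Ctx S A n} {a : Ty S A} (x : P.at' Δ a) :
    P.act (𝟙 a) (𝟙 Δ) x = x := by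
  show P.map (𝟙 (Opposite.op Δ, a)) x = x
  rw [P.map_id]
  rfl

theorem act_act (P : Dist S A n) {Δ Δ' Δ'' : Ctx S A n} {a a' a'' : Ty S A} (f : a ⟶ a')
    (g : a' ⟶ a'') (η : Δ' ⟶ Δ) (θ : Δ'' ⟶ Δ') (x : P.at' Δ a) :
    P.act g θ (P.act f η x) = P.act (f ≫ g) (θ ≫ η) x := by
  have h := P.map_comp (Prod.mkHom η.op f) (Prod.mkHom θ.op g)
  exact (congrArg (fun k => (ConcreteCategory.hom k : P.at' Δ a → P.at' Δ'' a'') x) h).symm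

/-- The denotation of a variable whose position in the context satisfies `pos`:
`(S D)ⁿ(Δ, ⟨⟨⟩, …, ⟨a⟩, …, ⟨⟩⟩)`. -/
def var (pos : Fin n → Prop) : Dist S A n :=
  ofAction (fun Δ a => (p : {p : Fin n // pos p}) × (Δ ⟶ Ctx.single (p : Fin n) a))
    (fun g η x => ⟨x.1, η ≫ x.2 ≫ Ctx.singleMap _ g⟩)
    (by
      rintro Δ a ⟨p, x⟩
      have : Ctx.singleMap (p : Fin n) (𝟙 a) = 𝟙 _ := rfl
      simp [this])
    (by
      rintro Δ Δ' Δ'' a a' a'' f g η θ ⟨p, x⟩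
      have : Ctx.singleMap (p : Fin n) (f ≫ g) = Ctx.singleMap _ f ≫ Ctx.singleMap _ g := rfl
      simp [this])

/-- Values of the denotation of an abstraction: `P(⟨a⃗⟩ ⊕ Δ, b)` at `a⃗ ⇒ b`, empty at atoms. -/
def LamObj (P : Dist S A (n + 1)) (Δ : Ctx S A n) : Ty S A → Type u
  | .atom _ => PEmpty
  | .arr k as b => P.at' (Ctx.ext ⟨k, as⟩ Δ) b

def lamAct (P : Dist S A (n + 1)) {Δ Δ' : Ctx S A n} (η : Δ' ⟶ Δ) :
    {c c' : Ty S A} → Ty.Hom c c' → LamObj P Δ c → LamObj P Δ' c'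
  | _, _, .atom _, x => PEmpty.elim x
  | _, _, .arr α hα f g, x => P.act g (Ctx.extMap ⟨α, hα, f⟩ η) x

/-- The denotation of an abstraction. -/
def lam (P : Dist S A (n + 1)) : Dist S A n :=
  ofAction (LamObj P) (fun g η x => lamAct P η g x)
    (by
      intro Δ c x
      cases c with
      | atom o => exact PEmpty.elim x
      | arr k as b =>
        refine Eq.trans ?_ (P.act_id x)
        exact congrArg (fun ζ => P.act (𝟙 b) ζ x) (Ctx.extMap_id ⟨k, as⟩ Δ))
    (by
      intro Δ Δ' Δ'' c c' c'' f g η θ x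
      change Ty.Hom c c' at f
      change Ty.Hom c' c'' at g
      cases f with
      | atom f => exact PEmpty.elim x
      | arr α hα fs f =>
        cases g with
        | arr β hβ gs g =>
          let φ : (⟨_, _⟩ : SList S (Ty S A)) ⟶ ⟨_, _⟩ := ⟨α, hα, fs⟩
          let ψ : (⟨_, _⟩ : SList S (Ty S A)) ⟶ ⟨_, _⟩ := ⟨β, hβ, gs⟩
          have h := P.act_act f g (Ctx.extMap φ η) (Ctx.extMap ψ θ) x
          rw [Ctx.extMap_comp] at h
          exact h.symm)

/-- The summands of the coend
`∫^{a⃗} ∫^{Γ₀, …, Γ_k} P(Γ₀, a⃗ ⇒ a) × ∏ᵢ Q(Γᵢ, aᵢ) × (S D)ⁿ(Δ, Γ₀ ⊗ ⋯ ⊗ Γ_k)`. -/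
structure AppPre (P Q : Dist S A n) (Δ : Ctx S A n) (a : Ty S A) : Type u where
  as : SList S (Ty S A)
  Γ₀ : Ctx S A n
  Γ : Fin as.len → Ctx S A n
  p : P.at' Γ₀ (Ty.arrow as a)
  q : ∀ i, Q.at' (Γ i) (as.get i)
  η : Δ ⟶ Ctx.tensor₀ Γ₀ Γ

/-- The cowedge relations of that coend, for the morphisms of `S D` and of `(S D)ⁿ`. -/
inductive AppRel (P Q : Dist S A n) (Δ : Ctx S A n) (a : Ty S A) :
    AppPre P Q Δ a → AppPre P Q Δ a → Prop
  | types {as bs : SList S (Ty S A)} (φ : as ⟶ bs) (Γ₀ : Ctx S A n)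
      (Γ : Fin as.len → Ctx S A n) (p : P.at' Γ₀ (Ty.arrow bs a))
      (q : ∀ i, Q.at' (Γ i) (as.get i)) (η : Δ ⟶ Ctx.tensor₀ Γ₀ Γ) :
      AppRel P Q Δ a
        ⟨bs, Γ₀, fun i => Γ (φ.idx i), p, fun i => Q.act (φ.map i) (𝟙 _) (q (φ.idx i)),
          η ≫ Ctx.star φ.idx φ.adm Γ₀ Γ⟩
        ⟨as, Γ₀, Γ, P.act (Ty.arrowMap φ (𝟙 a)) (𝟙 _) p, q, η⟩
  | contexts {as : SList S (Ty S A)} {Γ₀ Γ₀' : Ctx S A n} {Γ Γ' : Fin as.len → Ctx S A n}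
      (θ₀ : Γ₀ ⟶ Γ₀') (θ : ∀ i, Γ i ⟶ Γ' i) (p : P.at' Γ₀' (Ty.arrow as a))
      (q : ∀ i, Q.at' (Γ' i) (as.get i)) (η : Δ ⟶ Ctx.tensor₀ Γ₀ Γ) :
      AppRel P Q Δ a
        ⟨as, Γ₀, Γ, P.act (𝟙 _) θ₀ p, fun i => Q.act (𝟙 _) (θ i) (q i), η⟩
        ⟨as, Γ₀', Γ', p, q, η ≫ Ctx.tensorMap₀ θ₀ θ⟩

def AppPre.act {P Q : Dist S A n} {Δ Δ' : Ctx S A n} {a a' : Ty S A} (g : a ⟶ a')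
    (η : Δ' ⟶ Δ) (x : AppPre P Q Δ a) : AppPre P Q Δ' a' :=
  ⟨x.as, x.Γ₀, x.Γ, P.act (Ty.arrowMap (𝟙 _) g) (𝟙 _) x.p, x.q, η ≫ x.η⟩

theorem AppPre.act_rel {P Q : Dist S A n} {Δ Δ' : Ctx S A n} {a a' : Ty S A} (g : a ⟶ a')
    (η : Δ' ⟶ Δ) (x y : AppPre P Q Δ a) (h : AppRel P Q Δ a x y) :
    AppRel P Q Δ' a' (x.act g η) (y.act g η) := by
  cases h with
  | types φ Γ₀ Γ p q ζ =>
    have h := AppRel.types (a := a') φ Γ₀ Γ (P.act (Ty.arrowMap (𝟙 _) g) (𝟙 _) p) q (η ≫ ζ)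
    simpa [AppPre.act, act_act, Ty.arrowMap_comp] using h
  | contexts θ₀ θ p q ζ =>
    have h := AppRel.contexts (a := a') θ₀ θ (P.act (Ty.arrowMap (𝟙 _) g) (𝟙 _) p) q (η ≫ ζ)
    simpa [AppPre.act, act_act] using h

/-- The denotation of an application: the coend
`∫^{a⃗} ∫^{Γ₀, …, Γ_k} P(Γ₀, a⃗ ⇒ a) × ∏ᵢ Q(Γᵢ, aᵢ) × (S D)ⁿ(Δ, Γ₀ ⊗ ⋯ ⊗ Γ_k)`
in sets, as the quotient of the disjoint sum by the cowedge relations. -/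
def app (P Q : Dist S A n) : Dist S A n :=
  ofAction (fun Δ a => Quot (AppRel P Q Δ a))
    (fun g η => Quot.map (AppPre.act g η) (AppPre.act_rel g η))
    (by
      rintro Δ a ⟨x⟩
      refine congrArg (Quot.mk _) ?_
      simp [AppPre.act, Ty.arrowMap_id, act_id])
    (by
      rintro Δ Δ' Δ'' a a' a'' f g η θ ⟨x⟩
      refine congrArg (Quot.mk _) ?_
      simp [AppPre.act, act_act, Ty.arrowMap_comp])

end Dist

/-! ### Lambda terms -/

/-- Variables below `k` binders: free ones have names in a fixed countable set, bound ones are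
referred to by the number of binders between the occurrence and its binder. -/
inductive Var (k : ℕ) : Type
  | free (x : ℕ)
  | bound (i : Fin k)

/-- Terms below `k` binders. -/
inductive Term : ℕ → Type
  | var {k : ℕ} (v : Var k) : Term k
  | lam {k : ℕ} (M : Term (k + 1)) : Term k
  | app {k : ℕ} (M N : Term k) : Term k

/-- The set `Λ` of `λ`-terms up to renaming of bound variables. -/
abbrev Lam : Type := Term 0

namespace Term

/-- The set of free variables. -/
def FV : {k : ℕ} → Term k → Set ℕ
  | _, .var (.free x) => {x}
  | _, .var (.bound _) => ∅
  | _, .lam M => FV M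
  | _, .app M N => FV M ∪ FV N

/-- Renaming of bound variables. -/
def rename : {k l : ℕ} → (Fin k → Fin l) → Term k → Term l
  | _, _, _, .var (.free x) => .var (.free x)
  | _, _, ρ, .var (.bound i) => .var (.bound (ρ i))
  | _, l, ρ, .lam M =>
      .lam (rename (Fin.cons (α := fun _ => Fin (l + 1)) 0 fun i => (ρ i).succ) M)
  | _, _, ρ, .app M N => .app (rename ρ M) (rename ρ N)

/-- Substitution of terms for the bound variables. -/
def subst : {k l : ℕ} → (Fin k → Term l) → Term k → Term l
  | _, _, _, .var (.free x) => .var (.free x)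
  | _, _, σ, .var (.bound i) => σ i
  | _, l, σ, .lam M =>
      .lam (subst (Fin.cons (α := fun _ => Term (l + 1)) (.var (.bound 0))
        fun i => rename Fin.succ (σ i)) M)
  | _, _, σ, .app M N => .app (subst σ M) (subst σ N)

/-- The contractum `M[N/x]` of `(λx. M) N`. -/
def inst {k : ℕ} (M : Term (k + 1)) (N : Term k) : Term k :=
  subst (Fin.cons (α := fun _ => Term k) N fun i => .var (.bound i)) M

/-- One step of `β`-reduction, in any context. -/
inductive Beta : {k : ℕ} → Term k → Term k → Prop
  | beta {k : ℕ} (M : Term (k + 1)) (N : Term k) : Beta (.app (.lam M) N) (inst M N)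
  | lam {k : ℕ} {M M' : Term (k + 1)} : Beta M M' → Beta (.lam M) (.lam M')
  | appL {k : ℕ} {M M' : Term k} (N : Term k) : Beta M M' → Beta (.app M N) (.app M' N)
  | appR {k : ℕ} (M : Term k) {N N' : Term k} : Beta N N' → Beta (.app M N) (.app M N')

end Term

/-- The position of a variable in the list made of the `k` bound variables, innermost first,
followed by the list `x` of free variables. -/
def Var.At {n k : ℕ} (x : Fin n → ℕ) : Var k → Fin (n + k) → Prop
  | .free y, p => ∃ i : Fin n, x i = y ∧ p = i.addNat k
  | .bound i, p => p = i.castLE (Nat.le_add_left k n)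

/-! ### Denotations -/

/-- The denotation `⟦M⟧_x : D ⇸ (S D)ⁿ` of a `λ`-term. -/
def denote (S : Resource) (A : Type u) [SmallCategory A] {n : ℕ} (x : Fin n → ℕ) :
    {k : ℕ} → Term k → Dist S A (n + k)
  | _, .var v => Dist.var (v.At x)
  | _, .lam M => Dist.lam (denote S A x M)
  | _, .app M N => Dist.app (denote S A x M) (denote S A x N)

/-! ### Typing derivations -/

section Derivations

variable {S : Resource} {A : Type u} [SmallCategory A] {n : ℕ} {x : Fin n → ℕ}

/-- Typing derivations of `Δ ⊢ M : a` in the intersection type system. In the variable rule the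
family `f₁ : a⃗₁ ⟶ ⟨⟩, …, f_p : a⃗_p ⟶ ⟨a⟩, …, f_n : a⃗_n ⟶ ⟨⟩` is a single morphism of
contexts. -/
inductive Der (x : Fin n → ℕ) : {k : ℕ} → Ctx S A (n + k) → Term k → Ty S A → Type u
  | var {k : ℕ} {Δ : Ctx S A (n + k)} {v : Var k} {a : Ty S A} (p : Fin (n + k))
      (hp : v.At x p) (f : Δ ⟶ Ctx.single p a) : Der x Δ (.var v) a
  | lam {k : ℕ} {Δ : Ctx S A (n + k)} {M : Term (k + 1)} {m : ℕ} {as : Fin m → Ty S A}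
      {a : Ty S A} (π : Der x (k := k + 1) (Ctx.ext ⟨m, as⟩ Δ) M a) :
      Der x Δ (.lam M) (.arr m as a)
  | app {k : ℕ} {Δ : Ctx S A (n + k)} {M N : Term k} {a : Ty S A} (as : SList S (Ty S A))
      (Γ₀ : Ctx S A (n + k)) (Γ : Fin as.len → Ctx S A (n + k))
      (π₀ : Der x Γ₀ M (Ty.arrow as a)) (π : ∀ i, Der x (Γ i) N (as.get i))
      (η : Δ ⟶ Ctx.tensor₀ Γ₀ Γ) : Der x Δ (.app M N) a

namespace Der

/-- The right action `π{η}`. -/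
def ract : {k : ℕ} → {Δ Δ' : Ctx S A (n + k)} → {M : Term k} → {a : Ty S A} →
    Der x Δ M a → (Δ' ⟶ Δ) → Der x Δ' M a
  | _, _, _, _, _, .var p hp f, η => .var p hp (η ≫ f)
  | _, _, _, _, _, .lam π, η => .lam (ract π (Ctx.extMap (𝟙 _) η))
  | _, _, _, _, _, .app as Γ₀ Γ π₀ π θ, η => .app as Γ₀ Γ π₀ π (η ≫ θ)

/-- The left action `[g]π`. -/
def lact : {k : ℕ} → {Δ : Ctx S A (n + k)} → {M : Term k} → {a b : Ty S A} →
    Ty.Hom a b → Der x Δ M a → Der x Δ M b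
  | _, _, _, _, _, g, .var p hp f => .var p hp (f ≫ Ctx.singleMap p g)
  | _, _, _, _, _, .arr α hα fs g, .lam π =>
      .lam (ract (lact g π) (Ctx.extMap ⟨α, hα, fs⟩ (𝟙 _)))
  | _, _, _, _, _, g, .app as Γ₀ Γ π₀ π θ =>
      .app as Γ₀ Γ (lact (Ty.arrowMap (𝟙 as) g) π₀) π θ

theorem ract_id {k : ℕ} {Δ : Ctx S A (n + k)} {M : Term k} {a : Ty S A} (π : Der x Δ M a) :
    ract π (𝟙 Δ) = π := by
  induction π with
  | var p hp f => simp [ract]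
  | lam π ih => rw [ract, Ctx.extMap_id, ih]
  | app as Γ₀ Γ π₀ π θ ih₀ ih => simp [ract]

theorem ract_ract {k : ℕ} {Δ : Ctx S A (n + k)} {M : Term k} {a : Ty S A} (π : Der x Δ M a) :
    ∀ {Δ' Δ'' : Ctx S A (n + k)} (η : Δ' ⟶ Δ) (θ : Δ'' ⟶ Δ'),
      ract (ract π η) θ = ract π (θ ≫ η) := by
  induction π with
  | var p hp f => simp [ract]
  | lam π ih => intro Δ' Δ'' η θ; simp [ract, ih, Ctx.extMap_comp]
  | app as Γ₀ Γ π₀ π θ ih₀ ih => simp [ract]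

theorem lact_ract {k : ℕ} {Δ : Ctx S A (n + k)} {M : Term k} {a : Ty S A} (π : Der x Δ M a) :
    ∀ {Δ' : Ctx S A (n + k)} {b : Ty S A} (g : a ⟶ b) (η : Δ' ⟶ Δ),
      ract (lact g π) η = lact g (ract π η) := by
  induction π with
  | var p hp f => simp [ract, lact]
  | lam π ih =>
      intro Δ' b g η
      change Ty.Hom _ _ at g
      cases g with
      | arr α hα fs g =>
        rw [lact, ract, ract, lact, ← ih, ract_ract, ract_ract, Ctx.extMap_comp, Ctx.extMap_comp]
        simp
  | app as Γ₀ Γ π₀ π θ ih₀ ih => simp [ract, lact]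

theorem lact_id {k : ℕ} {Δ : Ctx S A (n + k)} {M : Term k} {a : Ty S A} (π : Der x Δ M a) :
    lact (𝟙 a) π = π := by
  induction π with
  | @var k Δ v a p hp f =>
      have : Ctx.singleMap p (𝟙 a) = 𝟙 (Ctx.single p a) := rfl
      simp [lact, this]
  | @lam k Δ M m as a π ih =>
      show Der.lam (ract (lact (𝟙 a) π) (Ctx.extMap (𝟙 _) (𝟙 _))) = _
      rw [ih, Ctx.extMap_id, ract_id]
  | app as Γ₀ Γ π₀ π θ ih₀ ih => rw [lact, Ty.arrowMap_id, ih₀]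

theorem lact_lact {k : ℕ} {Δ : Ctx S A (n + k)} {M : Term k} {a : Ty S A} (π : Der x Δ M a) :
    ∀ {b c : Ty S A} (g : a ⟶ b) (h : b ⟶ c), lact h (lact g π) = lact (g ≫ h) π := by
  induction π with
  | var p hp f =>
      intro b c g h
      have : Ctx.singleMap p (g ≫ h) = Ctx.singleMap p g ≫ Ctx.singleMap p h := rfl
      simp [lact, this]
  | lam π ih =>
      intro b c g h
      change Ty.Hom _ _ at g
      change Ty.Hom _ _ at h
      cases g with
      | arr α hα fs g =>
        cases h with
        | arr β hβ gs h =>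
          refine congrArg Der.lam ?_
          rw [← lact_ract, ih, ract_ract, Ctx.extMap_comp, Category.id_comp]
          rfl
  | app as Γ₀ Γ π₀ π θ ih₀ ih =>
      intro b c g h
      rw [lact, lact, lact, ih₀, Ty.arrowMap_comp]
      simp

/-- The smallest congruence `π ∼ π'` on derivations that contains the two generating rules. -/
inductive Congr : {k : ℕ} → {Δ : Ctx S A (n + k)} → {M : Term k} → {a : Ty S A} →
    Der x Δ M a → Der x Δ M a → Prop
  | refl {k : ℕ} {Δ : Ctx S A (n + k)} {M : Term k} {a : Ty S A} (π : Der x Δ M a) : Congr π π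
  | symm {k : ℕ} {Δ : Ctx S A (n + k)} {M : Term k} {a : Ty S A} {π ρ : Der x Δ M a} :
      Congr π ρ → Congr ρ π
  | trans {k : ℕ} {Δ : Ctx S A (n + k)} {M : Term k} {a : Ty S A} {π ρ τ : Der x Δ M a} :
      Congr π ρ → Congr ρ τ → Congr π τ
  | lam {k : ℕ} {Δ : Ctx S A (n + k)} {M : Term (k + 1)} {m : ℕ} {as : Fin m → Ty S A}
      {a : Ty S A} {π ρ : Der x (k := k + 1) (Ctx.ext ⟨m, as⟩ Δ) M a} :
      Congr π ρ → Congr (Der.lam π) (Der.lam ρ)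
  | app {k : ℕ} {Δ : Ctx S A (n + k)} {M N : Term k} {a : Ty S A} {as : SList S (Ty S A)}
      {Γ₀ : Ctx S A (n + k)} {Γ : Fin as.len → Ctx S A (n + k)}
      {π₀ ρ₀ : Der x Γ₀ M (Ty.arrow as a)} {π ρ : ∀ i, Der x (Γ i) N (as.get i)}
      (η : Δ ⟶ Ctx.tensor₀ Γ₀ Γ) :
      Congr π₀ ρ₀ → (∀ i, Congr (π i) (ρ i)) →
      Congr (Der.app as Γ₀ Γ π₀ π η) (Der.app as Γ₀ Γ ρ₀ ρ η)
  | types {k : ℕ} {Δ : Ctx S A (n + k)} {M N : Term k} {a : Ty S A} {as bs : SList S (Ty S A)}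
      (φ : as ⟶ bs) (Γ₀ : Ctx S A (n + k)) (Γ : Fin as.len → Ctx S A (n + k))
      (π₀ : Der x Γ₀ M (Ty.arrow bs a)) (π : ∀ i, Der x (Γ i) N (as.get i))
      (η : Δ ⟶ Ctx.tensor₀ Γ₀ Γ) :
      Congr
        (Der.app bs Γ₀ (fun i => Γ (φ.idx i)) π₀ (fun i => lact (φ.map i) (π (φ.idx i)))
          (η ≫ Ctx.star φ.idx φ.adm Γ₀ Γ))
        (Der.app as Γ₀ Γ (lact (Ty.arrowMap φ (𝟙 a)) π₀) π η)
  | contexts {k : ℕ} {Δ : Ctx S A (n + k)} {M N : Term k} {a : Ty S A}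
      {as : SList S (Ty S A)} {Γ₀ Γ₀' : Ctx S A (n + k)}
      {Γ Γ' : Fin as.len → Ctx S A (n + k)} (θ₀ : Γ₀ ⟶ Γ₀') (θ : ∀ i, Γ i ⟶ Γ' i)
      (π₀ : Der x Γ₀' M (Ty.arrow as a)) (π : ∀ i, Der x (Γ' i) N (as.get i))
      (η : Δ ⟶ Ctx.tensor₀ Γ₀ Γ) :
      Congr
        (Der.app as Γ₀ Γ (ract π₀ θ₀) (fun i => ract (π i) (θ i)) η)
        (Der.app as Γ₀' Γ' π₀ π (η ≫ Ctx.tensorMap₀ θ₀ θ))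

theorem Congr.ract {k : ℕ} {Δ : Ctx S A (n + k)} {M : Term k} {a : Ty S A}
    {π ρ : Der x Δ M a} (h : Congr π ρ) :
    ∀ {Δ' : Ctx S A (n + k)} (η : Δ' ⟶ Δ), Congr (π.ract η) (ρ.ract η) := by
  induction h with
  | refl π => intro Δ' η; exact .refl _
  | symm _ ih => intro Δ' η; exact (ih η).symm
  | trans _ _ ih ih' => intro Δ' η; exact (ih η).trans (ih' η)
  | lam _ ih => intro Δ' η; exact .lam (ih _)
  | app θ h₀ h _ _ => intro Δ' η; exact .app _ h₀ h
  | types φ Γ₀ Γ π₀ π θ =>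
      intro Δ' η
      have h := Congr.types φ Γ₀ Γ π₀ π (η ≫ θ)
      simpa [Der.ract] using h
  | contexts θ₀ θ π₀ π ζ =>
      intro Δ' η
      have h := Congr.contexts θ₀ θ π₀ π (η ≫ ζ)
      simpa [Der.ract] using h

theorem Congr.lact {k : ℕ} {Δ : Ctx S A (n + k)} {M : Term k} {a : Ty S A}
    {π ρ : Der x Δ M a} (h : Congr π ρ) :
    ∀ {b : Ty S A} (g : a ⟶ b), Congr (Der.lact g π) (Der.lact g ρ) := by
  induction h with
  | refl π => intro b g; exact .refl _
  | symm _ ih => intro b g; exact (ih g).symm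
  | trans _ _ ih ih' => intro b g; exact (ih g).trans (ih' g)
  | lam _ ih =>
      intro b g
      change Ty.Hom _ _ at g
      cases g with
      | arr α hα fs g => exact .lam ((ih g).ract _)
  | app θ h₀ h ih₀ _ => intro b g; exact .app _ (ih₀ _) h
  | types φ Γ₀ Γ π₀ π θ =>
      intro b g
      have h := Congr.types φ Γ₀ Γ (Der.lact (Ty.arrowMap (𝟙 _) g) π₀) π θ
      simpa [Der.lact, lact_lact, Ty.arrowMap_comp] using h
  | contexts θ₀ θ π₀ π ζ =>
      intro b g
      have h := Congr.contexts θ₀ θ (Der.lact (Ty.arrowMap (𝟙 _) g) π₀) π ζ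
      simpa [Der.lact, lact_ract] using h

end Der
end Derivations

/-- The intersection type distributor `T_D(M)_x`: the sets of equivalence classes of typing
derivations, with the action `[g]π{η}` on classes. -/
def typeDist (S : Resource) (A : Type u) [SmallCategory A] {n : ℕ} (x : Fin n → ℕ) {k : ℕ}
    (M : Term k) : Dist S A (n + k) :=
  Dist.ofAction (fun Δ a => Quot (Der.Congr (x := x) (Δ := Δ) (M := M) (a := a)))
    (fun g η => Quot.map (fun π => Der.ract (Der.lact g π) η) fun _ _ h => (h.lact g).ract η)
    (by
      rintro Δ a ⟨π⟩
      refine congrArg (Quot.mk _) ?_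
      show Der.ract (Der.lact (𝟙 a) π) (𝟙 Δ) = π
      rw [Der.lact_id, Der.ract_id])
    (by
      rintro Δ Δ' Δ'' a a' a'' f g η θ ⟨π⟩
      refine congrArg (Quot.mk _) ?_
      show Der.ract (Der.lact (f ≫ g) π) (θ ≫ η) =
        Der.ract (Der.lact g (Der.ract (Der.lact f π) η)) θ
      rw [← Der.lact_lact, ← Der.ract_ract, Der.lact_ract, Der.lact_ract])

end ITD

/-! ### Admissible maps on sums; functions on finite families of quotients. -/

namespace ITD

/-! Substitution is made into composition. A `Prof` `E` is a profunctor between categories of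
contexts, and `Prof.comp P E` is the coend `∫^Θ P(Θ, a) × E(Δ, Θ)`. The substitution lemma says that
if `E`, restricted to the contexts with a single entry, is the denotation of the terms `σ i` at the
bound variables and of the variable itself at the free ones, then composing `⟦M⟧` with `E` gives
`⟦M[σ]⟧`. It is proved by induction on `M`.

At a variable, the co-Yoneda lemma turns the composite into a restriction of `E` (`compVarIso`). At
an abstraction, `E` is extended by the identity profunctor in the new variable (`Prof.lift`,
`compLamIso`). At an application, `E` has to commute with tensor products: an element of `E(Δ, ⨂
Θ_j)` must be a splitting `Δ ⟶ ⨂ Δ_j` with elements of the `E(Δ_j, Θ_j)`, up to morphisms of the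
`Δ_j`. This is `Prof.Monoidal`; under it the two coends agree (`Monoidal.compAppIso`).

For a redex, `Prof.inst Q` sends a context with first entry `a⃗` and remainder `Θ'` to `∫^Γ ∏ᵢ Q(Γᵢ,
aᵢ) × (S D)ⁿ(-, Θ' ⊗ ⨂ᵢ Γᵢ)`. With `P` taken at `a⃗, Θ'`, the coend of the composite is the coend
that defines the application of `λP` to `Q` (`betaIso`). The profunctor is monoidal because
instantiating a tensor product only reassociates a sum of families (`instMonoidal`, with `shuffle`
as the reassociation). It restricts to `Q` at the first variable and to variables elsewhere, so the
substitution lemma applies. Under a binder the substituted terms are weakened; that is the case of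
renaming, proved first by the same induction with `Prof.wk`. Steps deeper in a term follow because
abstraction and application preserve isomorphisms.

The four resource monads are treated together: the argument uses only that admissible maps contain
the bijections and are closed under composition and sums. Concatenated lists are replaced by
families over arbitrary index types (`Fam`), where concatenation is a disjoint sum and reindexing
computes by cases; hence the second argument of a `Prof` is a context of families.

Finally, classes of derivations satisfy the same recursion as denotations, since the two generators
of `∼` are the cowedge relations of the application. So `T_D(M) ≅ ⟦M⟧` for every `M`
(`nonempty_typeDist_iso_denote`), and the second statement follows from the first. -/

theorem Resource.Adm.sumMap {S : Resource} {I J I' J' : Type} {α : I → J} {β : I' → J'}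
    (hα : S.Adm α) (hβ : S.Adm β) : S.Adm (Sum.map α β) := by
  cases S
  · exact ⟨Function.Injective.sumMap hα.1 hβ.1, Function.Surjective.sumMap hα.2 hβ.2⟩
  · exact Function.Injective.sumMap hα hβ
  · exact Function.Surjective.sumMap hα hβ
  · trivial

/-- A function on finite families that respects a family of reflexive relations respects the
generated equivalence relations. -/
theorem eq_of_quot_mk_eq {ι : Type} [Finite ι] {X : ι → Type*} {r : ∀ i, X i → X i → Prop}
    {Z : Type*} (refl : ∀ i x, r i x x) (f : (∀ i, X i) → Z)
    (hf : ∀ x y, (∀ i, r i (x i) (y i)) → f x = f y) {x y : ∀ i, X i}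
    (h : ∀ i, Quot.mk (r i) (x i) = Quot.mk (r i) (y i)) : f x = f y := by
  classical
  have := Fintype.ofFinite ι
  -- Reflexivity in the other coordinates lets a chain of steps in a single coordinate be followed
  -- while the rest stays fixed.
  have one : ∀ (z : ∀ i, X i) (i : ι) (u w : X i), Relation.EqvGen (r i) u w →
      f (Function.update z i u) = f (Function.update z i w) := by
    intro z i u w huw
    induction huw with
    | rel u w huw =>
      refine hf _ _ fun j => ?_
      by_cases hj : j = i
      · subst hj; simpa using huw
      · simpa [hj] using refl j _
    | refl => rfl
    | symm _ _ _ ih => exact ih.symm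
    | trans _ _ _ _ _ ih ih' => exact ih.trans ih'
  -- The coordinates of `x` are replaced by those of `y` one by one; finiteness of `ι` lets `s`
  -- exhaust it.
  have key : ∀ s : Finset ι, f x = f (fun i => if i ∈ s then y i else x i) := by
    intro s
    induction s using Finset.induction_on with
    | empty => simp
    | insert i s hi ih =>
      rw [ih]
      have := one (fun j => if j ∈ s then y j else x j) i (x i) (y i)
        (Quot.eqvGen_exact (h i))
      convert this using 2
      · funext j
        by_cases hj : j = i
        · subst hj; simp [hi]
        · simp [hj]
      · funext j
        by_cases hj : j = i
        · subst hj; simp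
        · simp [hj]
  simpa using key Finset.univ

/-- Lifting a function of one element and a finite family of elements to quotients. -/
noncomputable def quotLift₂ {ι : Type} {X₀ : Type*} {X : ι → Type*}
    {r₀ : X₀ → X₀ → Prop} {r : ∀ i, X i → X i → Prop} {Z : Type*} (f : X₀ → (∀ i, X i) → Z)
    (q₀ : Quot r₀) (q : ∀ i, Quot (r i)) : Z :=
  f q₀.out fun i => (q i).out

theorem quotLift₂_mk {ι : Type} [Finite ι] {X₀ : Type*} {X : ι → Type*}
    {r₀ : X₀ → X₀ → Prop} {r : ∀ i, X i → X i → Prop} {Z : Type*} {f : X₀ → (∀ i, X i) → Z}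
    (refl₀ : ∀ x, r₀ x x) (refl : ∀ i x, r i x x)
    (hf : ∀ x₀ y₀ x y, r₀ x₀ y₀ → (∀ i, r i (x i) (y i)) → f x₀ x = f y₀ y)
    (x₀ : X₀) (x : ∀ i, X i) :
    quotLift₂ f (Quot.mk r₀ x₀) (fun i => Quot.mk (r i) (x i)) = f x₀ x := by
  have h₀ : ∀ z, f (Quot.out (Quot.mk r₀ x₀)) z = f x₀ z := fun z =>
    eq_of_quot_mk_eq (ι := Unit) (r := fun _ => r₀) (fun _ => refl₀) (fun w => f (w ()) z)
      (fun w w' h => hf _ _ _ _ (h ()) fun i => refl i _)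
      (x := fun _ => Quot.out (Quot.mk r₀ x₀)) (y := fun _ => x₀) fun _ => Quot.out_eq _
  refine (h₀ _).trans ?_
  exact eq_of_quot_mk_eq refl (f x₀) (fun w w' h => hf _ _ _ _ (refl₀ _) h)
    fun i => Quot.out_eq _

/-! ### Families over arbitrary index types -/

/-- Families of objects of `C` over arbitrary index types. -/
structure Fam (S : Resource) (C : Type u) : Type (max u 1) where
  I : Type
  get : I → C

namespace Fam

variable {S : Resource} {C : Type u} [Category.{v} C]

/-- Morphisms of families, with the reindexings that `S` allows. -/
structure Hom (X Y : Fam S C) : Type v where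
  idx : Y.I → X.I
  adm : S.Adm idx
  map : ∀ i, X.get (idx i) ⟶ Y.get i

instance : Category.{v} (Fam S C) where
  Hom := Hom
  id X := ⟨fun i => i, .id S _, fun i => 𝟙 (X.get i)⟩
  comp f g := ⟨fun i => f.idx (g.idx i), f.adm.comp g.adm, fun i => f.map (g.idx i) ≫ g.map i⟩
  id_comp f := by simp
  comp_id f := by simp
  assoc f g h := by simp

@[simp] theorem id_map (X : Fam S C) (i : X.I) : Hom.map (𝟙 X) i = 𝟙 _ := rfl
@[simp] theorem comp_idx {X Y Z : Fam S C} (f : X ⟶ Y) (g : Y ⟶ Z) (i : Z.I) :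
    Hom.idx (f ≫ g) i = f.idx (g.idx i) := rfl
@[simp] theorem comp_map {X Y Z : Fam S C} (f : X ⟶ Y) (g : Y ⟶ Z) (i : Z.I) :
    Hom.map (f ≫ g) i = f.map (g.idx i) ≫ g.map i := rfl

/-- When the index maps agree by `rfl`, the transport is an identity; this is why many applications
end with a bare unit law. -/
theorem hom_ext {X Y : Fam S C} {f g : X ⟶ Y} (h : ∀ i, f.idx i = g.idx i)
    (h' : ∀ i, f.map i = eqToHom (congrArg X.get (h i)) ≫ g.map i) : f = g := by
  obtain ⟨fi, fa, fm⟩ := f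
  obtain ⟨gi, ga, gm⟩ := g
  obtain rfl : fi = gi := funext h
  congr
  funext i
  simpa using h' i

/-- The family of the entries of a list. -/
def ofList (a : SList S C) : Fam S C := ⟨Fin a.len, a.get⟩

def ofListMap {a b : SList S C} (f : a ⟶ b) : ofList a ⟶ ofList b := ⟨f.idx, f.adm, f.map⟩

def ofListPre {a b : SList S C} (f : ofList a ⟶ ofList b) : a ⟶ b := ⟨f.idx, f.adm, f.map⟩

/-- The sum of a family of families. -/
def sigma {J : Type} (X : J → Fam S C) : Fam S C := ⟨(j : J) × (X j).I, fun p => (X p.1).get p.2⟩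

def sigmaMap {J J' : Type} {X : J → Fam S C} {Y : J' → Fam S C} (α : J' → J) (hα : S.Adm α)
    (θ : ∀ j, X (α j) ⟶ Y j) : sigma X ⟶ sigma Y where
  idx p := ⟨α p.1, (θ p.1).idx p.2⟩
  adm := Resource.Adm.sigma (Q := fun i => (X i).I) hα fun j => (θ j).adm
  map p := (θ p.1).map p.2

/-- `X₀ ⊕ ⨁_j X_j`. -/
def tens {J : Type} (X₀ : Fam S C) (X : J → Fam S C) : Fam S C where
  I := X₀.I ⊕ (j : J) × (X j).I
  get := Sum.elim X₀.get fun p => (X p.1).get p.2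

def tensMap {J J' : Type} {X₀ Y₀ : Fam S C} {X : J → Fam S C} {Y : J' → Fam S C}
    (θ₀ : X₀ ⟶ Y₀) (α : J' → J) (hα : S.Adm α) (θ : ∀ j, X (α j) ⟶ Y j) :
    tens X₀ X ⟶ tens Y₀ Y where
  idx := Sum.map θ₀.idx fun p => ⟨α p.1, (θ p.1).idx p.2⟩
  adm := θ₀.adm.sumMap (Resource.Adm.sigma (Q := fun i => (X i).I) hα fun j => (θ j).adm)
  map := fun
    | .inl i => θ₀.map i
    | .inr p => (θ p.1).map p.2

theorem tensMap_id {J : Type} (X₀ : Fam S C) (X : J → Fam S C) :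
    tensMap (𝟙 X₀) (fun j => j) (.id S J) (fun j => 𝟙 (X j)) = 𝟙 (tens X₀ X) := by
  refine hom_ext ?_ ?_ <;> rintro (i | i)
  · rfl
  · rfl
  · exact (Category.id_comp _).symm
  · exact (Category.id_comp _).symm

theorem tensMap_comp {J J' J'' : Type} {X₀ Y₀ Z₀ : Fam S C} {X : J → Fam S C}
    {Y : J' → Fam S C} {Z : J'' → Fam S C} (θ₀ : X₀ ⟶ Y₀) (α : J' → J) (hα : S.Adm α)
    (θ : ∀ j, X (α j) ⟶ Y j) (ζ₀ : Y₀ ⟶ Z₀) (β : J'' → J') (hβ : S.Adm β)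
    (ζ : ∀ j, Y (β j) ⟶ Z j) :
    tensMap θ₀ α hα θ ≫ tensMap ζ₀ β hβ ζ =
      tensMap (θ₀ ≫ ζ₀) (fun j => α (β j)) (hα.comp hβ) fun j => θ (β j) ≫ ζ j := by
  refine hom_ext ?_ ?_ <;> rintro (i | i)
  · rfl
  · rfl
  · exact (Category.id_comp _).symm
  · exact (Category.id_comp _).symm

/-- An isomorphism from a bijection of index types. -/
def isoOfEquiv {X Y : Fam S C} (e : Y.I ≃ X.I) (h : ∀ i, X.get (e i) = Y.get i) : X ≅ Y where
  hom := ⟨e, .of_bijective S e.bijective, fun i => eqToHom (h i)⟩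
  inv := ⟨e.symm, .of_bijective S e.symm.bijective,
    fun i => eqToHom ((h (e.symm i)).symm.trans (congrArg X.get (e.apply_symm_apply i)))⟩
  hom_inv_id := hom_ext (fun i => e.apply_symm_apply i) fun i => by simp
  inv_hom_id := hom_ext (fun i => e.symm_apply_apply i) fun i => by simp

/-- The concatenation of lists as a sum of families. -/
def concatIso {m : ℕ} (a : Fin m → SList S C) :
    ofList (SList.concat a) ≅ sigma fun j => ofList (a j) :=
  isoOfEquiv (X := ofList (SList.concat a)) (Y := sigma fun j => ofList (a j))
    finSigmaFinEquiv (SList.concat_get a)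

theorem concatMap_concatIso {m m' : ℕ} {a : Fin m → SList S C} {b : Fin m' → SList S C}
    (α : Fin m' → Fin m) (hα : S.Adm α) (θ : ∀ j, a (α j) ⟶ b j) :
    ofListMap (SList.concatMap α hα θ) ≫ (concatIso b).hom =
      (concatIso a).hom ≫ sigmaMap α hα fun j => ofListMap (θ j) := by
  -- The round trip of `q` through `finSigmaFinEquiv` is generalised to an arbitrary `q'` equal to
  -- `q`, so that the equation can be eliminated.
  have key : ∀ q q' : (j : Fin m') × Fin (b j).len, q' = q →
      finSigmaFinEquiv (n := fun i => (a i).len) ⟨α q'.1, (θ q'.1).idx q'.2⟩ =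
      finSigmaFinEquiv (n := fun i => (a i).len) ⟨α q.1, (θ q.1).idx q.2⟩ := by
    rintro q _ rfl; rfl
  refine hom_ext (fun q => key q _ (Equiv.symm_apply_apply finSigmaFinEquiv q)) fun q => ?_
  have key' : ∀ (q' : (j : Fin m') × Fin (b j).len) (h : q' = q),
      (eqToHom (SList.concat_get a ⟨α q'.1, (θ q'.1).idx q'.2⟩) ≫ (θ q'.1).map q'.2) ≫
        eqToHom (congrArg (fun q => (b q.1).get q.2) h) =
      eqToHom (congrArg (SList.concat a).get (key q q' h)) ≫
        eqToHom (SList.concat_get a _) ≫ (θ q.1).map q.2 := by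
    rintro _ rfl; simp
  exact key' _ (Equiv.symm_apply_apply finSigmaFinEquiv q)

def sigmaSuccEquiv {k : ℕ} (X : Fin (k + 1) → Type) :
    (X 0 ⊕ (j : Fin k) × X j.succ) ≃ ((j : Fin (k + 1)) × X j) where
  toFun := Sum.elim (fun x => ⟨0, x⟩) fun p => ⟨p.1.succ, p.2⟩
  invFun p := Fin.cases (motive := fun j => X j → X 0 ⊕ (j : Fin k) × X j.succ)
    Sum.inl (fun j x => Sum.inr ⟨j, x⟩) p.1 p.2
  left_inv := by rintro (x | ⟨j, x⟩) <;> rfl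
  right_inv := by
    rintro ⟨j, x⟩
    induction j using Fin.cases <;> rfl

def sigmaSuccIso {k : ℕ} (X : Fin (k + 1) → Fam S C) :
    sigma X ≅ tens (X 0) fun j : Fin k => X j.succ :=
  isoOfEquiv (X := sigma X) (Y := tens (X 0) fun j : Fin k => X j.succ)
    (sigmaSuccEquiv fun j => (X j).I) (by rintro (x | p) <;> rfl)

/-- The empty family. -/
def empty : Fam S C := ⟨Empty, Empty.elim⟩

/-- The canonical isomorphism to the empty family. -/
def isoEmpty (X : Fam S C) [IsEmpty X.I] : X ≅ empty :=
  isoOfEquiv (Y := empty) (Equiv.equivOfIsEmpty Empty X.I) (fun i => i.elim)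

/-- A morphism is given by data over the entries of its target. Whether one into an empty family
exists depends on `S`: always if discarding is allowed, only from empty families in the linear and
relevant cases. -/
instance {X Y : Fam S C} [IsEmpty Y.I] : Subsingleton (X ⟶ Y) :=
  ⟨fun _ _ => hom_ext (fun i => isEmptyElim i) fun i => isEmptyElim i⟩

instance : IsEmpty (empty : Fam S C).I := inferInstanceAs (IsEmpty Empty)

/-- `X₀ ⊕ ⨁_j X_j` is `X₀` for an empty sum. -/
def tensEmptyIso {J : Type} [IsEmpty J] (X₀ : Fam S C) (X : J → Fam S C) : tens X₀ X ≅ X₀ :=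
  isoOfEquiv (X := tens X₀ X) (Y := X₀) (Equiv.sumEmpty X₀.I ((j : J) × (X j).I)).symm
    (fun _ => rfl)

/-- `X₀ ⊕ X₁` is `X₁` for empty `X₀`. -/
def tensUniqueIso {J : Type} [Unique J] (X₀ : Fam S C) [IsEmpty X₀.I] (X : J → Fam S C) :
    tens X₀ X ≅ X default :=
  isoOfEquiv (X := tens X₀ X) (Y := X default)
    ((Equiv.emptySum X₀.I ((j : J) × (X j).I)).trans (Equiv.uniqueSigma fun j => (X j).I)).symm
    (fun _ => rfl)

end Fam
end ITD

/-! ### Tensor products of contexts as disjoint sums of families. -/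

namespace ITD

theorem Fam.sigmaMap_cons_sigmaSuccIso {S : Resource} {C : Type u} [Category.{v} C] {k k' : ℕ}
    {X : Fin (k + 1) → Fam S C} {Y : Fin (k' + 1) → Fam S C} (α : Fin k' → Fin k)
    (hα : S.Adm α)
    (θ : ∀ j, X (Fin.cons (α := fun _ => Fin (k + 1)) 0 (fun j => (α j).succ) j) ⟶ Y j) :
    sigmaMap _ (Ctx.adm_cons hα) θ ≫ (sigmaSuccIso Y).hom =
      (sigmaSuccIso X).hom ≫ tensMap (θ 0) α hα (X := fun j : Fin k => X j.succ)
        (Y := fun j : Fin k' => Y j.succ) fun j => θ j.succ := by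
  refine hom_ext ?_ ?_ <;> rintro (i | ⟨j, i⟩)
  · rfl
  · rfl
  · exact (Category.comp_id ((θ 0).map i)).trans
      ((Category.id_comp _).trans (Category.id_comp _)).symm
  · exact (Category.comp_id ((θ j.succ).map i)).trans
      ((Category.id_comp _).trans (Category.id_comp _)).symm

theorem Fam.sigmaMap_sigmaSuccIso {S : Resource} {C : Type u} [Category.{v} C] {k : ℕ}
    {X : Fin (k + 1) → Fam S C} {Y : Fin (k + 1) → Fam S C} (θ : ∀ j, X j ⟶ Y j) :
    sigmaMap (fun j => j) (.id S _) θ ≫ (sigmaSuccIso Y).hom =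
      (sigmaSuccIso X).hom ≫ tensMap (θ 0) (fun j => j) (.id S _)
        (X := fun j : Fin k => X j.succ) (Y := fun j : Fin k => Y j.succ) fun j => θ j.succ := by
  refine hom_ext ?_ ?_ <;> rintro (i | ⟨j, i⟩)
  · rfl
  · rfl
  · exact (Category.comp_id ((θ 0).map i)).trans
      ((Category.id_comp _).trans (Category.id_comp _)).symm
  · exact (Category.comp_id ((θ j.succ).map i)).trans
      ((Category.id_comp _).trans (Category.id_comp _)).symm

/-- Pasting of two squares, used to join the naturality of `concatIso` with that of `sigmaSuccIso`.
-/
theorem square_comp {C : Type u} [Category.{v} C] {a b c d e f : C} {p : a ⟶ b} {q : b ⟶ c}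
    {q' : a ⟶ d} {r : d ⟶ c} {s : c ⟶ e} {s' : d ⟶ f} {t : f ⟶ e} (h : p ≫ q = q' ≫ r)
    (h' : r ≫ s = s' ≫ t) : p ≫ q ≫ s = (q' ≫ s') ≫ t := by
  rw [← Category.assoc, h, Category.assoc, h', Category.assoc]

/-- A nonempty concatenation of lists as a sum of families. -/
def Fam.concatSuccIso {S : Resource} {C : Type u} [Category.{v} C] {k : ℕ}
    (a : Fin (k + 1) → SList S C) :
    ofList (SList.concat a) ≅ tens (ofList (a 0)) fun j : Fin k => ofList (a j.succ) :=
  concatIso a ≪≫ sigmaSuccIso fun j => ofList (a j)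

theorem Fam.concatMap_cons_concatSuccIso {S : Resource} {C : Type u} [Category.{v} C]
    {k k' : ℕ} {a : Fin (k + 1) → SList S C} {b : Fin (k' + 1) → SList S C} (α : Fin k' → Fin k)
    (hα : S.Adm α)
    (θ : ∀ j, a (Fin.cons (α := fun _ => Fin (k + 1)) 0 (fun j => (α j).succ) j) ⟶ b j) :
    ofListMap (SList.concatMap _ (Ctx.adm_cons hα) θ) ≫ (concatSuccIso b).hom =
      (concatSuccIso a).hom ≫ tensMap (X₀ := ofList (a 0)) (Y₀ := ofList (b 0))
        (ofListMap (θ 0)) α hα (X := fun j : Fin k => ofList (a j.succ))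
        (Y := fun j : Fin k' => ofList (b j.succ)) fun j => ofListMap (θ j.succ) :=
  square_comp (concatMap_concatIso (a := a) (b := b) _ (Ctx.adm_cons hα) θ)
    (sigmaMap_cons_sigmaSuccIso (X := fun j => ofList (a j)) (Y := fun j => ofList (b j)) α hα
      fun j => ofListMap (θ j))

theorem Fam.concatMap_concatSuccIso {S : Resource} {C : Type u} [Category.{v} C]
    {k : ℕ} {a b : Fin (k + 1) → SList S C} (θ : ∀ j, a j ⟶ b j) :
    ofListMap (SList.concatMap (fun j => j) (.id S _) θ) ≫ (concatSuccIso b).hom =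
      (concatSuccIso a).hom ≫ tensMap (ofListMap (θ 0)) (fun j => j) (.id S _)
        (X := fun j : Fin k => ofList (a j.succ))
        (Y := fun j : Fin k => ofList (b j.succ)) fun j => ofListMap (θ j.succ) :=
  square_comp (concatMap_concatIso (a := a) (b := b) (fun j => j) (.id S _) θ)
    (sigmaMap_sigmaSuccIso (X := fun j => ofList (a j)) (Y := fun j => ofList (b j))
      fun j => ofListMap (θ j))

/-- Contexts whose entries are families. -/
abbrev FCtx (S : Resource) (A : Type u) (n : ℕ) : Type (max u 1) := Fin n → Fam S (Ty S A)

variable {S : Resource} {A : Type u} [SmallCategory A] {n : ℕ}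

namespace FCtx

def tens {J : Type} (Θ₀ : FCtx S A n) (Θ : J → FCtx S A n) : FCtx S A n :=
  fun v => Fam.tens (Θ₀ v) fun j => Θ j v

def tensMap {J J' : Type} {Θ₀ Ψ₀ : FCtx S A n} {Θ : J → FCtx S A n} {Ψ : J' → FCtx S A n}
    (θ₀ : Θ₀ ⟶ Ψ₀) (α : J' → J) (hα : S.Adm α) (θ : ∀ j, Θ (α j) ⟶ Ψ j) :
    tens Θ₀ Θ ⟶ tens Ψ₀ Ψ :=
  fun v => Fam.tensMap (θ₀ v) α hα fun j => θ j v

@[simp]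
theorem tensMap_id {J : Type} (Θ₀ : FCtx S A n) (Θ : J → FCtx S A n) (h : S.Adm fun j : J => j) :
    tensMap (𝟙 Θ₀) (fun j => j) h (fun j => 𝟙 (Θ j)) = 𝟙 (tens Θ₀ Θ) :=
  funext fun _ => Fam.tensMap_id _ _

@[simp]
theorem tensMap_comp {J J' J'' : Type} {X₀ Y₀ Z₀ : FCtx S A n} {X : J → FCtx S A n}
    {Y : J' → FCtx S A n} {Z : J'' → FCtx S A n} (θ₀ : X₀ ⟶ Y₀) (α : J' → J) (hα : S.Adm α)
    (θ : ∀ j, X (α j) ⟶ Y j) (ζ₀ : Y₀ ⟶ Z₀) (β : J'' → J') (hβ : S.Adm β)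
    (ζ : ∀ j, Y (β j) ⟶ Z j) :
    tensMap θ₀ α hα θ ≫ tensMap ζ₀ β hβ ζ =
      tensMap (θ₀ ≫ ζ₀) (fun j => α (β j)) (hα.comp hβ) fun j => θ (β j) ≫ ζ j :=
  funext fun _ => Fam.tensMap_comp _ _ _ _ _ _ _ _

def tail (Θ : FCtx S A (n + 1)) : FCtx S A n := fun v => Θ v.succ

def tailMap {Θ Θ' : FCtx S A (n + 1)} (θ : Θ ⟶ Θ') : tail Θ ⟶ tail Θ' := fun v => θ v.succ

@[simp] theorem tailMap_id (Θ : FCtx S A (n + 1)) : tailMap (𝟙 Θ) = 𝟙 (tail Θ) := rfl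

@[simp] theorem tailMap_comp {Θ Θ' Θ'' : FCtx S A (n + 1)} (θ : Θ ⟶ Θ') (ζ : Θ' ⟶ Θ'') :
    tailMap (θ ≫ ζ) = tailMap θ ≫ tailMap ζ := rfl

/-- The context whose entries are all empty. -/
def empty (S : Resource) (A : Type u) (n : ℕ) : FCtx S A n := fun _ => Fam.empty

/-- An isomorphism of contexts from isomorphisms of the entries. -/
def isoMk {Θ Θ' : FCtx S A n} (e : ∀ v, Θ v ≅ Θ' v) : Θ ≅ Θ' where
  hom v := (e v).hom
  inv v := (e v).inv
  hom_inv_id := funext fun v => (e v).hom_inv_id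
  inv_hom_id := funext fun v => (e v).inv_hom_id

end FCtx

namespace Ctx

def tail (Δ : Ctx S A (n + 1)) : Ctx S A n := fun v => Δ v.succ

def tailMap {Δ Δ' : Ctx S A (n + 1)} (θ : Δ ⟶ Δ') : tail Δ ⟶ tail Δ' := fun v => θ v.succ

@[simp] theorem tailMap_id (Δ : Ctx S A (n + 1)) : tailMap (𝟙 Δ) = 𝟙 (tail Δ) := rfl

@[simp] theorem tailMap_comp {Δ Δ' Δ'' : Ctx S A (n + 1)} (θ : Δ ⟶ Δ') (ζ : Δ' ⟶ Δ'') :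
    tailMap (θ ≫ ζ) = tailMap θ ≫ tailMap ζ := rfl

def fam (Δ : Ctx S A n) : FCtx S A n := fun v => Fam.ofList (Δ v)

def famMap {Δ Δ' : Ctx S A n} (θ : Δ ⟶ Δ') : fam Δ ⟶ fam Δ' := fun v => Fam.ofListMap (θ v)

/-- Passing to families is fully faithful, so morphisms of contexts can be built and compared as
morphisms of families. -/
def famPre {Δ Δ' : Ctx S A n} (θ : fam Δ ⟶ fam Δ') : Δ ⟶ Δ' := fun v => Fam.ofListPre (θ v)

@[simp] theorem famMap_famPre {Δ Δ' : Ctx S A n} (θ : fam Δ ⟶ fam Δ') : famMap (famPre θ) = θ :=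
  rfl
@[simp] theorem famPre_famMap {Δ Δ' : Ctx S A n} (θ : Δ ⟶ Δ') : famPre (famMap θ) = θ := rfl
@[simp] theorem famMap_id (Δ : Ctx S A n) : famMap (𝟙 Δ) = 𝟙 (fam Δ) := rfl
@[simp] theorem famMap_comp {Δ Δ' Δ'' : Ctx S A n} (θ : Δ ⟶ Δ') (ζ : Δ' ⟶ Δ'') :
    famMap (θ ≫ ζ) = famMap θ ≫ famMap ζ := rfl

/-- `tensor₀` as a sum of families. -/
def tensIso {k : ℕ} (Γ₀ : Ctx S A n) (Γ : Fin k → Ctx S A n) :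
    fam (tensor₀ Γ₀ Γ) ≅ FCtx.tens (fam Γ₀) fun j => fam (Γ j) :=
  FCtx.isoMk fun v => Fam.concatSuccIso fun j : Fin (k + 1) =>
    (Fin.cons (α := fun _ => Ctx S A n) Γ₀ Γ j : Ctx S A n) v

theorem famMap_star {k k' : ℕ} (α : Fin k' → Fin k) (hα : S.Adm α) (Γ₀ : Ctx S A n)
    (Γ : Fin k → Ctx S A n) :
    famMap (star α hα Γ₀ Γ) ≫ (tensIso Γ₀ fun j => Γ (α j)).hom =
      (tensIso Γ₀ Γ).hom ≫ FCtx.tensMap (𝟙 _) α hα (Θ := fun j => fam (Γ j))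
        fun j => 𝟙 (fam (Γ (α j))) := by
  funext v
  -- The components of `star`, named as one family over `Fin (k + 1)`, so that the naturality of
  -- `concatSuccIso` can be taken at the variable `v`.
  let θ : ∀ j, ((Fin.cons (α := fun _ => Ctx S A n) Γ₀ Γ
        (Fin.cons (α := fun _ => Fin (k + 1)) 0 (fun j => (α j).succ) j : Fin (k + 1)) :
          Ctx S A n) ⟶
      (Fin.cons (α := fun _ => Ctx S A n) Γ₀ (fun j => Γ (α j)) j : Ctx S A n)) :=
    Fin.cases (motive := fun j =>
      (Fin.cons (α := fun _ => Ctx S A n) Γ₀ Γ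
        (Fin.cons (α := fun _ => Fin (k + 1)) 0 (fun j => (α j).succ) j : Fin (k + 1)) :
          Ctx S A n) ⟶
      (Fin.cons (α := fun _ => Ctx S A n) Γ₀ (fun j => Γ (α j)) j : Ctx S A n))
      (𝟙 Γ₀) fun j => 𝟙 (Γ (α j))
  have h := Fam.concatMap_cons_concatSuccIso
    (a := fun j => (Fin.cons (α := fun _ => Ctx S A n) Γ₀ Γ j : Ctx S A n) v)
    (b := fun j => (Fin.cons (α := fun _ => Ctx S A n) Γ₀ (fun j => Γ (α j)) j : Ctx S A n) v)
    α hα (fun j => θ j v)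
  exact h

theorem famMap_tensorMap₀ {k : ℕ} {Γ₀ Γ₀' : Ctx S A n} {Γ Γ' : Fin k → Ctx S A n}
    (θ₀ : Γ₀ ⟶ Γ₀') (θ : ∀ j, Γ j ⟶ Γ' j) :
    famMap (tensorMap₀ θ₀ θ) ≫ (tensIso Γ₀' Γ').hom =
      (tensIso Γ₀ Γ).hom ≫ FCtx.tensMap (famMap θ₀) (fun j => j) (.id S _)
        fun j => famMap (θ j) := by
  funext v
  let ζ : ∀ j, ((Fin.cons (α := fun _ => Ctx S A n) Γ₀ Γ j : Ctx S A n) ⟶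
      (Fin.cons (α := fun _ => Ctx S A n) Γ₀' Γ' j : Ctx S A n)) :=
    Fin.cases (motive := fun j => (Fin.cons (α := fun _ => Ctx S A n) Γ₀ Γ j : Ctx S A n) ⟶
      (Fin.cons (α := fun _ => Ctx S A n) Γ₀' Γ' j : Ctx S A n)) θ₀ θ
  have h := Fam.concatMap_concatSuccIso
    (a := fun j => (Fin.cons (α := fun _ => Ctx S A n) Γ₀ Γ j : Ctx S A n) v)
    (b := fun j => (Fin.cons (α := fun _ => Ctx S A n) Γ₀' Γ' j : Ctx S A n) v) fun j => ζ j v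
  exact h

theorem tensIso_inv_famMap_tensorMap₀ {k : ℕ} {Γ₀ Γ₀' : Ctx S A n} {Γ Γ' : Fin k → Ctx S A n}
    (θ₀ : Γ₀ ⟶ Γ₀') (θ : ∀ j, Γ j ⟶ Γ' j) :
    (tensIso Γ₀ Γ).inv ≫ famMap (tensorMap₀ θ₀ θ) =
      FCtx.tensMap (famMap θ₀) (fun j => j) (.id S _) (fun j => famMap (θ j)) ≫
        (tensIso Γ₀' Γ').inv := by
  rw [Iso.inv_comp_eq, ← Category.assoc, Iso.eq_comp_inv, famMap_tensorMap₀]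

theorem tensIso_inv_famMap_star {k k' : ℕ} (α : Fin k' → Fin k) (hα : S.Adm α) (Γ₀ : Ctx S A n)
    (Γ : Fin k → Ctx S A n) :
    (tensIso Γ₀ Γ).inv ≫ famMap (star α hα Γ₀ Γ) =
      FCtx.tensMap (𝟙 _) α hα (Θ := fun j => fam (Γ j)) (fun j => 𝟙 (fam (Γ (α j)))) ≫
        (tensIso Γ₀ fun j => Γ (α j)).inv := by
  rw [Iso.inv_comp_eq, ← Category.assoc, Iso.eq_comp_inv, famMap_star]

variable {k : ℕ} {Δ Δ' : Ctx S A n} {Γ₀ Γ₀' : Ctx S A n} {Γ Γ' : Fin k → Ctx S A n}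

/-- Morphisms into a tensor product are handled through this bijection, with inverse `ofTens`: on
the side of families both `star` and `tensorMap₀` become instances of `FCtx.tensMap`, which has a
single composition law. -/
def toTens (η : Δ ⟶ tensor₀ Γ₀ Γ) : fam Δ ⟶ FCtx.tens (fam Γ₀) fun j => fam (Γ j) :=
  famMap η ≫ (tensIso Γ₀ Γ).hom

def ofTens (η : fam Δ ⟶ FCtx.tens (fam Γ₀) fun j => fam (Γ j)) : Δ ⟶ tensor₀ Γ₀ Γ :=
  famPre (η ≫ (tensIso Γ₀ Γ).inv)

@[simp] theorem toTens_ofTens (η : fam Δ ⟶ FCtx.tens (fam Γ₀) fun j => fam (Γ j)) :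
    toTens (ofTens η) = η := by simp [toTens, ofTens]

@[simp] theorem ofTens_toTens (η : Δ ⟶ tensor₀ Γ₀ Γ) : ofTens (toTens η) = η := by
  simp [toTens, ofTens]

@[simp] theorem toTens_comp (θ : Δ' ⟶ Δ) (η : Δ ⟶ tensor₀ Γ₀ Γ) :
    toTens (θ ≫ η) = famMap θ ≫ toTens η := by simp [toTens]

theorem toTens_id : toTens (𝟙 (tensor₀ Γ₀ Γ)) = (tensIso Γ₀ Γ).hom := by simp [toTens]

theorem toTens_injective : Function.Injective (toTens (Δ := Δ) (Γ₀ := Γ₀) (Γ := Γ)) :=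
  Function.LeftInverse.injective ofTens_toTens

@[simp] theorem toTens_comp_star {k' : ℕ} (η : Δ ⟶ tensor₀ Γ₀ Γ) (α : Fin k' → Fin k)
    (hα : S.Adm α) :
    toTens (η ≫ star α hα Γ₀ Γ) =
      toTens η ≫ FCtx.tensMap (𝟙 _) α hα (Θ := fun j => fam (Γ j))
        fun j => 𝟙 (fam (Γ (α j))) := by
  rw [toTens, famMap_comp, Category.assoc, famMap_star, ← Category.assoc]; rfl

@[simp] theorem toTens_comp_tensorMap₀ (η : Δ ⟶ tensor₀ Γ₀ Γ) (θ₀ : Γ₀ ⟶ Γ₀')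
    (θ : ∀ j, Γ j ⟶ Γ' j) :
    toTens (η ≫ tensorMap₀ θ₀ θ) =
      toTens η ≫ FCtx.tensMap (famMap θ₀) (fun j => j) (.id S _) fun j => famMap (θ j) := by
  rw [toTens, famMap_comp, Category.assoc, famMap_tensorMap₀, ← Category.assoc]; rfl

theorem ofTens_comp (θ : Δ' ⟶ Δ) (η : fam Δ ⟶ FCtx.tens (fam Γ₀) fun j => fam (Γ j)) :
    ofTens (famMap θ ≫ η) = θ ≫ ofTens η :=
  toTens_injective (by simp)

theorem ofTens_comp_star {k' : ℕ} (η : fam Δ ⟶ FCtx.tens (fam Γ₀) fun j => fam (Γ j))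
    (α : Fin k' → Fin k) (hα : S.Adm α) :
    ofTens (Γ := fun j => Γ (α j)) (η ≫ FCtx.tensMap (𝟙 _) α hα fun j => 𝟙 (fam (Γ (α j)))) =
      ofTens η ≫ star α hα Γ₀ Γ :=
  toTens_injective (by rw [toTens_comp_star]; simp)

theorem ofTens_comp_tensMap (η : fam Δ ⟶ FCtx.tens (fam Γ₀) fun j => fam (Γ j))
    (θ₀ : Γ₀ ⟶ Γ₀') (θ : ∀ j, Γ j ⟶ Γ' j) :
    ofTens (η ≫ FCtx.tensMap (famMap θ₀) (fun j => j) (.id S _) fun j => famMap (θ j)) =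
      ofTens η ≫ tensorMap₀ θ₀ θ :=
  toTens_injective (by rw [toTens_comp_tensorMap₀]; simp)

end Ctx

end ITD

namespace ITD

variable {S : Resource} {A : Type u} [SmallCategory A] {m n : ℕ}

/-! ### Isomorphisms of distributors -/

namespace Dist

/-- An isomorphism of distributors from equivariant bijections. -/
def isoMk {P Q : Dist S A n} (e : ∀ Δ a, P.at' Δ a ≃ Q.at' Δ a)
    (nat : ∀ {Δ Δ' : Ctx S A n} {a a' : Ty S A} (g : a ⟶ a') (η : Δ' ⟶ Δ) (x : P.at' Δ a),
      e Δ' a' (P.act g η x) = Q.act g η (e Δ a x)) : P ≅ Q :=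
  NatIso.ofComponents (fun X => (e X.1.unop X.2).toIso) fun f => by
    ext x
    exact nat f.2 f.1.unop x

/-- The bijections of an isomorphism of distributors. -/
def equivOfIso {P Q : Dist S A n} (i : P ≅ Q) (Δ : Ctx S A n) (a : Ty S A) :
    P.at' Δ a ≃ Q.at' Δ a :=
  (i.app (Opposite.op Δ, a)).toEquiv

theorem equivOfIso_act {P Q : Dist S A n} (i : P ≅ Q) {Δ Δ' : Ctx S A n} {a a' : Ty S A}
    (g : a ⟶ a') (η : Δ' ⟶ Δ) (x : P.at' Δ a) :
    equivOfIso i Δ' a' (P.act g η x) = Q.act g η (equivOfIso i Δ a x) :=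
  congrArg (fun k => (ConcreteCategory.hom k : P.at' Δ a → Q.at' Δ' a') x)
    (i.hom.naturality (Prod.mkHom η.op g : (Opposite.op Δ, a) ⟶ (Opposite.op Δ', a')))

def lamEquiv {P Q : Dist S A (n + 1)} (i : P ≅ Q) (Δ : Ctx S A n) :
    ∀ a, LamObj P Δ a ≃ LamObj Q Δ a
  | .atom _ => Equiv.refl _
  | .arr _ _ _ => equivOfIso i _ _

/-- Abstraction preserves isomorphisms. -/
def lamCongr {P Q : Dist S A (n + 1)} (i : P ≅ Q) : lam P ≅ lam Q :=
  isoMk (fun Δ a => lamEquiv i Δ a) fun {Δ Δ' a a'} g η x => by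
    change Ty.Hom a a' at g
    cases g with
    | atom f => exact PEmpty.elim x
    | arr α hα f g => exact equivOfIso_act i _ _ _

section App

variable {P Q P' Q' : Dist S A n}

def appMk {Δ : Ctx S A n} {a : Ty S A} (as : SList S (Ty S A)) (Γ₀ : Ctx S A n)
    (Γ : Fin as.len → Ctx S A n) (p : P.at' Γ₀ (Ty.arrow as a))
    (q : ∀ i, Q.at' (Γ i) (as.get i)) (η : Δ ⟶ Ctx.tensor₀ Γ₀ Γ) : (app P Q).at' Δ a :=
  Quot.mk (AppRel P Q Δ a) ⟨as, Γ₀, Γ, p, q, η⟩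

theorem appMk_surjective {Δ : Ctx S A n} {a : Ty S A} (x : (app P Q).at' Δ a) :
    ∃ as Γ₀ Γ p q η, appMk (P := P) (Q := Q) as Γ₀ Γ p q η = x := by
  obtain ⟨⟨as, Γ₀, Γ, p, q, η⟩⟩ := x
  exact ⟨as, Γ₀, Γ, p, q, η, rfl⟩

@[simp]
theorem act_appMk {Δ Δ' : Ctx S A n} {a a' : Ty S A} (g : a ⟶ a') (θ : Δ' ⟶ Δ)
    (as : SList S (Ty S A)) (Γ₀ : Ctx S A n)
    (Γ : Fin as.len → Ctx S A n) (p : P.at' Γ₀ (Ty.arrow as a))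
    (q : ∀ i, Q.at' (Γ i) (as.get i)) (η : Δ ⟶ Ctx.tensor₀ Γ₀ Γ) :
    (app P Q).act g θ (appMk as Γ₀ Γ p q η) =
      appMk as Γ₀ Γ (P.act (Ty.arrowMap (𝟙 _) g) (𝟙 _) p) q (θ ≫ η) := rfl

theorem appMk_types {Δ : Ctx S A n} {a : Ty S A} {as bs : SList S (Ty S A)} (φ : as ⟶ bs)
    (Γ₀ : Ctx S A n) (Γ : Fin as.len → Ctx S A n) (p : P.at' Γ₀ (Ty.arrow bs a))
    (q : ∀ i, Q.at' (Γ i) (as.get i)) (η : Δ ⟶ Ctx.tensor₀ Γ₀ Γ) :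
    appMk bs Γ₀ (fun i => Γ (φ.idx i)) p (fun i => Q.act (φ.map i) (𝟙 _) (q (φ.idx i)))
        (η ≫ Ctx.star φ.idx φ.adm Γ₀ Γ) =
      appMk as Γ₀ Γ (P.act (Ty.arrowMap φ (𝟙 a)) (𝟙 _) p) q η :=
  Quot.sound (.types φ Γ₀ Γ p q η)

theorem appMk_contexts {Δ : Ctx S A n} {a : Ty S A} {as : SList S (Ty S A)}
    {Γ₀ Γ₀' : Ctx S A n} {Γ Γ' : Fin as.len → Ctx S A n}
    (θ₀ : Γ₀ ⟶ Γ₀') (θ : ∀ i, Γ i ⟶ Γ' i) (p : P.at' Γ₀' (Ty.arrow as a))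
    (q : ∀ i, Q.at' (Γ' i) (as.get i)) (η : Δ ⟶ Ctx.tensor₀ Γ₀ Γ) :
    appMk as Γ₀ Γ (P.act (𝟙 _) θ₀ p) (fun i => Q.act (𝟙 _) (θ i) (q i)) η =
      appMk as Γ₀' Γ' p q (η ≫ Ctx.tensorMap₀ θ₀ θ) :=
  Quot.sound (.contexts θ₀ θ p q η)

def appLift {Δ : Ctx S A n} {a : Ty S A} {Z : Type*} (f : AppPre P Q Δ a → Z)
    (types : ∀ {as bs : SList S (Ty S A)} (φ : as ⟶ bs) (Γ₀ : Ctx S A n)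
      (Γ : Fin as.len → Ctx S A n) (p : P.at' Γ₀ (Ty.arrow bs a))
      (q : ∀ i, Q.at' (Γ i) (as.get i)) (η : Δ ⟶ Ctx.tensor₀ Γ₀ Γ),
      f ⟨bs, Γ₀, fun i => Γ (φ.idx i), p, fun i => Q.act (φ.map i) (𝟙 _) (q (φ.idx i)),
          η ≫ Ctx.star φ.idx φ.adm Γ₀ Γ⟩ =
        f ⟨as, Γ₀, Γ, P.act (Ty.arrowMap φ (𝟙 a)) (𝟙 _) p, q, η⟩)
    (contexts : ∀ {as : SList S (Ty S A)} {Γ₀ Γ₀' : Ctx S A n}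
      {Γ Γ' : Fin as.len → Ctx S A n} (θ₀ : Γ₀ ⟶ Γ₀') (θ : ∀ i, Γ i ⟶ Γ' i)
      (p : P.at' Γ₀' (Ty.arrow as a)) (q : ∀ i, Q.at' (Γ' i) (as.get i))
      (η : Δ ⟶ Ctx.tensor₀ Γ₀ Γ),
      f ⟨as, Γ₀, Γ, P.act (𝟙 _) θ₀ p, fun i => Q.act (𝟙 _) (θ i) (q i), η⟩ =
        f ⟨as, Γ₀', Γ', p, q, η ≫ Ctx.tensorMap₀ θ₀ θ⟩) :
    (app P Q).at' Δ a → Z :=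
  Quot.lift f fun _ _ h => by
    cases h with
    | types φ Γ₀ Γ p q η => exact types φ Γ₀ Γ p q η
    | contexts θ₀ θ p q η => exact contexts θ₀ θ p q η

def appMap (i : P ≅ P') (j : Q ≅ Q') (Δ : Ctx S A n) (a : Ty S A) :
    (app P Q).at' Δ a → (app P' Q').at' Δ a :=
  appLift (fun x => appMk x.as x.Γ₀ x.Γ (equivOfIso i _ _ x.p) (fun t => equivOfIso j _ _ (x.q t))
      x.η)
    (by
      intro as bs φ Γ₀ Γ p q η
      simp only [equivOfIso_act]
      exact appMk_types φ Γ₀ Γ (equivOfIso i _ _ p) (fun t => equivOfIso j _ _ (q t)) η)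
    (by
      intro as Γ₀ Γ₀' Γ Γ' θ₀ θ p q η
      simp only [equivOfIso_act]
      exact appMk_contexts θ₀ θ (equivOfIso i _ _ p) (fun t => equivOfIso j _ _ (q t)) η)

/-- Application preserves isomorphisms. -/
def appCongr (i : P ≅ P') (j : Q ≅ Q') : app P Q ≅ app P' Q' :=
  isoMk (fun Δ a =>
    { toFun := appMap i j Δ a
      invFun := appMap i.symm j.symm Δ a
      left_inv := by
        rintro ⟨x⟩
        refine Eq.trans (b := appMk x.as x.Γ₀ x.Γ
          ((equivOfIso i _ _).symm (equivOfIso i _ _ x.p))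
          (fun t => (equivOfIso j _ _).symm (equivOfIso j _ _ (x.q t))) x.η) rfl ?_
        simp only [Equiv.symm_apply_apply]
        rfl
      right_inv := by
        rintro ⟨x⟩
        refine Eq.trans (b := appMk x.as x.Γ₀ x.Γ
          (equivOfIso i _ _ ((equivOfIso i _ _).symm x.p))
          (fun t => equivOfIso j _ _ ((equivOfIso j _ _).symm (x.q t))) x.η) rfl ?_
        simp only [Equiv.apply_symm_apply]
        rfl })
    (by
      rintro Δ Δ' a a' g η ⟨x⟩
      refine Eq.trans (b := appMk x.as x.Γ₀ x.Γ (equivOfIso i _ _ (P.act _ _ x.p))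
        (fun t => equivOfIso j _ _ (x.q t)) (η ≫ x.η)) rfl ?_
      rw [equivOfIso_act]
      rfl)

end App

/-- The distributor that ignores the first entry of the context. -/
def wk (Q : Dist S A n) : Dist S A (n + 1) :=
  ofAction (fun Δ a => (Fam.ofList (Δ 0) ⟶ Fam.empty) × Q.at' (Ctx.tail Δ) a)
    (fun g η x => (Fam.ofListMap (η 0) ≫ x.1, Q.act g (Ctx.tailMap η) x.2))
    (fun x => Prod.ext (Subsingleton.elim _ _) (Q.act_id x.2))
    (fun _ _ _ _ _ => Prod.ext (Subsingleton.elim _ _) (Q.act_act _ _ _ _ _).symm)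

def wkCongr {P Q : Dist S A n} (i : P ≅ Q) : wk P ≅ wk Q :=
  isoMk (fun _ _ => (Equiv.refl _).prodCongr (equivOfIso i _ _)) fun _ _ _ =>
    Prod.ext rfl (equivOfIso_act i _ _ _)

end Dist

/-! ### Profunctors between categories of contexts -/

/-- Profunctors from contexts in `m` variables to contexts in `n` variables. -/
structure Prof (S : Resource) (A : Type u) [SmallCategory A] (m n : ℕ) where
  obj : Ctx S A n → FCtx S A m → Type u
  act : ∀ {Δ Δ' : Ctx S A n} {Θ Θ' : FCtx S A m}, (Θ ⟶ Θ') → (Δ' ⟶ Δ) → obj Δ Θ → obj Δ' Θ'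
  act_id : ∀ {Δ : Ctx S A n} {Θ : FCtx S A m} (e : obj Δ Θ), act (𝟙 Θ) (𝟙 Δ) e = e
  act_act : ∀ {Δ Δ' Δ'' : Ctx S A n} {Θ Θ' Θ'' : FCtx S A m} (f : Θ ⟶ Θ') (g : Θ' ⟶ Θ'')
    (η : Δ' ⟶ Δ) (θ : Δ'' ⟶ Δ') (e : obj Δ Θ),
    act g θ (act f η e) = act (f ≫ g) (θ ≫ η) e

namespace Prof

open Ctx (fam famMap)

/-- The summands of the coend `∫^Θ P(Θ, a) × E(Δ, Θ)`. -/
structure CompPre (P : Dist S A m) (E : Prof S A m n) (Δ : Ctx S A n) (a : Ty S A) :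
    Type u where
  Θ : Ctx S A m
  p : P.at' Θ a
  e : E.obj Δ (fam Θ)

inductive CompRel (P : Dist S A m) (E : Prof S A m n) (Δ : Ctx S A n) (a : Ty S A) :
    CompPre P E Δ a → CompPre P E Δ a → Prop
  | mk {Θ Θ' : Ctx S A m} (θ : Θ ⟶ Θ') (p : P.at' Θ' a) (e : E.obj Δ (fam Θ)) :
      CompRel P E Δ a ⟨Θ, P.act (𝟙 _) θ p, e⟩ ⟨Θ', p, E.act (famMap θ) (𝟙 _) e⟩

/-- The composite `∫^Θ P(Θ, a) × E(Δ, Θ)`. -/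
def comp (P : Dist S A m) (E : Prof S A m n) : Dist S A n :=
  Dist.ofAction (fun Δ a => Quot (CompRel P E Δ a))
    (fun g η => Quot.map (fun x => ⟨x.Θ, P.act g (𝟙 _) x.p, E.act (𝟙 _) η x.e⟩) (by
      rintro _ _ ⟨θ, p, e⟩
      have h := CompRel.mk (P := P) θ (P.act g (𝟙 _) p) (E.act (𝟙 _) η e)
      simpa [Dist.act_act, E.act_act] using h))
    (by
      rintro Δ a ⟨x⟩
      refine congrArg (Quot.mk _) ?_
      simp [Dist.act_id, E.act_id])
    (by
      rintro Δ Δ' Δ'' a a' a'' f g η θ ⟨x⟩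
      refine congrArg (Quot.mk _) ?_
      simp [Dist.act_act, E.act_act])

variable {P : Dist S A m} {E : Prof S A m n}

def compMk {Δ : Ctx S A n} {a : Ty S A} (Θ : Ctx S A m) (p : P.at' Θ a)
    (e : E.obj Δ (fam Θ)) : (comp P E).at' Δ a :=
  Quot.mk (CompRel P E Δ a) ⟨Θ, p, e⟩

@[simp]
theorem act_compMk {Δ Δ' : Ctx S A n} {a a' : Ty S A} (g : a ⟶ a') (η : Δ' ⟶ Δ)
    (Θ : Ctx S A m) (p : P.at' Θ a) (e : E.obj Δ (fam Θ)) :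
    (comp P E).act g η (compMk Θ p e) = compMk Θ (P.act g (𝟙 _) p) (E.act (𝟙 _) η e) := rfl

theorem compMk_act {Δ : Ctx S A n} {a : Ty S A} {Θ Θ' : Ctx S A m} (θ : Θ ⟶ Θ')
    (p : P.at' Θ' a) (e : E.obj Δ (fam Θ)) :
    compMk (P := P) Θ (P.act (𝟙 _) θ p) e = compMk Θ' p (E.act (famMap θ) (𝟙 _) e) :=
  Quot.sound ⟨θ, p, e⟩

def compLift {Δ : Ctx S A n} {a : Ty S A} {Z : Type*}
    (f : ∀ Θ : Ctx S A m, P.at' Θ a → E.obj Δ (fam Θ) → Z)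
    (hf : ∀ {Θ Θ' : Ctx S A m} (θ : Θ ⟶ Θ') (p : P.at' Θ' a) (e : E.obj Δ (fam Θ)),
      f Θ (P.act (𝟙 _) θ p) e = f Θ' p (E.act (famMap θ) (𝟙 _) e)) :
    (comp P E).at' Δ a → Z :=
  Quot.lift (fun x => f x.Θ x.p x.e) fun _ _ h => by
    cases h with
    | mk θ p e => exact hf θ p e

theorem compMk_surjective {Δ : Ctx S A n} {a : Ty S A} (x : (comp P E).at' Δ a) :
    ∃ Θ p e, compMk (P := P) (E := E) Θ p e = x := by
  obtain ⟨⟨Θ, p, e⟩⟩ := x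
  exact ⟨Θ, p, e, rfl⟩

/-- Take the identity for the morphism of contexts. Reflexivity is what `quotLift₂_mk` asks of the
relation. -/
theorem CompRel.refl {Δ : Ctx S A n} {a : Ty S A} (x : CompPre P E Δ a) :
    CompRel P E Δ a x x := by
  obtain ⟨Θ, p, e⟩ := x
  have h := CompRel.mk (𝟙 Θ) p e
  rwa [P.act_id, Ctx.famMap_id, E.act_id] at h

/-- The inversion is stated with equations so that, for a family of related pairs, all the morphisms
can be chosen at once. -/
theorem CompRel.exists_eq {Δ : Ctx S A n} {a : Ty S A} {x y : CompPre P E Δ a}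
    (h : CompRel P E Δ a x y) :
    ∃ θ : x.Θ ⟶ y.Θ, x.p = P.act (𝟙 _) θ y.p ∧ y.e = E.act (famMap θ) (𝟙 _) x.e := by
  cases h
  exact ⟨_, rfl, rfl⟩

/-- The restriction of `E` to the contexts `⟨⟨⟩, …, ⟨a⟩, …, ⟨⟩⟩`. -/
def atVar (E : Prof S A m n) (pos : Fin m → Prop) : Dist S A n :=
  Dist.ofAction
    (fun Δ a => (p : {p : Fin m // pos p}) × E.obj Δ (fam (Ctx.single (p : Fin m) a)))
    (fun g η x => ⟨x.1, E.act (famMap (Ctx.singleMap _ g)) η x.2⟩)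
    (by
      rintro Δ a ⟨p, x⟩
      exact congrArg (Sigma.mk p) (E.act_id x))
    (by
      rintro Δ Δ' Δ'' a a' a'' f g η θ ⟨p, x⟩
      exact congrArg (Sigma.mk p) (E.act_act (famMap (Ctx.singleMap _ f))
        (famMap (Ctx.singleMap _ g)) η θ x).symm)

/-- Composition with a variable is restriction. -/
def compVarIso (E : Prof S A m n) (pos : Fin m → Prop) :
    comp (Dist.var pos) E ≅ E.atVar pos :=
  Dist.isoMk (fun Δ a =>
    { toFun := compLift (fun Θ p e => ⟨p.1, E.act (famMap p.2) (𝟙 _) e⟩) (by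
        rintro Θ Θ' θ ⟨p, f⟩ e
        refine congrArg (Sigma.mk p) ?_
        show E.act (famMap (θ ≫ f ≫ 𝟙 _)) (𝟙 _) e =
          E.act (famMap f) (𝟙 _) (E.act (famMap θ) (𝟙 _) e)
        rw [E.act_act]
        simp)
      invFun := fun x => compMk (P := Dist.var pos) (Ctx.single (x.1 : Fin m) a) ⟨x.1, 𝟙 _⟩ x.2
      left_inv := by
        rintro ⟨Θ, ⟨p, f⟩, e⟩
        -- Co-Yoneda: the variable `f` is the universal element `𝟙` acted on by `f`, and the coend
        -- relation moves `f` between the two factors.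
        refine (compMk_act (P := Dist.var pos) f ⟨p, 𝟙 _⟩ e).symm.trans ?_
        refine congrArg (fun q => compMk (P := Dist.var pos) Θ q e) ?_
        refine congrArg (Sigma.mk p) ?_
        show f ≫ 𝟙 _ ≫ 𝟙 _ = f
        simp
      right_inv := by
        rintro ⟨p, e⟩
        exact congrArg (Sigma.mk p) (E.act_id e) })
    (by
      rintro Δ Δ' a a' g η ⟨Θ, ⟨p, f⟩, e⟩
      refine congrArg (Sigma.mk p) ?_
      show E.act (famMap (𝟙 _ ≫ f ≫ Ctx.singleMap _ g)) (𝟙 _) (E.act (𝟙 _) η e) =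
        E.act (famMap (Ctx.singleMap _ g)) η (E.act (famMap f) (𝟙 _) e)
      simp [E.act_act])

/-- The extension of a profunctor by one variable. -/
def lift (E : Prof S A m n) : Prof S A (m + 1) (n + 1) where
  obj Δ Θ := (Fam.ofList (Δ 0) ⟶ Θ 0) × E.obj (Ctx.tail Δ) (FCtx.tail Θ)
  act f η e := (Fam.ofListMap (η 0) ≫ e.1 ≫ f 0, E.act (FCtx.tailMap f) (Ctx.tailMap η) e.2)
  act_id e := Prod.ext ((Category.id_comp _).trans (Category.comp_id _)) (E.act_id e.2)
  act_act f g η θ e := Prod.ext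
    (by
      show Fam.ofListMap (θ 0) ≫ (Fam.ofListMap (η 0) ≫ e.1 ≫ f 0) ≫ g 0 =
        (Fam.ofListMap (θ 0) ≫ Fam.ofListMap (η 0)) ≫ e.1 ≫ f 0 ≫ g 0
      simp only [Category.assoc])
    (E.act_act _ _ _ _ e.2)

end Prof

namespace Ctx

/-- A morphism of contexts that is the identity except at the first variable. -/
def headMap {as : SList S (Ty S A)} {Θ : Ctx S A (n + 1)} (h : as ⟶ Θ 0) :
    ext as (tail Θ) ⟶ Θ :=
  Fin.cases (motive := fun i => ext as (tail Θ) i ⟶ Θ i) h fun i => 𝟙 (Θ i.succ)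

/-- The tail of `θ` moves to the front and its head is absorbed into `h`. This separates the part of
a morphism seen by an abstraction from the part seen by `E` alone. -/
theorem headMap_comp {as : SList S (Ty S A)} {Θ Θ' : Ctx S A (n + 1)} (h : as ⟶ Θ 0)
    (θ : Θ ⟶ Θ') :
    headMap h ≫ θ = extMap (𝟙 as) (tailMap θ) ≫ headMap (h ≫ θ 0) := by
  funext i
  refine Fin.cases ?_ (fun i => ?_) i
  · exact (Category.id_comp (h ≫ θ 0)).symm
  · exact (Category.id_comp (θ i.succ)).trans (Category.comp_id (θ i.succ)).symm

theorem extMap_headMap {as as' : SList S (Ty S A)} {Θ : Ctx S A (n + 1)} (φ : as' ⟶ as)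
    (h : as ⟶ Θ 0) :
    extMap φ (𝟙 (tail Θ)) ≫ headMap h = headMap (φ ≫ h) := by
  funext i
  refine Fin.cases ?_ (fun i => ?_) i
  · rfl
  · exact Category.comp_id (𝟙 (Θ i.succ))

theorem headMap_eq_extMap {as as' : SList S (Ty S A)} {Θ : Ctx S A n} (h : as ⟶ as') :
    headMap (Θ := ext as' Θ) h = extMap h (𝟙 Θ) := by
  funext i
  exact Fin.cases rfl (fun _ => rfl) i

end Ctx

namespace Prof

open Ctx (fam famMap)

variable {E : Prof S A m n}

def compLamToFun (P : Dist S A (m + 1)) (E : Prof S A m n) (Δ : Ctx S A n)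
    (as : SList S (Ty S A)) (b : Ty S A) :
    (comp (Dist.lam P) E).at' Δ (Ty.arrow as b) → (comp P E.lift).at' (Ctx.ext as Δ) b :=
  compLift (fun Θ (p : P.at' (Ctx.ext as Θ) b) e =>
      compMk (P := P) (E := E.lift) (Ctx.ext as Θ) p (𝟙 (Fam.ofList as), e)) (by
    intro Θ Θ' θ p e
    change P.at' (Ctx.ext as Θ') b at p
    refine (compMk_act (P := P) (E := E.lift) (Ctx.extMap (𝟙 as) θ) p _).trans ?_
    refine congrArg (compMk (P := P) (E := E.lift) (Ctx.ext as Θ') p) (Prod.ext ?_ rfl)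
    exact (Category.id_comp (𝟙 (Fam.ofList as) ≫ 𝟙 (Fam.ofList as))).trans (Category.id_comp _))

/-- In the composite with `E.lift` the new variable contributes a morphism `as ⟶ Θ 0`. Letting it
act on `p` by `headMap` normalises it to an identity, and a coend over the remaining `m` variables
is left. -/
def compLamInv (P : Dist S A (m + 1)) (E : Prof S A m n) (Δ : Ctx S A n)
    (as : SList S (Ty S A)) (b : Ty S A) :
    (comp P E.lift).at' (Ctx.ext as Δ) b → (comp (Dist.lam P) E).at' Δ (Ty.arrow as b) :=
  compLift (fun Θ p e => compMk (P := Dist.lam P) (Ctx.tail Θ)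
      (P.act (𝟙 b) (Ctx.headMap (as := as) (Fam.ofListPre e.1)) p) e.2) (by
    intro Θ Θ' θ p e
    have h : Fam.ofListPre (a := as) (b := Θ' 0) (E.lift.act (famMap θ) (𝟙 (Ctx.ext as Δ)) e).1 =
        Fam.ofListPre e.1 ≫ θ 0 :=
      congrArg Fam.ofListPre (Category.id_comp (e.1 ≫ famMap θ 0))
    rw [h]
    refine Eq.trans ?_ (compMk_act (P := Dist.lam P) (a := Ty.arrow as b) (Ctx.tailMap θ)
      (P.act (𝟙 b) (Ctx.headMap (as := as) (Fam.ofListPre e.1 ≫ θ 0)) p :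
        P.at' (Ctx.ext as (Ctx.tail Θ')) b) e.2)
    refine congrArg (fun q => compMk (P := Dist.lam P) (Ctx.tail Θ) q e.2) ?_
    show P.act (𝟙 b) _ (P.act (𝟙 b) θ p) =
      P.act (𝟙 b) (Ctx.extMap (𝟙 as) (Ctx.tailMap θ)) (P.act (𝟙 b) _ p)
    rw [P.act_act, P.act_act, Ctx.headMap_comp])

def compLamEquiv (P : Dist S A (m + 1)) (E : Prof S A m n) (Δ : Ctx S A n) :
    ∀ a, (comp (Dist.lam P) E).at' Δ a ≃ Dist.LamObj (comp P E.lift) Δ a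
  | .atom _ =>
    { toFun := compLift (fun _ p _ => PEmpty.elim p) (fun _ p _ => PEmpty.elim p)
      invFun := fun x => PEmpty.elim x
      left_inv := by rintro ⟨_, p, _⟩; exact PEmpty.elim p
      right_inv := fun x => PEmpty.elim x }
  | .arr k as b =>
    { toFun := compLamToFun P E Δ ⟨k, as⟩ b
      invFun := compLamInv P E Δ ⟨k, as⟩ b
      left_inv := by
        rintro ⟨Θ, p, e⟩
        change P.at' (Ctx.ext ⟨k, as⟩ Θ) b at p
        refine congrArg (fun q => compMk (P := Dist.lam P) Θ q e) ?_
        refine Eq.trans ?_ (P.act_id p)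
        refine congrArg (fun θ => P.act (𝟙 b) θ p) ?_
        exact (Ctx.headMap_eq_extMap _).trans (Ctx.extMap_id ⟨k, as⟩ Θ)
      right_inv := by
        rintro ⟨Θ, p, h, e⟩
        -- The coend relation returns `h` from `p` to the component of `E.lift` at the new variable.
        refine (compMk_act (P := P) (E := E.lift) (Ctx.headMap (as := ⟨k, as⟩) (Fam.ofListPre h))
          p (𝟙 _, e)).trans ?_
        refine congrArg (compMk (P := P) (E := E.lift) Θ p) (Prod.ext ?_ (E.act_id e))
        show Fam.ofListMap (𝟙 _) ≫ 𝟙 _ ≫ h = h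
        exact (Category.id_comp _).trans (Category.id_comp _) }

/-- Composition commutes with abstraction. -/
def compLamIso (P : Dist S A (m + 1)) (E : Prof S A m n) :
    comp (Dist.lam P) E ≅ Dist.lam (comp P E.lift) :=
  Dist.isoMk (fun Δ a => compLamEquiv P E Δ a) (by
    rintro Δ Δ' a a' g η ⟨Θ, p, e⟩
    change Ty.Hom a a' at g
    cases g with
    | atom f => exact PEmpty.elim p
    | @arr k k' as as' a a' α hα f g =>
      change P.at' (Ctx.ext ⟨k, as⟩ Θ) a at p
      let φ : (⟨k', as'⟩ : SList S (Ty S A)) ⟶ ⟨k, as⟩ := ⟨α, hα, f⟩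
      let e' : E.obj Δ' (fam Θ) := E.act (𝟙 (fam Θ)) η e
      show compMk (P := P) (E := E.lift) (Δ := Ctx.ext ⟨k', as'⟩ Δ') (Ctx.ext ⟨k', as'⟩ Θ)
          (P.act g (Ctx.extMap φ (𝟙 _)) p) (𝟙 _, e') =
        compMk (P := P) (E := E.lift) (Δ := Ctx.ext ⟨k', as'⟩ Δ') (Ctx.ext ⟨k, as⟩ Θ)
          (P.act g (𝟙 _) p) (Fam.ofListMap φ ≫ 𝟙 _ ≫ 𝟙 _, e')
      have h : P.act g (Ctx.extMap φ (𝟙 _)) p =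
          P.act (𝟙 _) (Ctx.extMap φ (𝟙 _)) (P.act g (𝟙 _) p) := by simp [P.act_act]
      rw [h]
      -- The list part `φ` of the morphism of arrow types acts on `p` on one side and on the new
      -- component of `E.lift` on the other; the coend relation at `extMap φ 1` exchanges the two.
      refine (compMk_act (P := P) (E := E.lift) (Δ := Ctx.ext ⟨k', as'⟩ Δ')
        (Ctx.extMap φ (𝟙 Θ)) (P.act g (𝟙 _) p) (𝟙 _, e')).trans ?_
      refine congrArg (compMk (P := P) (E := E.lift) _ _) (Prod.ext ?_ ?_)
      · show 𝟙 _ ≫ 𝟙 _ ≫ Fam.ofListMap φ = Fam.ofListMap φ ≫ 𝟙 _ ≫ 𝟙 _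
        simp
      · exact E.act_id _)

end Prof
end ITD

namespace ITD

variable {S : Resource} {A : Type u} [SmallCategory A] {m n : ℕ}

/-! ### Monoidal profunctors -/

namespace Prof

open Ctx (fam famMap)

/-- The summands of the coend `∫^{Δ₀, …, Δ_k} ∏_j E(Δ_j, Θ_j) × (S D)ⁿ(Δ, Δ₀ ⊗ ⋯ ⊗ Δ_k)`. -/
structure Split (E : Prof S A m n) {k : ℕ} (Δ : Ctx S A n) (Θ₀ : Ctx S A m)
    (Θ : Fin k → Ctx S A m) : Type u where
  Δ₀ : Ctx S A n
  Δs : Fin k → Ctx S A n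
  η : fam Δ ⟶ FCtx.tens (fam Δ₀) fun j => fam (Δs j)
  e₀ : E.obj Δ₀ (fam Θ₀)
  e : ∀ j, E.obj (Δs j) (fam (Θ j))

inductive SplitRel (E : Prof S A m n) {k : ℕ} (Δ : Ctx S A n) (Θ₀ : Ctx S A m)
    (Θ : Fin k → Ctx S A m) : E.Split Δ Θ₀ Θ → E.Split Δ Θ₀ Θ → Prop
  | mk {Δ₀ Δ₀' : Ctx S A n} {Δs Δs' : Fin k → Ctx S A n} (θ₀ : Δ₀ ⟶ Δ₀')
      (θ : ∀ j, Δs j ⟶ Δs' j) (η : fam Δ ⟶ FCtx.tens (fam Δ₀) fun j => fam (Δs j))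
      (e₀ : E.obj Δ₀' (fam Θ₀)) (e : ∀ j, E.obj (Δs' j) (fam (Θ j))) :
      SplitRel E Δ Θ₀ Θ ⟨Δ₀, Δs, η, E.act (𝟙 _) θ₀ e₀, fun j => E.act (𝟙 _) (θ j) (e j)⟩
        ⟨Δ₀', Δs', η ≫ FCtx.tensMap (famMap θ₀) (fun j => j) (.id S _) fun j => famMap (θ j),
          e₀, e⟩

/-- Profunctors that commute with tensor products of contexts: the elements of `E(Δ, ⨂_j Θ_j)`
are the elements of `∫^{Δ₀, …, Δ_k} ∏_j E(Δ_j, Θ_j) × (S D)ⁿ(Δ, ⨂_j Δ_j)`. -/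
structure Monoidal (E : Prof S A m n) where
  mul : ∀ {k : ℕ} {Δ : Ctx S A n} {Θ₀ : Ctx S A m} {Θ : Fin k → Ctx S A m},
    E.Split Δ Θ₀ Θ → E.obj Δ (FCtx.tens (fam Θ₀) fun j => fam (Θ j))
  mul_rel : ∀ {k : ℕ} {Δ : Ctx S A n} {Θ₀ : Ctx S A m} {Θ : Fin k → Ctx S A m}
    {r r' : E.Split Δ Θ₀ Θ}, SplitRel E Δ Θ₀ Θ r r' → mul r = mul r'
  mul_inj : ∀ {k : ℕ} {Δ : Ctx S A n} {Θ₀ : Ctx S A m} {Θ : Fin k → Ctx S A m}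
    {r r' : E.Split Δ Θ₀ Θ}, mul r = mul r' →
      Quot.mk (SplitRel E Δ Θ₀ Θ) r = Quot.mk (SplitRel E Δ Θ₀ Θ) r'
  mul_surj : ∀ {k : ℕ} {Δ : Ctx S A n} {Θ₀ : Ctx S A m} {Θ : Fin k → Ctx S A m}
    (e : E.obj Δ (FCtx.tens (fam Θ₀) fun j => fam (Θ j))), ∃ r : E.Split Δ Θ₀ Θ, mul r = e
  act_mul : ∀ {k k' : ℕ} {Δ Δ' : Ctx S A n} {Θ₀ Θ₀' : Ctx S A m} {Θ : Fin k → Ctx S A m}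
    {Θ' : Fin k' → Ctx S A m} (φ₀ : Θ₀ ⟶ Θ₀') (α : Fin k' → Fin k) (hα : S.Adm α)
    (φ : ∀ j, Θ (α j) ⟶ Θ' j) (ζ : Δ' ⟶ Δ) (r : E.Split Δ Θ₀ Θ),
    E.act (FCtx.tensMap (famMap φ₀) α hα fun j => famMap (φ j)) ζ (mul r) =
      mul ⟨r.Δ₀, fun j => r.Δs (α j),
        famMap ζ ≫ r.η ≫ FCtx.tensMap (𝟙 _) α hα fun j => 𝟙 (fam (r.Δs (α j))),
        E.act (famMap φ₀) (𝟙 _) r.e₀, fun j => E.act (famMap (φ j)) (𝟙 _) (r.e (α j))⟩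
  subsingleton : ∀ (Δ : Ctx S A n) (Θ : FCtx S A m) [∀ v, IsEmpty (Θ v).I],
    Subsingleton (E.obj Δ Θ)
  toEmpty : ∀ {Δ : Ctx S A n} {Θ : FCtx S A m} [∀ v, IsEmpty (Θ v).I],
    E.obj Δ Θ → (fam Δ ⟶ FCtx.empty S A n)
  ofEmpty : ∀ {Δ : Ctx S A n} {Θ : FCtx S A m} [∀ v, IsEmpty (Θ v).I],
    (fam Δ ⟶ FCtx.empty S A n) → E.obj Δ Θ

namespace Monoidal

variable {P P' : Dist S A m} {E : Prof S A m n}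

theorem act_tensMap_mul (hE : E.Monoidal) {k : ℕ} {Δ : Ctx S A n} {Θ₀ Θ₀' : Ctx S A m}
    {Θ Θ' : Fin k → Ctx S A m} (φ₀ : Θ₀ ⟶ Θ₀') (φ : ∀ j, Θ j ⟶ Θ' j) (r : E.Split Δ Θ₀ Θ) :
    E.act (FCtx.tensMap (famMap φ₀) (fun j => j) (.id S _) fun j => famMap (φ j)) (𝟙 _)
        (hE.mul r) =
      hE.mul ⟨r.Δ₀, r.Δs, r.η, E.act (famMap φ₀) (𝟙 _) r.e₀,
        fun j => E.act (famMap (φ j)) (𝟙 _) (r.e j)⟩ := by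
  rw [hE.act_mul]
  simp

theorem act_star_mul (hE : E.Monoidal) {k k' : ℕ} {Δ : Ctx S A n} {Θ₀ : Ctx S A m}
    {Θ : Fin k → Ctx S A m} (α : Fin k' → Fin k) (hα : S.Adm α) (r : E.Split Δ Θ₀ Θ) :
    E.act (FCtx.tensMap (𝟙 _) α hα fun j => 𝟙 (fam (Θ (α j)))) (𝟙 _) (hE.mul r) =
      hE.mul ⟨r.Δ₀, fun j => r.Δs (α j),
        r.η ≫ FCtx.tensMap (𝟙 _) α hα fun j => 𝟙 (fam (r.Δs (α j))), r.e₀,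
        fun j => r.e (α j)⟩ := by
  have h := hE.act_mul (Θ' := fun j => Θ (α j)) (𝟙 Θ₀) α hα (fun j => 𝟙 (Θ (α j))) (𝟙 Δ) r
  simp only [Ctx.famMap_id, Category.id_comp, E.act_id] at h
  exact h

theorem act_left_mul (hE : E.Monoidal) {k : ℕ} {Δ Δ' : Ctx S A n} {Θ₀ : Ctx S A m}
    {Θ : Fin k → Ctx S A m} (ζ : Δ' ⟶ Δ) (r : E.Split Δ Θ₀ Θ) :
    E.act (𝟙 _) ζ (hE.mul r) = hE.mul ⟨r.Δ₀, r.Δs, famMap ζ ≫ r.η, r.e₀, r.e⟩ := by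
  have h := hE.act_mul (Θ' := Θ) (𝟙 Θ₀) (fun j => j) (.id S _) (fun j => 𝟙 (Θ j)) ζ r
  simpa [E.act_id] using h

variable {Δ : Ctx S A n} {a : Ty S A}

/-- The splitting distributes `E` over the function and its arguments, each receiving its own
factor. -/
def appOfSplit (as : SList S (Ty S A)) {Γ₀ : Ctx S A m} {Γ : Fin as.len → Ctx S A m}
    (p : P.at' Γ₀ (Ty.arrow as a)) (q : ∀ i, P'.at' (Γ i) (as.get i)) (r : E.Split Δ Γ₀ Γ) :
    (Dist.app (comp P E) (comp P' E)).at' Δ a :=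
  Dist.appMk as r.Δ₀ r.Δs (compMk Γ₀ p r.e₀) (fun i => compMk (Γ i) (q i) (r.e i))
    (Ctx.ofTens r.η)

theorem appOfSplit_rel (as : SList S (Ty S A)) {Γ₀ : Ctx S A m} {Γ : Fin as.len → Ctx S A m}
    (p : P.at' Γ₀ (Ty.arrow as a)) (q : ∀ i, P'.at' (Γ i) (as.get i)) {r r' : E.Split Δ Γ₀ Γ}
    (h : SplitRel E Δ Γ₀ Γ r r') : appOfSplit as p q r = appOfSplit as p q r' := by
  cases h with
  | mk θ₀ θ η e₀ e =>
    have h := Dist.appMk_contexts (P := comp P E) (Q := comp P' E) θ₀ θ (compMk Γ₀ p e₀)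
      (fun i => compMk (Γ i) (q i) (e i)) (Ctx.ofTens η)
    simp only [act_compMk, Dist.act_id] at h
    rw [← Ctx.ofTens_comp_tensMap] at h
    exact h

noncomputable def appOfMul (hE : E.Monoidal) (as : SList S (Ty S A)) {Γ₀ : Ctx S A m}
    {Γ : Fin as.len → Ctx S A m}
    (p : P.at' Γ₀ (Ty.arrow as a)) (q : ∀ i, P'.at' (Γ i) (as.get i))
    (e : E.obj Δ (FCtx.tens (fam Γ₀) fun j => fam (Γ j))) :
    (Dist.app (comp P E) (comp P' E)).at' Δ a :=
  appOfSplit as p q (hE.mul_surj e).choose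

/-- The chosen preimage is immaterial: two splittings with the same product have the same class by
`mul_inj`, and `appOfSplit` is constant on classes by the relation on contexts of the application.
-/
theorem appOfMul_mul (hE : E.Monoidal) (as : SList S (Ty S A)) {Γ₀ : Ctx S A m}
    {Γ : Fin as.len → Ctx S A m}
    (p : P.at' Γ₀ (Ty.arrow as a)) (q : ∀ i, P'.at' (Γ i) (as.get i)) (r : E.Split Δ Γ₀ Γ) :
    appOfMul hE as p q (hE.mul r) = appOfSplit as p q r :=
  congrArg (Quot.lift (appOfSplit as p q) fun _ _ => appOfSplit_rel as p q)
    (hE.mul_inj (hE.mul_surj (hE.mul r)).choose_spec)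

/-- The morphism `η : Θ ⟶ Γ₀ ⊗ ⨂ᵢ Γᵢ` of the application pushes `e` to an element over the tensor
product, which the monoidal structure then splits. -/
noncomputable def compAppTo (hE : E.Monoidal) (P P' : Dist S A m) (Δ : Ctx S A n) (a : Ty S A) :
    (comp (Dist.app P P') E).at' Δ a → (Dist.app (comp P E) (comp P' E)).at' Δ a :=
  compLift (fun Θ x e => Dist.appLift (fun x : Dist.AppPre P P' Θ a =>
      appOfMul hE x.as x.p x.q (E.act (Ctx.toTens x.η) (𝟙 _) e))
    (by
      intro as bs φ Γ₀ Γ p q η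
      dsimp only
      obtain ⟨r, hr⟩ := hE.mul_surj (E.act (Ctx.toTens η) (𝟙 _) e)
      have h : E.act (Ctx.toTens (η ≫ Ctx.star φ.idx φ.adm Γ₀ Γ)) (𝟙 _) e =
          hE.mul ⟨r.Δ₀, fun j => r.Δs (φ.idx j),
            r.η ≫ FCtx.tensMap (𝟙 _) φ.idx φ.adm fun j => 𝟙 (fam (r.Δs (φ.idx j))), r.e₀,
            fun j => r.e (φ.idx j)⟩ := by
        rw [← act_star_mul, hr, E.act_act, Ctx.toTens_comp_star, Category.id_comp]
      rw [h, ← hr, appOfMul_mul, appOfMul_mul]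
      have := Dist.appMk_types (P := comp P E) (Q := comp P' E) φ r.Δ₀ r.Δs (compMk Γ₀ p r.e₀)
        (fun i => compMk (Γ i) (q i) (r.e i)) (Ctx.ofTens r.η)
      rw [← Ctx.ofTens_comp_star] at this
      simp only [act_compMk, E.act_id] at this
      exact this)
    (by
      intro as Γ₀ Γ₀' Γ Γ' θ₀ θ p q η
      dsimp only
      obtain ⟨r, hr⟩ := hE.mul_surj (E.act (Ctx.toTens η) (𝟙 _) e)
      have h : E.act (Ctx.toTens (η ≫ Ctx.tensorMap₀ θ₀ θ)) (𝟙 _) e =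
          hE.mul ⟨r.Δ₀, r.Δs, r.η, E.act (famMap θ₀) (𝟙 _) r.e₀,
            fun j => E.act (famMap (θ j)) (𝟙 _) (r.e j)⟩ := by
        rw [← act_tensMap_mul, hr, E.act_act, Ctx.toTens_comp_tensorMap₀, Category.id_comp]
      rw [h, ← hr, appOfMul_mul, appOfMul_mul]
      simp only [appOfSplit, compMk_act]) x)
    (by
      rintro Θ Θ' θ ⟨as, Γ₀, Γ, p, q, η⟩ e
      show appOfMul hE as (P.act (Ty.arrowMap (𝟙 _) (𝟙 _)) (𝟙 _) p) q
          (E.act (Ctx.toTens (θ ≫ η)) (𝟙 _) e) =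
        appOfMul hE as p q (E.act (Ctx.toTens η) (𝟙 _) (E.act (famMap θ) (𝟙 _) e))
      rw [Ty.arrowMap_id, P.act_id, E.act_act, Ctx.toTens_comp, Category.id_comp])

theorem compAppTo_mk (hE : E.Monoidal) (Θ : Ctx S A m) (as : SList S (Ty S A)) (Γ₀ : Ctx S A m)
    (Γ : Fin as.len → Ctx S A m) (p : P.at' Γ₀ (Ty.arrow as a))
    (q : ∀ i, P'.at' (Γ i) (as.get i)) (η : Θ ⟶ Ctx.tensor₀ Γ₀ Γ) (e : E.obj Δ (fam Θ)) :
    compAppTo hE P P' Δ a (compMk Θ (Dist.appMk as Γ₀ Γ p q η) e) =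
      appOfMul hE as p q (E.act (Ctx.toTens η) (𝟙 _) e) := rfl

/-- Bringing an application of composites to the form of a composite. -/
def compOfApp (hE : E.Monoidal) (as : SList S (Ty S A)) (Δ₀ : Ctx S A n)
    (Δs : Fin as.len → Ctx S A n) (η : Δ ⟶ Ctx.tensor₀ Δ₀ Δs)
    (x₀ : CompPre P E Δ₀ (Ty.arrow as a)) (x : ∀ i, CompPre P' E (Δs i) (as.get i)) :
    (comp (Dist.app P P') E).at' Δ a :=
  compMk (P := Dist.app P P') (Ctx.tensor₀ x₀.Θ fun i => (x i).Θ)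
    (Dist.appMk as x₀.Θ (fun i => (x i).Θ) x₀.p (fun i => (x i).p) (𝟙 _))
    (E.act (Ctx.tensIso _ _).inv (𝟙 _)
      (hE.mul ⟨Δ₀, Δs, Ctx.toTens η, x₀.e, fun i => (x i).e⟩))

/-- All representatives are changed at once: the morphisms for the function and the arguments
assemble to `tensorMap₀`, which crosses the coend and becomes the factorwise action on `mul`. -/
theorem compOfApp_rel (hE : E.Monoidal) (as : SList S (Ty S A)) (Δ₀ : Ctx S A n)
    (Δs : Fin as.len → Ctx S A n) (η : Δ ⟶ Ctx.tensor₀ Δ₀ Δs)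
    (x₀ y₀ : CompPre P E Δ₀ (Ty.arrow as a)) (x y : ∀ i, CompPre P' E (Δs i) (as.get i))
    (h₀ : CompRel P E _ _ x₀ y₀) (h : ∀ i, CompRel P' E _ _ (x i) (y i)) :
    compOfApp hE as Δ₀ Δs η x₀ x = compOfApp hE as Δ₀ Δs η y₀ y := by
  have h' := fun i => (h i).exists_eq
  choose θ hp he using h'
  cases h₀ with
  | @mk Θ₀ Θ₀' θ₀ p e =>
    simp only [compOfApp, hp, he]
    rw [Dist.appMk_contexts, Category.id_comp]
    -- Exhibits `tensorMap₀` as acting on an application whose own morphism is the identity, the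
    -- form in which the coend relation can move it to `E`.
    have h1 : Dist.appMk as Θ₀' (fun i => (y i).Θ) p (fun i => (y i).p) (Ctx.tensorMap₀ θ₀ θ) =
        (Dist.app P P').act (𝟙 a) (Ctx.tensorMap₀ θ₀ θ)
          (Dist.appMk as Θ₀' (fun i => (y i).Θ) p (fun i => (y i).p) (𝟙 _)) := by
      rw [Dist.act_appMk, Ty.arrowMap_id, P.act_id, Category.comp_id]
    rw [h1, compMk_act, E.act_act, ← act_tensMap_mul hE θ₀ θ
      ⟨Δ₀, Δs, Ctx.toTens η, e, fun i => (x i).e⟩, E.act_act, Ctx.tensIso_inv_famMap_tensorMap₀]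

noncomputable def compAppInv (hE : E.Monoidal) (P P' : Dist S A m) (Δ : Ctx S A n) (a : Ty S A) :
    (Dist.app (comp P E) (comp P' E)).at' Δ a → (comp (Dist.app P P') E).at' Δ a :=
  Dist.appLift (fun x => quotLift₂ (compOfApp hE x.as x.Γ₀ x.Γ x.η) x.p x.q)
    (by
      rintro as bs φ Δ₀ Δs ⟨x₀⟩ q η
      obtain ⟨x, rfl⟩ : ∃ x : ∀ i, CompPre P' E (Δs i) (as.get i),
          (fun i => Quot.mk (CompRel P' E _ _) (x i)) = q :=
        ⟨fun i => (q i).out, funext fun i => Quot.out_eq _⟩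
      refine (quotLift₂_mk CompRel.refl (fun _ => CompRel.refl)
        (compOfApp_rel hE bs Δ₀ (fun i => Δs (φ.idx i)) (η ≫ Ctx.star φ.idx φ.adm Δ₀ Δs)) x₀
        fun i => ⟨(x (φ.idx i)).Θ, P'.act (φ.map i) (𝟙 _) (x (φ.idx i)).p,
          E.act (𝟙 _) (𝟙 _) (x (φ.idx i)).e⟩).trans ?_
      refine Eq.trans ?_ (quotLift₂_mk CompRel.refl (fun _ => CompRel.refl)
        (compOfApp_rel hE as Δ₀ Δs η)
        ⟨x₀.Θ, P.act (Ty.arrowMap φ (𝟙 a)) (𝟙 _) x₀.p, E.act (𝟙 _) (𝟙 _) x₀.e⟩ x).symm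
      simp only [compOfApp, E.act_id]
      rw [← Dist.appMk_types, Category.id_comp, Ctx.toTens_comp_star]
      have h1 := act_star_mul hE φ.idx φ.adm
        ⟨Δ₀, Δs, Ctx.toTens η, x₀.e, fun i => (x i).e⟩
      have h2 : Dist.appMk bs x₀.Θ (fun i => (x (φ.idx i)).Θ) x₀.p
          (fun i => P'.act (φ.map i) (𝟙 _) (x (φ.idx i)).p)
            (Ctx.star φ.idx φ.adm x₀.Θ fun i => (x i).Θ) =
          (Dist.app P P').act (𝟙 a) (Ctx.star φ.idx φ.adm x₀.Θ fun i => (x i).Θ)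
            (Dist.appMk bs x₀.Θ (fun i => (x (φ.idx i)).Θ) x₀.p
              (fun i => P'.act (φ.map i) (𝟙 _) (x (φ.idx i)).p) (𝟙 _)) := by
        rw [Dist.act_appMk, Ty.arrowMap_id, P.act_id, Category.comp_id]
      rw [h2, compMk_act, ← h1, E.act_act, E.act_act, Ctx.tensIso_inv_famMap_star])
    (by
      rintro as Δ₀ Δ₀' Δs Δs' θ₀ θ ⟨x₀⟩ q η
      obtain ⟨x, rfl⟩ : ∃ x : ∀ i, CompPre P' E (Δs' i) (as.get i),
          (fun i => Quot.mk (CompRel P' E _ _) (x i)) = q :=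
        ⟨fun i => (q i).out, funext fun i => Quot.out_eq _⟩
      refine (quotLift₂_mk CompRel.refl (fun _ => CompRel.refl)
        (compOfApp_rel hE as Δ₀ Δs η)
        ⟨x₀.Θ, P.act (𝟙 _) (𝟙 _) x₀.p, E.act (𝟙 _) θ₀ x₀.e⟩
        fun i => ⟨(x i).Θ, P'.act (𝟙 _) (𝟙 _) (x i).p, E.act (𝟙 _) (θ i) (x i).e⟩).trans ?_
      refine Eq.trans ?_ (quotLift₂_mk CompRel.refl (fun _ => CompRel.refl)
        (compOfApp_rel hE as Δ₀' Δs' (η ≫ Ctx.tensorMap₀ θ₀ θ)) x₀ x).symm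
      simp only [compOfApp, P.act_id, P'.act_id, Ctx.toTens_comp_tensorMap₀]
      rw [hE.mul_rel (SplitRel.mk θ₀ θ (Ctx.toTens η) x₀.e fun i => (x i).e)])

theorem compAppInv_mk (hE : E.Monoidal) (as : SList S (Ty S A)) (Δ₀ : Ctx S A n)
    (Δs : Fin as.len → Ctx S A n) (η : Δ ⟶ Ctx.tensor₀ Δ₀ Δs)
    (x₀ : CompPre P E Δ₀ (Ty.arrow as a)) (x : ∀ i, CompPre P' E (Δs i) (as.get i)) :
    compAppInv hE P P' Δ a (Dist.appMk (P := comp P E) (Q := comp P' E) as Δ₀ Δs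
      (Quot.mk _ x₀) (fun i => Quot.mk _ (x i)) η) = compOfApp hE as Δ₀ Δs η x₀ x :=
  quotLift₂_mk CompRel.refl (fun _ => CompRel.refl) (compOfApp_rel hE as Δ₀ Δs η) x₀ x

theorem compAppTo_compOfApp (hE : E.Monoidal) (as : SList S (Ty S A)) (Δ₀ : Ctx S A n)
    (Δs : Fin as.len → Ctx S A n) (η : Δ ⟶ Ctx.tensor₀ Δ₀ Δs)
    (x₀ : CompPre P E Δ₀ (Ty.arrow as a)) (x : ∀ i, CompPre P' E (Δs i) (as.get i)) :
    compAppTo hE P P' Δ a (compOfApp hE as Δ₀ Δs η x₀ x) =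
      Dist.appMk (P := comp P E) (Q := comp P' E) as Δ₀ Δs
        (Quot.mk _ x₀) (fun i => Quot.mk _ (x i)) η := by
  rw [compOfApp, compAppTo_mk, E.act_act, Ctx.toTens_id, Iso.inv_hom_id, Category.comp_id,
    E.act_id, appOfMul_mul, appOfSplit, Ctx.ofTens_toTens]
  rfl

/-- Composition with a monoidal profunctor commutes with application. -/
noncomputable def compAppIso (hE : E.Monoidal) (P P' : Dist S A m) :
    comp (Dist.app P P') E ≅ Dist.app (comp P E) (comp P' E) :=
  Dist.isoMk (fun Δ a =>
    { toFun := compAppTo hE P P' Δ a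
      invFun := compAppInv hE P P' Δ a
      left_inv := by
        intro x
        obtain ⟨Θ, y, e, rfl⟩ := compMk_surjective x
        obtain ⟨as, Γ₀, Γ, p, q, η, rfl⟩ := Dist.appMk_surjective y
        refine (congrArg _ (compAppTo_mk hE Θ as Γ₀ Γ p q η e)).trans ?_
        obtain ⟨r, hr⟩ := hE.mul_surj (E.act (Ctx.toTens η) (𝟙 _) e)
        rw [← hr, appOfMul_mul]
        refine (compAppInv_mk hE as r.Δ₀ r.Δs (Ctx.ofTens r.η) ⟨Γ₀, p, r.e₀⟩
          fun i => ⟨Γ i, q i, r.e i⟩).trans ?_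
        rw [compOfApp, Ctx.toTens_ofTens, hr, E.act_act, Ctx.toTens, Category.assoc,
          Iso.hom_inv_id, Category.comp_id, Category.comp_id]
        dsimp only
        -- Splitting and multiplying leaves `famMap η` acting on `e`; it crosses the coend back to
        -- the identity of the tensor product.
        rw [← compMk_act, Dist.act_appMk, Ty.arrowMap_id, P.act_id, Category.comp_id]
      right_inv := by
        rintro ⟨as, Δ₀, Δs, ⟨x₀⟩, q, η⟩
        obtain ⟨x, rfl⟩ : ∃ x : ∀ i, CompPre P' E (Δs i) (as.get i),
            (fun i => Quot.mk (CompRel P' E _ _) (x i)) = q :=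
          ⟨fun i => (q i).out, funext fun i => Quot.out_eq _⟩
        exact (congrArg _ (compAppInv_mk hE as Δ₀ Δs η x₀ x)).trans
          (compAppTo_compOfApp hE as Δ₀ Δs η x₀ x) })
    (by
      rintro Δ Δ' a a' g η ⟨Θ, ⟨as, Γ₀, Γ, p, q, θ⟩, e⟩
      obtain ⟨r, hr⟩ := hE.mul_surj (E.act (Ctx.toTens θ) (𝟙 _) e)
      have h : E.act (Ctx.toTens θ) (𝟙 _) (E.act (𝟙 _) η e) =
          hE.mul ⟨r.Δ₀, r.Δs, famMap η ≫ r.η, r.e₀, r.e⟩ := by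
        rw [← act_left_mul, hr, E.act_act, E.act_act]
        simp
      refine Eq.trans (b := appOfMul hE as (P.act (Ty.arrowMap (𝟙 as) g) (𝟙 _) p) q
        (E.act (Ctx.toTens (𝟙 _ ≫ θ)) (𝟙 _) (E.act (𝟙 _) η e))) rfl ?_
      refine Eq.trans ?_ (b := Dist.act _ g η (appOfMul hE as p q
        (E.act (Ctx.toTens θ) (𝟙 _) e))) rfl
      rw [Category.id_comp, h, ← hr, appOfMul_mul, appOfMul_mul]
      simp only [appOfSplit, Dist.act_appMk, act_compMk, E.act_id]
      rw [Ctx.ofTens_comp])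

end Monoidal
end Prof
end ITD

/-! ### Weakening is monoidal, and extension by a variable preserves monoidality. -/

namespace ITD

variable {S : Resource} {A : Type u} [SmallCategory A] {m n : ℕ}

namespace Prof

open Ctx (fam famMap famPre)

/-- The profunctor of weakening by one variable. -/
def wk (S : Resource) (A : Type u) [SmallCategory A] (n : ℕ) : Prof S A n (n + 1) where
  obj Δ Θ := (Fam.ofList (Δ 0) ⟶ Fam.empty) × (fam (Ctx.tail Δ) ⟶ Θ)
  act f η e := (Fam.ofListMap (η 0) ≫ e.1, famMap (Ctx.tailMap η) ≫ e.2 ≫ f)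
  act_id e := Prod.ext (Subsingleton.elim _ _) (by simp)
  act_act f g η θ e := Prod.ext (Subsingleton.elim _ _) (by simp)

instance (k : ℕ) : IsEmpty (Fam.tens (S := S) (C := Ty S A) Fam.empty
    fun _ : Fin k => Fam.empty).I :=
  ⟨Sum.rec (fun x : Empty => x.elim) fun x => Empty.elim x.2⟩

/-- The empty list. -/
def nil (S : Resource) (C : Type u) : SList S C := ⟨0, Fin.elim0⟩

instance (C : Type u) : IsEmpty (Fam.ofList (nil S C)).I := inferInstanceAs (IsEmpty (Fin 0))

instance (C : Type u) (k : ℕ) : IsEmpty (Fam.tens (Fam.ofList (nil S C))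
    fun _ : Fin k => Fam.ofList (nil S C)).I :=
  ⟨Sum.rec (fun x : Fin 0 => x.elim0) fun x => Fin.elim0 x.2⟩

/-- The part of a morphism `Δ ⟶ Δ₀ ⊗ ⋯ ⊗ Δ_k` outside the first variable. -/
def tailTens {k : ℕ} {Δ Δ₀ : Ctx S A (n + 1)} {Δs : Fin k → Ctx S A (n + 1)}
    (η : fam Δ ⟶ FCtx.tens (fam Δ₀) fun j => fam (Δs j)) :
    fam (Ctx.tail Δ) ⟶ FCtx.tens (fam (Ctx.tail Δ₀)) fun j => fam (Ctx.tail (Δs j)) :=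
  FCtx.tailMap η

def wkMul {k : ℕ} {Δ : Ctx S A (n + 1)} {Θ₀ : Ctx S A n} {Θ : Fin k → Ctx S A n}
    (r : (wk S A n).Split Δ Θ₀ Θ) :
    (wk S A n).obj Δ (FCtx.tens (fam Θ₀) fun j => fam (Θ j)) :=
  ((r.η 0 ≫ Fam.tensMap r.e₀.1 (fun j => j) (.id S _) fun j => (r.e j).1) ≫
      (Fam.isoEmpty _).hom,
    tailTens r.η ≫
      FCtx.tensMap r.e₀.2 (fun j => j) (.id S _) fun j => (r.e j).2)

/-- The canonical splitting: the factors are the `Θ_j` with an empty list at the discarded variable,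
carrying universal elements, so all the information of `e` sits in the splitting morphism. -/
def wkSplit {k : ℕ} {Δ : Ctx S A (n + 1)} {Θ₀ : Ctx S A n} {Θ : Fin k → Ctx S A n}
    (e : (wk S A n).obj Δ (FCtx.tens (fam Θ₀) fun j => fam (Θ j))) :
    (wk S A n).Split Δ Θ₀ Θ where
  Δ₀ := Ctx.ext (nil S _) Θ₀
  Δs j := Ctx.ext (nil S _) (Θ j)
  η := Fin.cases (motive := fun v => fam Δ v ⟶ Fam.tens (fam (Ctx.ext (nil S _) Θ₀) v)
      fun j => fam (Ctx.ext (nil S _) (Θ j)) v)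
    (e.1 ≫ (Fam.isoEmpty (Fam.tens (Fam.ofList (nil S _)) fun _ => Fam.ofList (nil S _))).inv) e.2
  e₀ := ((Fam.isoEmpty (Fam.ofList (nil S _))).hom, 𝟙 (fam Θ₀))
  e j := ((Fam.isoEmpty (Fam.ofList (nil S _))).hom, 𝟙 (fam (Θ j)))

theorem wkMul_wkSplit {k : ℕ} {Δ : Ctx S A (n + 1)} {Θ₀ : Ctx S A n} {Θ : Fin k → Ctx S A n}
    (e : (wk S A n).obj Δ (FCtx.tens (fam Θ₀) fun j => fam (Θ j))) :
    wkMul (wkSplit e) = e := by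
  refine Prod.ext (Subsingleton.elim _ _) ?_
  show e.2 ≫ FCtx.tensMap (𝟙 (fam Θ₀)) (fun j => j) (.id S _) (fun j => 𝟙 (fam (Θ j))) = e.2
  simp

/-- A morphism to a context that starts with the empty list. -/
def toExtNil {Δ : Ctx S A (n + 1)} {Θ : Ctx S A n} (e : (wk S A n).obj Δ (fam Θ)) :
    Δ ⟶ Ctx.ext (nil S _) Θ :=
  Fin.cases (motive := fun v => Δ v ⟶ Ctx.ext (nil S _) Θ v)
    (Fam.ofListPre (e.1 ≫ (Fam.isoEmpty (Fam.ofList (nil S _))).inv)) (famPre e.2)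

theorem act_toExtNil {Δ : Ctx S A (n + 1)} {Θ : Ctx S A n} (e : (wk S A n).obj Δ (fam Θ)) :
    (wk S A n).act (𝟙 _) (toExtNil e) ((Fam.isoEmpty (Fam.ofList (nil S _))).hom, 𝟙 (fam Θ)) =
      e := by
  refine Prod.ext (Subsingleton.elim _ _) ?_
  show e.2 ≫ 𝟙 _ ≫ 𝟙 _ = e.2
  simp

/-- Each element of a factor is itself a morphism of contexts (`toExtNil`) acting on a universal
element, so one relation step reaches the canonical splitting. As that splitting depends only on the
product, injectivity of `mul` follows. -/
theorem mk_eq_mk_wkSplit {k : ℕ} {Δ : Ctx S A (n + 1)} {Θ₀ : Ctx S A n} {Θ : Fin k → Ctx S A n}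
    (r : (wk S A n).Split Δ Θ₀ Θ) :
    Quot.mk (SplitRel _ Δ Θ₀ Θ) r = Quot.mk _ (wkSplit (wkMul r)) := by
  obtain ⟨Δ₀, Δs, η, e₀, e⟩ := r
  have h := Quot.sound (SplitRel.mk (E := wk S A n) (Θ₀ := Θ₀) (Θ := Θ) (toExtNil e₀) (fun j => toExtNil (e j)) η
    ((Fam.isoEmpty (Fam.ofList (nil S _))).hom, 𝟙 (fam Θ₀))
    fun j => ((Fam.isoEmpty (Fam.ofList (nil S _))).hom, 𝟙 (fam (Θ j))))
  simp only [act_toExtNil] at h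
  refine h.trans ?_
  refine congrArg (fun ζ => Quot.mk _ (Split.mk _ _ ζ _ _)) ?_
  funext v
  refine Fin.cases ?_ (fun v => rfl) v
  exact Subsingleton.elim (α := _ ⟶ Fam.tens (Fam.ofList (nil S _))
    fun _ => Fam.ofList (nil S _)) _ _

def wkMonoidal (S : Resource) (A : Type u) [SmallCategory A] (n : ℕ) : (wk S A n).Monoidal where
  mul := wkMul
  mul_rel h := by
    cases h with
    | mk θ₀ θ η e₀ e =>
      refine Prod.ext (Subsingleton.elim _ _) ?_
      show tailTens η ≫ FCtx.tensMap (famMap (Ctx.tailMap θ₀) ≫ e₀.2 ≫ 𝟙 _) _ _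
          (fun j => famMap (Ctx.tailMap (θ j)) ≫ (e j).2 ≫ 𝟙 _) =
        (tailTens η ≫ FCtx.tensMap (famMap (Ctx.tailMap θ₀)) (fun j => j) (.id S _)
          fun j => famMap (Ctx.tailMap (θ j))) ≫ FCtx.tensMap e₀.2 _ _ fun j => (e j).2
      simp
  mul_inj {k Δ Θ₀ Θ r r'} h := by
    rw [mk_eq_mk_wkSplit r, h, ← mk_eq_mk_wkSplit r']
  mul_surj e := ⟨_, wkMul_wkSplit e⟩
  act_mul φ₀ α hα φ ζ r := by
    refine Prod.ext (Subsingleton.elim _ _) ?_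
    show famMap (Ctx.tailMap ζ) ≫ (tailTens r.η ≫ FCtx.tensMap r.e₀.2 (fun j => j) (.id S _)
        fun j => (r.e j).2) ≫ FCtx.tensMap (famMap φ₀) α hα (fun j => famMap (φ j)) =
      (famMap (Ctx.tailMap ζ) ≫ tailTens r.η ≫ FCtx.tensMap (𝟙 (fam (Ctx.tail r.Δ₀))) α hα
        fun j => 𝟙 (fam (Ctx.tail (r.Δs (α j))))) ≫
        FCtx.tensMap (famMap (𝟙 _) ≫ r.e₀.2 ≫ famMap φ₀) (fun j => j) (.id S _)
          fun j => famMap (𝟙 _) ≫ (r.e (α j)).2 ≫ famMap (φ j)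
    simp
  subsingleton Δ Θ _ := ⟨fun e e' => Prod.ext (Subsingleton.elim _ _)
    (funext fun v => Subsingleton.elim _ _)⟩
  toEmpty {Δ Θ _} e := Fin.cases (motive := fun v => fam Δ v ⟶ Fam.empty) e.1
    fun v => e.2 v ≫ (Fam.isoEmpty (Θ v)).hom
  ofEmpty {Δ Θ _} e := (e 0, fun v => e v.succ ≫ (Fam.isoEmpty (Θ v)).inv)

section Lift

variable {E : Prof S A m n} {k : ℕ} {Δ : Ctx S A (n + 1)} {Θ₀ : Ctx S A (m + 1)}
  {Θ : Fin k → Ctx S A (m + 1)}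

def Split.tail (r : E.lift.Split Δ Θ₀ Θ) :
    E.Split (Ctx.tail Δ) (Ctx.tail Θ₀) fun j => Ctx.tail (Θ j) where
  Δ₀ := Ctx.tail r.Δ₀
  Δs j := Ctx.tail (r.Δs j)
  η := tailTens r.η
  e₀ := r.e₀.2
  e j := (r.e j).2

def liftMul (hE : E.Monoidal) (r : E.lift.Split Δ Θ₀ Θ) :
    E.lift.obj Δ (FCtx.tens (fam Θ₀) fun j => fam (Θ j)) :=
  (r.η 0 ≫ Fam.tensMap r.e₀.1 (fun j => j) (.id S _) fun j => (r.e j).1, hE.mul r.tail)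

/-- Splittings normalised at the new variable: the factors carry identities there, and `h` holds the
whole component. -/
def liftSplit (h : Fam.ofList (Δ 0) ⟶ Fam.tens (Fam.ofList (Θ₀ 0)) fun j => Fam.ofList (Θ j 0))
    (s : E.Split (Ctx.tail Δ) (Ctx.tail Θ₀) fun j => Ctx.tail (Θ j)) : E.lift.Split Δ Θ₀ Θ where
  Δ₀ := Ctx.ext (Θ₀ 0) s.Δ₀
  Δs j := Ctx.ext (Θ j 0) (s.Δs j)
  η := Fin.cases (motive := fun v => fam Δ v ⟶ Fam.tens (fam (Ctx.ext (Θ₀ 0) s.Δ₀) v)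
      fun j => fam (Ctx.ext (Θ j 0) (s.Δs j)) v) h s.η
  e₀ := (𝟙 (Fam.ofList (Θ₀ 0)), s.e₀)
  e j := (𝟙 (Fam.ofList (Θ j 0)), s.e j)

theorem liftSplit_rel
    (h : Fam.ofList (Δ 0) ⟶ Fam.tens (Fam.ofList (Θ₀ 0)) fun j => Fam.ofList (Θ j 0))
    {s s' : E.Split (Ctx.tail Δ) (Ctx.tail Θ₀) fun j => Ctx.tail (Θ j)}
    (hs : SplitRel E _ _ _ s s') : SplitRel E.lift Δ Θ₀ Θ (liftSplit h s) (liftSplit h s') := by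
  cases hs with
  | @mk Δ₀ Δ₀' Δs Δs' θ₀ θ η e₀ e =>
    have h0 : ∀ {X Y : Ctx S A n} (Ψ : Ctx S A (m + 1)) (θ : X ⟶ Y)
        (e : E.obj Y (fam (Ctx.tail Ψ))),
        (E.lift.act (𝟙 (fam Ψ)) (Ctx.extMap (𝟙 (Ψ 0)) θ) (𝟙 (Fam.ofList (Ψ 0)), e) :
          E.lift.obj (Ctx.ext (Ψ 0) X) (fam Ψ)) =
        (𝟙 (Fam.ofList (Ψ 0)), E.act (𝟙 _) θ e) := fun Ψ θ e =>
      Prod.ext ((Category.id_comp _).trans (Category.id_comp _)) rfl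
    have := SplitRel.mk (E := E.lift) (Δ := Δ) (Θ₀ := Θ₀) (Θ := Θ)
      (Ctx.extMap (𝟙 (Θ₀ 0)) θ₀) (fun j => Ctx.extMap (𝟙 (Θ j 0)) (θ j))
      (liftSplit h ⟨Δ₀, Δs, η, E.act (𝟙 _) θ₀ e₀, fun j => E.act (𝟙 _) (θ j) (e j)⟩).η
      (𝟙 (Fam.ofList (Θ₀ 0)), e₀) (fun j => (𝟙 (Fam.ofList (Θ j 0)), e j))
    rw [h0] at this
    simp only [h0] at this
    refine cast (congrArg (SplitRel E.lift Δ Θ₀ Θ _) ?_) this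
    refine congrArg (fun ζ => Split.mk _ _ ζ _ _) ?_
    funext v
    refine Fin.cases ?_ (fun v => rfl) v
    show h ≫ Fam.tensMap (𝟙 _) (fun j => j) (.id S _) (fun j => 𝟙 (Fam.ofList (Θ j 0))) = h
    rw [Fam.tensMap_id, Category.comp_id]

theorem liftMul_liftSplit (hE : E.Monoidal)
    (h : Fam.ofList (Δ 0) ⟶ Fam.tens (Fam.ofList (Θ₀ 0)) fun j => Fam.ofList (Θ j 0))
    (s : E.Split (Ctx.tail Δ) (Ctx.tail Θ₀) fun j => Ctx.tail (Θ j)) :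
    liftMul hE (liftSplit h s) = (h, hE.mul s) := by
  refine Prod.ext ?_ rfl
  show h ≫ Fam.tensMap (𝟙 _) _ _ (fun j => 𝟙 (Fam.ofList (Θ j 0))) = h
  rw [Fam.tensMap_id, Category.comp_id]

/-- The morphism of contexts with a given first component that is the identity elsewhere. -/
def toExt {X : Ctx S A (n + 1)} {as : SList S (Ty S A)} (h : Fam.ofList (X 0) ⟶ Fam.ofList as) :
    X ⟶ Ctx.ext as (Ctx.tail X) :=
  Fin.cases (motive := fun v => X v ⟶ Ctx.ext as (Ctx.tail X) v) (Fam.ofListPre h)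
    fun v => 𝟙 (X v.succ)

theorem act_toExt {X : Ctx S A (n + 1)} {Ψ : Ctx S A (m + 1)} (e : E.lift.obj X (fam Ψ)) :
    E.lift.act (𝟙 (fam Ψ)) (toExt (as := Ψ 0) e.1)
      ((𝟙 (Fam.ofList (Ψ 0)), e.2) : E.lift.obj (Ctx.ext (Ψ 0) (Ctx.tail X)) (fam Ψ)) = e := by
  refine Prod.ext ?_ (E.act_id e.2)
  show e.1 ≫ 𝟙 _ ≫ 𝟙 _ = e.1
  simp

/-- The component of each factor at the new variable is a morphism of lists, which one relation step
absorbs into the splitting morphism. What is left to compare is a splitting for `E` alone. -/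
theorem mk_eq_mk_liftSplit (hE : E.Monoidal) (r : E.lift.Split Δ Θ₀ Θ) :
    Quot.mk (SplitRel E.lift Δ Θ₀ Θ) r = Quot.mk _ (liftSplit (liftMul hE r).1 r.tail) := by
  obtain ⟨Δ₀, Δs, η, e₀, e⟩ := r
  have h := Quot.sound (SplitRel.mk (E := E.lift) (Θ₀ := Θ₀) (Θ := Θ)
    (toExt (as := Θ₀ 0) e₀.1) (fun j => toExt (as := Θ j 0) (e j).1) η
    (𝟙 (Fam.ofList (Θ₀ 0)), e₀.2) fun j => (𝟙 (Fam.ofList (Θ j 0)), (e j).2))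
  simp only [act_toExt] at h
  refine h.trans ?_
  refine congrArg (fun ζ => Quot.mk _ (Split.mk _ _ ζ _ _)) ?_
  funext v
  refine Fin.cases rfl (fun v => ?_) v
  exact (congrArg (fun f => η v.succ ≫ f) (Fam.tensMap_id (Fam.ofList (Δ₀ v.succ))
    fun j => Fam.ofList (Δs j v.succ))).trans (Category.comp_id _)

def liftMonoidal (hE : E.Monoidal) : E.lift.Monoidal where
  mul := liftMul hE
  mul_rel h := by
    cases h with
    | @mk Δ₀ Δ₀' Δs Δs' θ₀ θ η e₀ e =>
      refine Prod.ext ?_ (hE.mul_rel (.mk (Ctx.tailMap θ₀) (fun j => Ctx.tailMap (θ j))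
        (tailTens η) e₀.2 fun j => (e j).2))
      let η' : Fam.ofList _ ⟶ Fam.tens (Fam.ofList (Δ₀ 0)) fun j => Fam.ofList (Δs j 0) := η 0
      show η' ≫ Fam.tensMap (Fam.ofListMap (θ₀ 0) ≫ e₀.1 ≫ 𝟙 _) (fun j => j) (.id S _)
          (fun j => Fam.ofListMap (θ j 0) ≫ (e j).1 ≫ 𝟙 _) =
        (η' ≫ Fam.tensMap (Fam.ofListMap (θ₀ 0)) (fun j => j) (.id S _)
          fun j => Fam.ofListMap (θ j 0)) ≫
          Fam.tensMap e₀.1 (fun j => j) (.id S _) fun j => (e j).1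
      simp [Fam.tensMap_comp]
  mul_inj {k Δ Θ₀ Θ r r'} h := by
    rw [mk_eq_mk_liftSplit hE r, mk_eq_mk_liftSplit hE r', h]
    -- Both splittings are now normalised with the same first component, so injectivity for `E` on
    -- the tails suffices.
    exact congrArg (Quot.map (liftSplit (liftMul hE r').1) fun _ _ => liftSplit_rel _)
      (hE.mul_inj (congrArg Prod.snd h))
  mul_surj e := by
    obtain ⟨s, hs⟩ := hE.mul_surj e.2
    exact ⟨liftSplit e.1 s, (liftMul_liftSplit hE e.1 s).trans (Prod.ext rfl hs)⟩
  act_mul {k k' Δ Δ' Θ₀ Θ₀' Θ Θ'} φ₀ α hα φ ζ r := by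
    have h := hE.act_mul (Θ := fun j => Ctx.tail (Θ j)) (Θ' := fun j => Ctx.tail (Θ' j))
      (Ctx.tailMap φ₀) α hα (fun j => Ctx.tailMap (φ j)) (Ctx.tailMap ζ) r.tail
    refine Prod.ext ?_ h
    let η : Fam.ofList (Δ 0) ⟶ Fam.tens (Fam.ofList (r.Δ₀ 0)) fun j => Fam.ofList (r.Δs j 0) :=
      r.η 0
    let f₀ : Fam.ofList (r.Δ₀ 0) ⟶ Fam.ofList (Θ₀ 0) := r.e₀.1
    let f : ∀ j, Fam.ofList (r.Δs j 0) ⟶ Fam.ofList (Θ j 0) := fun j => (r.e j).1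
    show Fam.ofListMap (ζ 0) ≫ (η ≫ Fam.tensMap f₀ (fun j => j) (.id S _) f) ≫
        Fam.tensMap (Fam.ofListMap (φ₀ 0)) α hα (fun j => Fam.ofListMap (φ j 0)) =
      (Fam.ofListMap (ζ 0) ≫ η ≫ Fam.tensMap (𝟙 _) α hα
        fun j => 𝟙 (Fam.ofList (r.Δs (α j) 0))) ≫
        Fam.tensMap (𝟙 (Fam.ofList (r.Δ₀ 0)) ≫ f₀ ≫ Fam.ofListMap (φ₀ 0)) (fun j => j)
          (.id S _) fun j => 𝟙 (Fam.ofList (r.Δs (α j) 0)) ≫ f (α j) ≫ Fam.ofListMap (φ j 0)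
    simp [Fam.tensMap_comp]
  subsingleton Δ Θ _ :=
    have : ∀ v, IsEmpty (FCtx.tail Θ v).I := fun v => inferInstanceAs (IsEmpty (Θ v.succ).I)
    have := hE.subsingleton (Ctx.tail Δ) (FCtx.tail Θ)
    ⟨fun e e' => Prod.ext (Subsingleton.elim _ _) (Subsingleton.elim _ _)⟩
  toEmpty {Δ Θ _} e :=
    have : ∀ v, IsEmpty (FCtx.tail Θ v).I := fun v => inferInstanceAs (IsEmpty (Θ v.succ).I)
    Fin.cases (motive := fun v => fam Δ v ⟶ Fam.empty) (e.1 ≫ (Fam.isoEmpty (Θ 0)).hom)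
      (hE.toEmpty e.2)
  ofEmpty {Δ Θ _} e :=
    have : ∀ v, IsEmpty (FCtx.tail Θ v).I := fun v => inferInstanceAs (IsEmpty (Θ v.succ).I)
    (e 0 ≫ (Fam.isoEmpty (Θ 0)).inv, hE.ofEmpty fun v => e v.succ)

end Lift

end Prof
end ITD

/-! ### Restrictions of weakening and extension to single variables. -/

namespace ITD

variable {S : Resource} {A : Type u} [SmallCategory A] {m n : ℕ}

/-- An isomorphism of distributors from an equivariant family of bijective functions. -/
noncomputable def Dist.isoOfBijective {P Q : Dist S A n} (e : ∀ Δ a, P.at' Δ a → Q.at' Δ a)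
    (he : ∀ Δ a, Function.Bijective (e Δ a))
    (nat : ∀ {Δ Δ' : Ctx S A n} {a a' : Ty S A} (g : a ⟶ a') (η : Δ' ⟶ Δ) (x : P.at' Δ a),
      e Δ' a' (P.act g η x) = Q.act g η (e Δ a x)) : P ≅ Q :=
  isoMk (fun Δ a => Equiv.ofBijective _ (he Δ a)) nat

theorem comp_comp_square {C : Type u} [Category.{v} C] {a b c d e f : C} {p : a ⟶ b}
    {q : b ⟶ c} {r : c ⟶ d} {s : d ⟶ e} {s' : c ⟶ f} {t : f ⟶ e} (h : r ≫ s = s' ≫ t) :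
    (p ≫ q ≫ r) ≫ s = p ≫ (q ≫ s') ≫ t := by
  rw [Category.assoc, Category.assoc, h, Category.assoc]

theorem SList.hom_eq_of_isEmpty {C : Type u} [Category.{v} C] {a b : SList S C}
    (h : IsEmpty (Fam.ofList b).I) (f g : a ⟶ b) : f = g :=
  congrArg Fam.ofListPre (Subsingleton.elim (Fam.ofListMap f) (Fam.ofListMap g))

namespace Ctx

/-- The entries of `⟨⟩, …, ⟨a⟩, …, ⟨⟩` beyond the first one. -/
def singleTailIso (p : Fin n) (a : Ty S A) :
    fam (single p a) ≅ FCtx.tail (fam (single p.succ a)) :=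
  FCtx.isoMk fun v => Fam.isoOfEquiv (X := fam (single p a) v)
    (Y := FCtx.tail (fam (single p.succ a)) v)
    (finCongr (by simp [Fin.succ_inj] : (if v.succ = p.succ then 1 else 0) =
      if v = p then 1 else 0)) fun _ => rfl

theorem singleTailIso_hom_naturality (p : Fin n) {a b : Ty S A} (g : a ⟶ b) :
    famMap (singleMap p g) ≫ (singleTailIso p b).hom =
      (singleTailIso p a).hom ≫ FCtx.tailMap (famMap (singleMap p.succ g)) := by
  funext v
  refine Fam.hom_ext (fun _ => rfl) fun i => ?_
  refine Eq.trans ?_ (Category.id_comp _).symm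
  exact (Category.comp_id g).trans (Category.id_comp g).symm

instance isEmpty_single_succ_zero (p : Fin n) (a : Ty S A) :
    IsEmpty (fam (single p.succ a) 0).I := by
  show IsEmpty (Fin (if (0 : Fin (n + 1)) = p.succ then 1 else 0))
  rw [if_neg (Fin.succ_ne_zero p).symm]
  infer_instance

theorem isEmpty_tail_single_zero {p : Fin (n + 1)} (hp : p = 0) (a : Ty S A) (v : Fin n) :
    IsEmpty (FCtx.tail (fam (single p a)) v).I := by
  subst hp
  show IsEmpty (Fin (if v.succ = 0 then 1 else 0))
  rw [if_neg (Fin.succ_ne_zero v)]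
  infer_instance

/-- The first entry of `⟨a⟩, ⟨⟩, …, ⟨⟩`. -/
def singleZeroIso (m : ℕ) {p : Fin (n + 1)} (hp : p = 0) (a : Ty S A) :
    fam (single p a) 0 ≅ fam (single (0 : Fin (m + 1)) a) 0 :=
  Fam.isoOfEquiv (X := fam (single p a) 0) (Y := fam (single (0 : Fin (m + 1)) a) 0)
    (finCongr (by simp [hp] : (if (0 : Fin (m + 1)) = 0 then 1 else 0) =
      if (0 : Fin (n + 1)) = p then 1 else 0)) fun _ => rfl

theorem singleZeroIso_hom_naturality (m : ℕ) {p : Fin (n + 1)} (hp : p = 0) {a b : Ty S A}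
    (g : a ⟶ b) :
    famMap (singleMap p g) 0 ≫ (singleZeroIso m hp b).hom =
      (singleZeroIso m hp a).hom ≫ famMap (singleMap (0 : Fin (m + 1)) g) 0 := by
  refine Fam.hom_ext (fun _ => rfl) fun i => ?_
  refine Eq.trans ?_ (Category.id_comp _).symm
  exact (Category.comp_id g).trans (Category.id_comp g).symm

end Ctx

namespace Prof

open Ctx (fam famMap famPre)

/-- Composition with the profunctor of weakening. -/
def compWkIso (Q : Dist S A n) : comp Q (wk S A n) ≅ Q.wk :=
  Dist.isoMk (fun Δ a =>
    { toFun := compLift (fun Θ q e => (e.1, Q.act (𝟙 _) (famPre e.2) q)) (by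
        intro Θ Θ' θ q e
        refine Prod.ext (Subsingleton.elim _ _) ?_
        show Q.act (𝟙 _) (famPre e.2) (Q.act (𝟙 _) θ q) =
          Q.act (𝟙 _) (𝟙 _ ≫ famPre e.2 ≫ θ) q
        simp [Q.act_act])
      invFun x := compMk (P := Q) (Ctx.tail Δ) x.2 (x.1, 𝟙 _)
      left_inv := by
        rintro ⟨Θ, q, h, e⟩
        -- Co-Yoneda again: off the first variable weakening is a hom-functor.
        refine (compMk_act (P := Q) (E := wk S A n) (Δ := Δ) (famPre e) q (h, 𝟙 _)).trans ?_
        refine congrArg (compMk (P := Q) (E := wk S A n) (Δ := Δ) Θ q)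
          (Prod.ext (Subsingleton.elim _ _) ?_)
        show 𝟙 _ ≫ 𝟙 _ ≫ e = e
        simp
      right_inv := fun x => Prod.ext rfl (Q.act_id x.2) })
    (by
      rintro Δ Δ' a a' g η ⟨Θ, q, h, e⟩
      refine Prod.ext rfl ?_
      show Q.act (𝟙 _) (Ctx.tailMap η ≫ famPre e ≫ 𝟙 _) (Q.act g (𝟙 _) q) =
        Q.act g (Ctx.tailMap η) (Q.act (𝟙 _) (famPre e) q)
      simp [Q.act_act])

/-- The restriction of the profunctor of weakening to variables. -/
noncomputable def wkAtVarIso (pos : Fin n → Prop) (pos' : Fin (n + 1) → Prop) (h₀ : ¬ pos' 0)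
    (h : ∀ p, pos' p.succ ↔ pos p) : (wk S A n).atVar pos ≅ Dist.var pos' :=
  Dist.isoOfBijective (fun Δ a x => ⟨⟨(x.1 : Fin n).succ, (h _).2 x.1.2⟩,
      Fin.cases (motive := fun v => Δ v ⟶ Ctx.single (x.1 : Fin n).succ a v)
        (Fam.ofListPre (x.2.1 ≫ (Fam.isoEmpty (fam (Ctx.single (x.1 : Fin n).succ a) 0)).inv))
        fun v => Fam.ofListPre (x.2.2 v ≫ (Ctx.singleTailIso (x.1 : Fin n) a).hom v)⟩)
    (fun Δ a => by
      constructor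
      · rintro ⟨⟨p, hp⟩, e, f⟩ ⟨⟨p', hp'⟩, e', f'⟩ hx
        have hx1 := congrArg Sigma.fst hx
        simp only [Subtype.mk.injEq, Fin.succ_inj] at hx1
        subst hx1
        refine congrArg (Sigma.mk _) (Prod.ext (Subsingleton.elim _ _) ?_)
        have hx2 := eq_of_heq (Sigma.mk.inj hx).2
        rw [← cancel_mono (Ctx.singleTailIso p a).hom]
        funext v
        exact congrArg Fam.ofListMap (congrFun hx2 v.succ)
      · rintro ⟨⟨p, hp⟩, f⟩
        obtain rfl | ⟨p, rfl⟩ := Fin.eq_zero_or_eq_succ p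
        · exact absurd hp h₀
        · refine ⟨⟨⟨p, (h p).1 hp⟩,
            Fam.ofListMap (f 0) ≫ (Fam.isoEmpty (fam (Ctx.single p.succ a) 0)).hom,
            FCtx.tailMap (famMap f) ≫ (Ctx.singleTailIso p a).inv⟩, ?_⟩
          refine congrArg (Sigma.mk _) ?_
          funext v
          refine Fin.cases ?_ (fun v => ?_) v
          · exact SList.hom_eq_of_isEmpty (Ctx.isEmpty_single_succ_zero p a) _ _
          · exact congrArg Fam.ofListPre (congrFun (Category.assoc (FCtx.tailMap (famMap f))
              (Ctx.singleTailIso p a).inv (Ctx.singleTailIso p a).hom |>.trans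
                (by rw [Iso.inv_hom_id, Category.comp_id])) v))
    (by
      rintro Δ Δ' a a' g η ⟨⟨p, hp⟩, e, f⟩
      refine congrArg (Sigma.mk _) ?_
      funext v
      refine Fin.cases ?_ (fun v => ?_) v
      · exact SList.hom_eq_of_isEmpty (Ctx.isEmpty_single_succ_zero p a') _ _
      · refine congrArg Fam.ofListPre (congrFun (?_ : (famMap (Ctx.tailMap η) ≫ f ≫
            famMap (Ctx.singleMap p g)) ≫ (Ctx.singleTailIso p a').hom =
          famMap (Ctx.tailMap η) ≫ (f ≫ (Ctx.singleTailIso p a).hom) ≫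
            FCtx.tailMap (famMap (Ctx.singleMap p.succ g))) v)
        rw [Category.assoc, Category.assoc, Ctx.singleTailIso_hom_naturality, Category.assoc])

/-- The restriction of an extended profunctor to the new variable. -/
noncomputable def liftAtVarZeroIso {E : Prof S A m n} (hE : E.Monoidal)
    (pos : Fin (m + 1) → Prop) (pos' : Fin (n + 1) → Prop)
    (h : ∀ p, pos p ↔ p = 0) (h' : ∀ p, pos' p ↔ p = 0) :
    Dist.var pos' ≅ E.lift.atVar pos :=
  Dist.isoOfBijective (fun Δ a x =>
      have := Ctx.isEmpty_tail_single_zero (p := (0 : Fin (m + 1))) rfl a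
      have := Ctx.isEmpty_tail_single_zero ((h' _).1 x.1.2) a
      ⟨⟨0, (h 0).2 rfl⟩, Fam.ofListMap (x.2 0) ≫ (Ctx.singleZeroIso m ((h' _).1 x.1.2) a).hom,
        hE.ofEmpty fun v => Fam.ofListMap (x.2 v.succ) ≫
          (Fam.isoEmpty (FCtx.tail (fam (Ctx.single _ a)) v)).hom⟩)
    (fun Δ a => by
      have := Ctx.isEmpty_tail_single_zero (S := S) (p := (0 : Fin (m + 1))) rfl a
      have := Ctx.isEmpty_tail_single_zero (S := S) (p := (0 : Fin (n + 1))) rfl a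
      constructor
      · rintro ⟨⟨p, hp⟩, f⟩ ⟨⟨p', hp'⟩, f'⟩ hx
        obtain rfl := (h' _).1 hp
        obtain rfl := (h' _).1 hp'
        refine congrArg (Sigma.mk _) ?_
        have hx2 := congrArg Prod.fst (eq_of_heq (Sigma.mk.inj hx).2)
        funext v
        refine Fin.cases ?_ (fun v => ?_) v
        · exact congrArg Fam.ofListPre ((Iso.cancel_iso_hom_right (Fam.ofListMap (f 0))
            (Fam.ofListMap (f' 0)) (Ctx.singleZeroIso m rfl a)).1 hx2)
        · exact SList.hom_eq_of_isEmpty (Ctx.isEmpty_tail_single_zero rfl a v) _ _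
      · rintro ⟨⟨p, hp⟩, e, f⟩
        obtain rfl := (h _).1 hp
        refine ⟨⟨⟨0, (h' 0).2 rfl⟩, Fin.cases
          (motive := fun v => Δ v ⟶ Ctx.single (0 : Fin (n + 1)) a v)
          (Fam.ofListPre (e ≫ (Ctx.singleZeroIso m rfl a).inv))
          fun v => Fam.ofListPre (hE.toEmpty f v ≫
            (Fam.isoEmpty (FCtx.tail (fam (Ctx.single (0 : Fin (n + 1)) a)) v)).inv)⟩, ?_⟩
        -- Beyond the new variable the target context is empty, where `E` has at most one element.
        -- So `toEmpty` and `ofEmpty` are needed only for existence, and the first components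
        -- decide.
        have := hE.subsingleton (Ctx.tail Δ) (FCtx.tail (fam (Ctx.single (0 : Fin (m + 1)) a)))
        refine congrArg (Sigma.mk _) (Prod.ext ?_ (this.elim _ _))
        exact (Category.assoc _ _ _).trans ((congrArg (fun k => e ≫ k)
          (Ctx.singleZeroIso m rfl a).inv_hom_id).trans (Category.comp_id e)))
    (by
      rintro Δ Δ' a a' g η ⟨⟨p, hp⟩, f⟩
      have := Ctx.isEmpty_tail_single_zero (S := S) (p := (0 : Fin (m + 1))) rfl a'
      have := hE.subsingleton (Ctx.tail Δ') (FCtx.tail (fam (Ctx.single (0 : Fin (m + 1)) a')))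
      refine congrArg (Sigma.mk _) (Prod.ext ?_ (this.elim _ _))
      have hp0 := (h' _).1 hp
      show (Fam.ofListMap (η 0) ≫ Fam.ofListMap (f 0) ≫ famMap (Ctx.singleMap p g) 0) ≫
          (Ctx.singleZeroIso m hp0 a').hom =
        Fam.ofListMap (η 0) ≫ (Fam.ofListMap (f 0) ≫ (Ctx.singleZeroIso m hp0 a).hom) ≫
          famMap (Ctx.singleMap (0 : Fin (m + 1)) g) 0
      exact comp_comp_square (Ctx.singleZeroIso_hom_naturality m hp0 g))

/-- The restriction of an extended profunctor to the old variables. -/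
noncomputable def liftAtVarSuccIso (E : Prof S A m n) (pos : Fin m → Prop)
    (pos' : Fin (m + 1) → Prop) (h₀ : ¬ pos' 0) (h : ∀ p, pos' p.succ ↔ pos p) :
    (E.atVar pos).wk ≅ E.lift.atVar pos' :=
  Dist.isoOfBijective (fun Δ a x => ⟨⟨(x.2.1 : Fin m).succ, (h _).2 x.2.1.2⟩,
      x.1 ≫ (Fam.isoEmpty (fam (Ctx.single (x.2.1 : Fin m).succ a) 0)).inv,
      E.act (Ctx.singleTailIso (x.2.1 : Fin m) a).hom (𝟙 _) x.2.2⟩)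
    (fun Δ a => by
      constructor
      · rintro ⟨e, ⟨p, hp⟩, f⟩ ⟨e', ⟨p', hp'⟩, f'⟩ hx
        have hx1 := congrArg Sigma.fst hx
        simp only [Subtype.mk.injEq, Fin.succ_inj] at hx1
        subst hx1
        refine Prod.ext (Subsingleton.elim _ _) (congrArg (Sigma.mk _) ?_)
        have hx2 := congrArg Prod.snd (eq_of_heq (Sigma.mk.inj hx).2)
        have hx3 := congrArg (E.act (Ctx.singleTailIso p a).inv (𝟙 _)) hx2
        simpa [E.act_act, E.act_id] using hx3
      · rintro ⟨⟨p, hp⟩, e, f⟩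
        obtain rfl | ⟨p, rfl⟩ := Fin.eq_zero_or_eq_succ p
        · exact absurd hp h₀
        · refine ⟨⟨e ≫ (Fam.isoEmpty _).hom, ⟨p, (h p).1 hp⟩,
            E.act (Ctx.singleTailIso p a).inv (𝟙 _) f⟩, ?_⟩
          refine congrArg (Sigma.mk _) (Prod.ext ?_ ?_)
          · have : Subsingleton (fam Δ 0 ⟶ fam (Ctx.single p.succ a) 0) := inferInstance
            exact this.elim _ _
          · refine (E.act_act _ _ _ _ f).trans ?_
            rw [Iso.inv_hom_id, Category.comp_id, E.act_id])
    (by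
      rintro Δ Δ' a a' g η ⟨e, ⟨p, hp⟩, f⟩
      refine congrArg (Sigma.mk _) (Prod.ext ?_ ?_)
      · have : Subsingleton (fam Δ' 0 ⟶ fam (Ctx.single p.succ a') 0) := inferInstance
        exact this.elim _ _
      · show E.act (Ctx.singleTailIso p a').hom (𝟙 _)
            (E.act (famMap (Ctx.singleMap p g)) (Ctx.tailMap η) f) =
          E.act (FCtx.tailMap (famMap (Ctx.singleMap p.succ g))) (Ctx.tailMap η)
            (E.act (Ctx.singleTailIso p a).hom (𝟙 _) f)
        rw [E.act_act, E.act_act, Ctx.singleTailIso_hom_naturality, Category.id_comp,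
          Category.comp_id])

end Prof
end ITD

namespace ITD

/-! ### The profunctor of instantiation -/

namespace Fam

variable {S : Resource} {C : Type u} [Category.{v} C]

theorem comp_id_eq_id_comp_id_comp {a b : C} (f : a ⟶ b) : f ≫ 𝟙 b = 𝟙 a ≫ 𝟙 a ≫ f := by simp

/-- Reassociation of iterated sums of families. -/
def shuffleEquiv {J I₀ : Type} {I : J → Type} (A₀ : Type) (A : J → Type)
    (B : I₀ ⊕ ((j : J) × I j) → Type) :
    ((A₀ ⊕ (j : J) × A j) ⊕ (p : I₀ ⊕ ((j : J) × I j)) × B p) ≃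
      ((A₀ ⊕ (i : I₀) × B (.inl i)) ⊕ (j : J) × (A j ⊕ (i : I j) × B (.inr ⟨j, i⟩))) where
  toFun
    | .inl (.inl x) => .inl (.inl x)
    | .inl (.inr ⟨j, x⟩) => .inr ⟨j, .inl x⟩
    | .inr ⟨.inl i, x⟩ => .inl (.inr ⟨i, x⟩)
    | .inr ⟨.inr ⟨j, i⟩, x⟩ => .inr ⟨j, .inr ⟨i, x⟩⟩
  invFun
    | .inl (.inl x) => .inl (.inl x)
    | .inr ⟨j, .inl x⟩ => .inl (.inr ⟨j, x⟩)
    | .inl (.inr ⟨i, x⟩) => .inr ⟨.inl i, x⟩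
    | .inr ⟨j, .inr ⟨i, x⟩⟩ => .inr ⟨.inr ⟨j, i⟩, x⟩
  left_inv := by rintro ((x | ⟨j, x⟩) | ⟨i | ⟨j, i⟩, x⟩) <;> rfl
  right_inv := by rintro ((x | ⟨i, x⟩) | ⟨j, x | ⟨i, x⟩⟩) <;> rfl

def shuffle {J I₀ : Type} {I : J → Type} (A₀ : Fam S C) (A : J → Fam S C)
    (B : I₀ ⊕ ((j : J) × I j) → Fam S C) :
    tens (tens A₀ fun i : I₀ => B (.inl i)) (fun j => tens (A j) fun i : I j => B (.inr ⟨j, i⟩)) ≅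
      tens (tens A₀ A) B :=
  isoOfEquiv (X := tens (tens A₀ fun i : I₀ => B (.inl i))
      (fun j => tens (A j) fun i : I j => B (.inr ⟨j, i⟩))) (Y := tens (tens A₀ A) B)
    (shuffleEquiv A₀.I (fun j => (A j).I) fun p => (B p).I) (by
      rintro ((x | ⟨j, x⟩) | ⟨i | ⟨j, i⟩, x⟩) <;> rfl)

/-- Both sides reindex each of the four kinds of entry in the same way by computation, so only unit
laws remain. -/
theorem shuffle_hom_naturality {J I₀ J' I₀' : Type} {I : J → Type} {I' : J' → Type}
    {A₀ A₀' : Fam S C} {A : J → Fam S C} {A' : J' → Fam S C}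
    {B : I₀ ⊕ ((j : J) × I j) → Fam S C} {B' : I₀' ⊕ ((j : J') × I' j) → Fam S C}
    (a₀ : A₀ ⟶ A₀') (α : J' → J) (hα : S.Adm α) (a : ∀ j, A (α j) ⟶ A' j)
    (β₀ : I₀' → I₀) (hβ₀ : S.Adm β₀) (β : ∀ j, I' j → I (α j)) (hβ : ∀ j, S.Adm (β j))
    (b : ∀ p : I₀' ⊕ ((j : J') × I' j),
      B (Sum.map β₀ (fun p : (j : J') × I' j => (⟨α p.1, β p.1 p.2⟩ : (j : J) × I j)) p) ⟶ B' p) :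
    tensMap (tensMap a₀ β₀ hβ₀ fun i => b (.inl i)) α hα
        (Y := fun j => tens (A' j) fun i : I' j => B' (.inr ⟨j, i⟩))
        (fun j => tensMap (a j) (β j) (hβ j) (X := fun i => B (.inr ⟨α j, i⟩))
          fun i => b (.inr ⟨j, i⟩)) ≫
        (shuffle A₀' A' B').hom =
      (shuffle A₀ A B).hom ≫ tensMap (tensMap a₀ α hα a)
        (Sum.map β₀ fun p : (j : J') × I' j => (⟨α p.1, β p.1 p.2⟩ : (j : J) × I j))
        (hβ₀.sumMap (Resource.Adm.sigma hα hβ)) b := by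
  refine hom_ext ?_ ?_ <;> rintro ((x | ⟨j, x⟩) | ⟨i | ⟨j, i⟩, x⟩)
  any_goals rfl
  · exact comp_id_eq_id_comp_id_comp (a₀.map x)
  · exact comp_id_eq_id_comp_id_comp ((a j).map x)
  · exact comp_id_eq_id_comp_id_comp ((b (.inl i)).map x)
  · exact comp_id_eq_id_comp_id_comp ((b (.inr ⟨j, i⟩)).map x)

/-- Stated apart from the general case because `Sum.map` of identities reduces to the identity only
after a case split on the index. -/
theorem shuffle_hom_naturality_id {J I₀ : Type} {I : J → Type}
    {A₀ : Fam S C} {A : J → Fam S C}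
    {B B' : I₀ ⊕ ((j : J) × I j) → Fam S C} (b : ∀ p, B p ⟶ B' p) :
    tensMap (tensMap (𝟙 A₀) (fun i => i) (.id S _) fun i => b (.inl i)) (fun j => j) (.id S _)
        (Y := fun j => tens (A j) fun i : I j => B' (.inr ⟨j, i⟩))
        (fun j => tensMap (𝟙 (A j)) (fun i => i) (.id S _) (X := fun i => B (.inr ⟨j, i⟩))
          fun i => b (.inr ⟨j, i⟩)) ≫
        (shuffle A₀ A B').hom =
      (shuffle A₀ A B).hom ≫ tensMap (𝟙 (tens A₀ A)) (fun i => i) (.id S _) b := by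
  refine hom_ext ?_ ?_ <;> rintro ((x | ⟨j, x⟩) | ⟨i | ⟨j, i⟩, x⟩)
  any_goals rfl
  · exact comp_id_eq_id_comp_id_comp (𝟙 (A₀.get x))
  · exact comp_id_eq_id_comp_id_comp (𝟙 ((A j).get x))
  · exact comp_id_eq_id_comp_id_comp ((b (.inl i)).map x)
  · exact comp_id_eq_id_comp_id_comp ((b (.inr ⟨j, i⟩)).map x)

end Fam

variable {S : Resource} {A : Type u} [SmallCategory A] {n : ℕ}

namespace FCtx

def shuffle {J I₀ : Type} {I : J → Type} (A₀ : FCtx S A n) (A' : J → FCtx S A n)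
    (B : I₀ ⊕ ((j : J) × I j) → FCtx S A n) :
    tens (tens A₀ fun i : I₀ => B (.inl i))
        (fun j => tens (A' j) fun i : I j => B (.inr ⟨j, i⟩)) ≅
      tens (tens A₀ A') B :=
  isoMk fun v => Fam.shuffle (A₀ v) (fun j => A' j v) fun p => B p v

theorem shuffle_hom_naturality {J I₀ J' I₀' : Type} {I : J → Type} {I' : J' → Type}
    {A₀ A₀' : FCtx S A n} {A₁ : J → FCtx S A n} {A₁' : J' → FCtx S A n}
    {B : I₀ ⊕ ((j : J) × I j) → FCtx S A n} {B' : I₀' ⊕ ((j : J') × I' j) → FCtx S A n}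
    (a₀ : A₀ ⟶ A₀') (α : J' → J) (hα : S.Adm α) (a : ∀ j, A₁ (α j) ⟶ A₁' j)
    (β₀ : I₀' → I₀) (hβ₀ : S.Adm β₀) (β : ∀ j, I' j → I (α j)) (hβ : ∀ j, S.Adm (β j))
    (b : ∀ p : I₀' ⊕ ((j : J') × I' j),
      B (Sum.map β₀ (fun p : (j : J') × I' j => (⟨α p.1, β p.1 p.2⟩ : (j : J) × I j)) p) ⟶ B' p) :
    tensMap (tensMap a₀ β₀ hβ₀ fun i => b (.inl i)) α hα
        (Ψ := fun j => tens (A₁' j) fun i : I' j => B' (.inr ⟨j, i⟩))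
        (fun j => tensMap (a j) (β j) (hβ j) (Θ := fun i => B (.inr ⟨α j, i⟩))
          fun i => b (.inr ⟨j, i⟩)) ≫
        (shuffle A₀' A₁' B').hom =
      (shuffle A₀ A₁ B).hom ≫ tensMap (tensMap a₀ α hα a)
        (Sum.map β₀ fun p : (j : J') × I' j => (⟨α p.1, β p.1 p.2⟩ : (j : J) × I j))
        (hβ₀.sumMap (Resource.Adm.sigma hα hβ)) b :=
  funext fun v => Fam.shuffle_hom_naturality (A := fun j => A₁ j v) (A' := fun j => A₁' j v)
    (B := fun p => B p v) (B' := fun p => B' p v) (a₀ v) α hα (fun j => a j v) β₀ hβ₀ β hβ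
    fun p => b p v

theorem shuffle_hom_naturality_id {J I₀ : Type} {I : J → Type}
    {A₀ : FCtx S A n} {A₁ : J → FCtx S A n}
    {B B' : I₀ ⊕ ((j : J) × I j) → FCtx S A n} (b : ∀ p, B p ⟶ B' p) :
    tensMap (tensMap (𝟙 A₀) (fun i => i) (.id S _) fun i => b (.inl i)) (fun j => j) (.id S _)
        (Ψ := fun j => tens (A₁ j) fun i : I j => B' (.inr ⟨j, i⟩))
        (fun j => tensMap (𝟙 (A₁ j)) (fun i => i) (.id S _) (Θ := fun i => B (.inr ⟨j, i⟩))
          fun i => b (.inr ⟨j, i⟩)) ≫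
        (shuffle A₀ A₁ B').hom =
      (shuffle A₀ A₁ B).hom ≫ tensMap (𝟙 (tens A₀ A₁)) (fun i => i) (.id S _) b :=
  funext fun v => Fam.shuffle_hom_naturality_id (A₀ := A₀ v) (A := fun j => A₁ j v)
    (B := fun p => B p v) (B' := fun p => B' p v) fun p => b p v

theorem tensMap_star_comp {J J' : Type} {X₀ Y₀ Z₀ : FCtx S A n} {X Y : J → FCtx S A n}
    {Z : J' → FCtx S A n} (α : J' → J) (hα : S.Adm α) (f₀ : X₀ ⟶ Y₀) (f : ∀ j, X j ⟶ Y j)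
    (g₀ : Y₀ ⟶ Z₀) (g : ∀ j, Y (α j) ⟶ Z j) :
    tensMap (𝟙 X₀) α hα (fun j => 𝟙 (X (α j))) ≫
        tensMap (𝟙 _ ≫ f₀ ≫ g₀) (fun j => j) (.id S _) (fun j => 𝟙 _ ≫ f (α j) ≫ g j) =
      tensMap f₀ (fun j => j) (.id S _) f ≫ tensMap g₀ α hα g := by
  simp

end FCtx

namespace Prof

open Ctx (fam famMap famPre)

/-- The summands of the coend `∫^{Γ} ∏ᵢ Q(Γᵢ, aᵢ) × (S D)ⁿ(Δ, Θ' ⊗ ⨂ᵢ Γᵢ)` for `Θ = a⃗, Θ'`. -/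
structure InstPre (Q : Dist S A n) (Δ : Ctx S A n) (Θ : FCtx S A (n + 1)) : Type u where
  Γ : (Θ 0).I → Ctx S A n
  q : ∀ i, Q.at' (Γ i) ((Θ 0).get i)
  η : fam Δ ⟶ FCtx.tens (FCtx.tail Θ) fun i => fam (Γ i)

inductive InstRel (Q : Dist S A n) (Δ : Ctx S A n) (Θ : FCtx S A (n + 1)) :
    InstPre Q Δ Θ → InstPre Q Δ Θ → Prop
  | mk {Γ Γ' : (Θ 0).I → Ctx S A n} (θ : ∀ i, Γ i ⟶ Γ' i) (q : ∀ i, Q.at' (Γ' i) ((Θ 0).get i))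
      (η : fam Δ ⟶ FCtx.tens (FCtx.tail Θ) fun i => fam (Γ i)) :
      InstRel Q Δ Θ ⟨Γ, fun i => Q.act (𝟙 _) (θ i) (q i), η⟩
        ⟨Γ', q, η ≫ FCtx.tensMap (𝟙 _) (fun i => i) (.id S _) fun i => famMap (θ i)⟩

/-- The head of `φ` copies, discards or permutes the instances, as `S` allows, and acts on their
types; its tail acts on the remaining variables. -/
def InstPre.act {Q : Dist S A n} {Δ Δ' : Ctx S A n} {Θ Θ' : FCtx S A (n + 1)} (φ : Θ ⟶ Θ')
    (ζ : Δ' ⟶ Δ) (x : InstPre Q Δ Θ) : InstPre Q Δ' Θ' where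
  Γ i := x.Γ ((φ 0).idx i)
  q i := Q.act ((φ 0).map i) (𝟙 _) (x.q ((φ 0).idx i))
  η := famMap ζ ≫ x.η ≫ FCtx.tensMap (FCtx.tailMap φ) (φ 0).idx (φ 0).adm
    fun i => 𝟙 (fam (x.Γ ((φ 0).idx i)))

/-- The profunctor that instantiates the first variable by `Q`. -/
def inst (Q : Dist S A n) : Prof S A (n + 1) n where
  obj Δ Θ := Quot (InstRel Q Δ Θ)
  act φ ζ := Quot.map (InstPre.act φ ζ) (by
    rintro _ _ ⟨θ, q, η⟩
    have h := InstRel.mk (fun i => θ ((φ 0).idx i))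
      (fun i => Q.act ((φ 0).map i) (𝟙 _) (q ((φ 0).idx i)))
      (famMap ζ ≫ η ≫ FCtx.tensMap (FCtx.tailMap φ) (φ 0).idx (φ 0).adm
        fun i => 𝟙 (fam _))
    simpa [InstPre.act, Dist.act_act] using h)
  act_id := by
    rintro Δ Θ ⟨x⟩
    refine congrArg (Quot.mk _) ?_
    obtain ⟨Γ, q, η⟩ := x
    refine congrArg₂ (InstPre.mk Γ) (funext fun i => Q.act_id (q i))
      (?_ : famMap (𝟙 Δ) ≫ η ≫ FCtx.tensMap (𝟙 (FCtx.tail Θ)) (fun i => i) (.id S _)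
        (fun i => 𝟙 (fam (Γ i))) = η)
    simp
  act_act := by
    rintro Δ Δ' Δ'' Θ Θ' Θ'' f g η θ ⟨x⟩
    refine congrArg (Quot.mk _) ?_
    obtain ⟨Γ, q, ζ⟩ := x
    refine congrArg₂ (InstPre.mk _) (funext fun i => ?_)
      (?_ : famMap θ ≫ (famMap η ≫ ζ ≫ FCtx.tensMap (FCtx.tailMap f) (f 0).idx (f 0).adm
          fun i => 𝟙 (fam (Γ ((f 0).idx i)))) ≫ FCtx.tensMap (FCtx.tailMap g) (g 0).idx (g 0).adm
          (fun i => 𝟙 (fam (Γ ((f 0).idx ((g 0).idx i))))) =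
        famMap (θ ≫ η) ≫ ζ ≫ FCtx.tensMap (FCtx.tailMap f ≫ FCtx.tailMap g)
          (fun i => (f 0).idx ((g 0).idx i)) ((f 0).adm.comp (g 0).adm)
          (fun i => 𝟙 (fam (Γ ((f 0).idx ((g 0).idx i))))))
    · refine (Q.act_act _ _ _ _ _).trans ?_
      exact congrArg (fun t => Q.act ((f 0).map ((g 0).idx i) ≫ (g 0).map i) t
        (q ((f 0).idx ((g 0).idx i)))) (Category.id_comp (𝟙 (Γ ((f 0).idx ((g 0).idx i)))))
    · simp

variable {Q : Dist S A n}

theorem InstRel.exists_eq {Δ : Ctx S A n} {Θ : FCtx S A (n + 1)} {x y : InstPre Q Δ Θ}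
    (h : InstRel Q Δ Θ x y) :
    ∃ θ : ∀ i, x.Γ i ⟶ y.Γ i, x.q = (fun i => Q.act (𝟙 _) (θ i) (y.q i)) ∧
      y.η = x.η ≫ FCtx.tensMap (𝟙 _) (fun i => i) (.id S _) fun i => famMap (θ i) := by
  cases h
  exact ⟨_, rfl, rfl⟩

/-- The generating relation with its data as equations, for representatives that have the required
form only propositionally. -/
theorem InstRel.of_eq {Δ : Ctx S A n} {Θ : FCtx S A (n + 1)} {x y : InstPre Q Δ Θ}
    (θ : ∀ i, x.Γ i ⟶ y.Γ i) (hq : ∀ i, x.q i = Q.act (𝟙 _) (θ i) (y.q i))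
    (hη : y.η = x.η ≫ FCtx.tensMap (𝟙 _) (fun i => i) (.id S _) fun i => famMap (θ i)) :
    InstRel Q Δ Θ x y := by
  have h := InstRel.mk θ y.q x.η
  rwa [← funext hq, ← hη] at h

theorem InstRel.refl {Δ : Ctx S A n} {Θ : FCtx S A (n + 1)} (x : InstPre Q Δ Θ) :
    InstRel Q Δ Θ x x :=
  .of_eq (fun i => 𝟙 (x.Γ i)) (fun i => (Q.act_id _).symm) (by simp)

theorem act_instMk {Δ Δ' : Ctx S A n} {Θ : FCtx S A (n + 1)} (ζ : Δ' ⟶ Δ)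
    (x : InstPre Q Δ Θ) :
    (inst Q).act (𝟙 Θ) ζ (Quot.mk _ x) =
      Quot.mk (InstRel Q Δ' Θ) ⟨x.Γ, x.q, famMap ζ ≫ x.η⟩ := by
  refine congrArg (Quot.mk _) ?_
  refine congrArg₂ (InstPre.mk x.Γ) (funext fun i => Q.act_id (x.q i))
    (?_ : famMap ζ ≫ x.η ≫ FCtx.tensMap (𝟙 (FCtx.tail Θ)) (fun i => i) (.id S _)
      (fun i => 𝟙 (fam (x.Γ i))) = famMap ζ ≫ x.η)
  simp

theorem instMk_surjective {Δ : Ctx S A n} {Θ : FCtx S A (n + 1)} (x : (inst Q).obj Δ Θ) :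
    ∃ y, Quot.mk (InstRel Q Δ Θ) y = x := Quot.exists_rep x

/-! ### Instantiation is monoidal. -/

section InstMonoidal

/-- This and the next five lemmas paste diagrams in an arbitrary category; they are instantiated at
the squares around `shuffle` and `tensIso`. -/
theorem comp_comp_square' {C : Type u} [Category.{v} C] {a b c d e f : C} {p : a ⟶ b}
    {q : b ⟶ c} {r : c ⟶ d} {s : d ⟶ e} {s' : c ⟶ f} {t : f ⟶ e} (h : r ≫ s = s' ≫ t) :
    p ≫ (q ≫ r) ≫ s = (p ≫ q ≫ s') ≫ t := by
  simp only [Category.assoc, h]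

theorem comp_comp_eq {C : Type u} [Category.{v} C] {a b c d e : C} {p : a ⟶ b} {q : b ⟶ c}
    {r : c ⟶ d} {s : d ⟶ e} {t : b ⟶ d} (h : q ≫ r = t) :
    p ≫ t ≫ s = (p ≫ q) ≫ r ≫ s := by
  subst h
  simp only [Category.assoc]

theorem three_squares {C : Type u} [Category.{v} C] {a b c d e f g h i : C} {p : a ⟶ b}
    {q : b ⟶ c} {r : c ⟶ d} {s : d ⟶ e} {s' : c ⟶ f} {t : f ⟶ e} {sh' : e ⟶ g} {sh : f ⟶ h}
    {T : h ⟶ g} {T₁ : h ⟶ i} {T₂ : i ⟶ g} (hS : r ≫ s = s' ≫ t) (hh : t ≫ sh' = sh ≫ T)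
    (hT : T₁ ≫ T₂ = T) :
    (p ≫ q ≫ r) ≫ s ≫ sh' = (p ≫ (q ≫ s' ≫ sh) ≫ T₁) ≫ T₂ := by
  subst hT
  simp only [Category.assoc, ← hh]
  rw [← Category.assoc r, hS, Category.assoc]

theorem inv_square_comp {C : Type u} [Category.{v} C] {a b b' c c' d e : C} {p : a ⟶ c}
    {s : b ≅ c} {s' : b' ≅ c'} {i : b ⟶ d} {i' : b' ⟶ e} {t : d ⟶ e} {t₁ : b ⟶ b'} {T : c ⟶ c'}
    (h : i ≫ t = t₁ ≫ i') (h' : t₁ ≫ s'.hom = s.hom ≫ T) :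
    (p ≫ s.inv ≫ i) ≫ t = (p ≫ T) ≫ s'.inv ≫ i' := by
  have h'' : s.inv ≫ t₁ = T ≫ s'.inv := by
    rw [Iso.inv_comp_eq, ← Category.assoc, Iso.eq_comp_inv, h']
  rw [Category.assoc, Category.assoc, h, ← Category.assoc s.inv, h'']
  simp only [Category.assoc]

theorem cancel_inner {C : Type u} [Category.{v} C] {a b c d e : C} {p : a ⟶ b} {q : b ⟶ c}
    {s : c ≅ d} {i : c ⟶ e} : (p ≫ q ≫ s.hom) ≫ s.inv ≫ i = p ≫ q ≫ i := by simp

theorem eq_comp_of_inverse {C : Type u} [Category.{v} C] {a b c c' d : C} {p : a ⟶ c}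
    {s : b ≅ c} {s' : b ≅ c'} {i : b ⟶ d} {j : d ⟶ b} {t : b ⟶ b} {T : c' ⟶ c}
    (h : i ≫ j = 𝟙 _) (ht : t = 𝟙 _) (h' : t ≫ s.hom = s'.hom ≫ T) :
    p = ((p ≫ s.inv ≫ i) ≫ j ≫ s'.hom) ≫ T := by
  simp only [Category.assoc, ← h', ht, Category.id_comp]
  rw [← Category.assoc i, h]
  simp

variable {k : ℕ} {Δ : Ctx S A n} {Θ₀ : Ctx S A (n + 1)} {Θ : Fin k → Ctx S A (n + 1)}

/-- The contexts of a product. -/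
def instMulΓ {Δ₀ : Ctx S A n} {Δs : Fin k → Ctx S A n} (x₀ : InstPre Q Δ₀ (fam Θ₀))
    (x : ∀ j, InstPre Q (Δs j) (fam (Θ j))) :
    (fam Θ₀ 0).I ⊕ ((j : Fin k) × (fam (Θ j) 0).I) → Ctx S A n :=
  Sum.elim x₀.Γ fun p => (x p.1).Γ p.2

/-- The product of representatives. -/
def instMulPre {Δ₀ : Ctx S A n} {Δs : Fin k → Ctx S A n}
    (η : fam Δ ⟶ FCtx.tens (fam Δ₀) fun j => fam (Δs j)) (x₀ : InstPre Q Δ₀ (fam Θ₀))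
    (x : ∀ j, InstPre Q (Δs j) (fam (Θ j))) :
    InstPre Q Δ (FCtx.tens (fam Θ₀) fun j => fam (Θ j)) where
  Γ := instMulΓ x₀ x
  q
    | .inl i => x₀.q i
    | .inr p => (x p.1).q p.2
  η := η ≫ FCtx.tensMap x₀.η (fun j => j) (.id S _) (fun j => (x j).η) ≫
    (FCtx.shuffle (FCtx.tail (fam Θ₀)) (fun j => FCtx.tail (fam (Θ j)))
      (fun p => fam (instMulΓ x₀ x p))).hom

/-- The morphisms of instances in the factors form one family over the disjoint sum of their
indices; naturality of `shuffle` carries it past the reassociation. -/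
theorem instMulPre_rel {Δ₀ : Ctx S A n} {Δs : Fin k → Ctx S A n}
    (η : fam Δ ⟶ FCtx.tens (fam Δ₀) fun j => fam (Δs j)) (x₀ y₀ : InstPre Q Δ₀ (fam Θ₀))
    (x y : ∀ j, InstPre Q (Δs j) (fam (Θ j))) (h₀ : InstRel Q _ _ x₀ y₀)
    (h : ∀ j, InstRel Q _ _ (x j) (y j)) :
    Quot.mk (InstRel Q _ _) (instMulPre η x₀ x) = Quot.mk _ (instMulPre η y₀ y) := by
  obtain ⟨θ₀, hq₀, hη₀⟩ := h₀.exists_eq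
  have h' := fun i => (h i).exists_eq
  choose θ hq hη using h'
  let θ' : ∀ p, instMulΓ x₀ x p ⟶ instMulΓ y₀ y p := Sum.rec θ₀ fun p => θ p.1 p.2
  refine Quot.sound (.of_eq θ' ?_ ?_)
  · rintro (i | ⟨j, i⟩)
    · exact congrFun hq₀ i
    · exact congrFun (hq j) i
  · have h := FCtx.shuffle_hom_naturality_id (A₀ := FCtx.tail (fam Θ₀))
      (A₁ := fun j => FCtx.tail (fam (Θ j))) (B := fun p => fam (instMulΓ x₀ x p))
      (B' := fun p => fam (instMulΓ y₀ y p)) fun p => famMap (θ' p)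
    refine Eq.trans ?_ (comp_comp_square' (p := η) (q := FCtx.tensMap x₀.η (fun j => j) (.id S _)
      fun j => (x j).η) h)
    refine congrArg (fun f => η ≫ f ≫ (FCtx.shuffle (FCtx.tail (fam Θ₀))
      (fun j => FCtx.tail (fam (Θ j))) (fun p => fam (instMulΓ y₀ y p))).hom) ?_
    refine Eq.trans ?_ (FCtx.tensMap_comp _ _ _ _ _ _ _ _).symm
    exact congrArg₂ (fun f g => FCtx.tensMap f (fun j => j) (.id S _) g) hη₀ (funext hη)

noncomputable def instMul (r : (inst Q).Split Δ Θ₀ Θ) :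
    (inst Q).obj Δ (FCtx.tens (fam Θ₀) fun j => fam (Θ j)) :=
  quotLift₂ (fun x₀ x => Quot.mk (InstRel Q _ _) (instMulPre r.η x₀ x)) r.e₀ r.e

theorem instMul_mk {Δ₀ : Ctx S A n} {Δs : Fin k → Ctx S A n}
    (η : fam Δ ⟶ FCtx.tens (fam Δ₀) fun j => fam (Δs j)) (x₀ : InstPre Q Δ₀ (fam Θ₀))
    (x : ∀ j, InstPre Q (Δs j) (fam (Θ j))) :
    instMul (Q := Q) ⟨Δ₀, Δs, η, Quot.mk _ x₀, fun j => Quot.mk _ (x j)⟩ =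
      Quot.mk _ (instMulPre η x₀ x) :=
  quotLift₂_mk InstRel.refl (fun _ => InstRel.refl) (instMulPre_rel η) x₀ x

theorem Split.exists_rep (r : (inst Q).Split Δ Θ₀ Θ) :
    ∃ (Δ₀ : Ctx S A n) (Δs : Fin k → Ctx S A n)
      (η : fam Δ ⟶ FCtx.tens (fam Δ₀) fun j => fam (Δs j)) (x₀ : InstPre Q Δ₀ (fam Θ₀))
      (x : ∀ j, InstPre Q (Δs j) (fam (Θ j))),
      r = ⟨Δ₀, Δs, η, Quot.mk _ x₀, fun j => Quot.mk _ (x j)⟩ := by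
  obtain ⟨Δ₀, Δs, η, ⟨x₀⟩, e⟩ := r
  exact ⟨Δ₀, Δs, η, x₀, fun j => (e j).out,
    congrArg (Split.mk Δ₀ Δs η _) (funext fun j => (Quot.out_eq _).symm)⟩

/-- The factors of a representative. -/
def instSplitPre (x : InstPre Q Δ (FCtx.tens (fam Θ₀) fun j => fam (Θ j))) :
    (inst Q).Split Δ Θ₀ Θ where
  -- Each factor context is the tail of `Θ_j` tensored with the instances for the entries of `Θ_j`:
  -- the universal choice, for which the instantiation morphism is just `tensIso`.
  Δ₀ := Ctx.tensor₀ (Ctx.tail Θ₀) (k := (Θ₀ 0).len) (fun i => x.Γ (.inl i))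
  Δs j := Ctx.tensor₀ (Ctx.tail (Θ j)) (k := (Θ j 0).len) (fun i => x.Γ (.inr ⟨j, i⟩))
  η := x.η ≫ (FCtx.shuffle (FCtx.tail (fam Θ₀)) (fun j => FCtx.tail (fam (Θ j)))
      (fun p => fam (x.Γ p))).inv ≫
    FCtx.tensMap (Ctx.tensIso (Ctx.tail Θ₀) (k := (Θ₀ 0).len) (fun i => x.Γ (.inl i))).inv
      (fun j => j) (.id S _) fun j =>
        (Ctx.tensIso (Ctx.tail (Θ j)) (k := (Θ j 0).len) (fun i => x.Γ (.inr ⟨j, i⟩))).inv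
  e₀ := Quot.mk _ ⟨fun i => x.Γ (.inl i), fun i => x.q (.inl i), (Ctx.tensIso _ _).hom⟩
  e j := Quot.mk _ ⟨fun i => x.Γ (.inr ⟨j, i⟩), fun i => x.q (.inr ⟨j, i⟩),
    (Ctx.tensIso _ _).hom⟩

/-- A family of morphisms of instances is distributed over the factors, where it becomes a
`tensorMap₀` and hence a relation between splittings. -/
theorem instSplitPre_rel {x y : InstPre Q Δ (FCtx.tens (fam Θ₀) fun j => fam (Θ j))}
    (h : InstRel Q _ _ x y) :
    Quot.mk (SplitRel _ Δ Θ₀ Θ) (instSplitPre x) = Quot.mk _ (instSplitPre y) := by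
  cases h with
  | @mk Γ Γ' θ q η =>
  have h := SplitRel.mk (E := inst Q) (Θ₀ := Θ₀) (Θ := Θ)
    (Ctx.tensorMap₀ (𝟙 (Ctx.tail Θ₀)) (k := (Θ₀ 0).len) fun i => θ (.inl i))
    (fun j => Ctx.tensorMap₀ (𝟙 (Ctx.tail (Θ j))) (k := (Θ j 0).len) fun i => θ (.inr ⟨j, i⟩))
    (instSplitPre ⟨Γ, fun i => Q.act (𝟙 _) (θ i) (q i), η⟩).η
    (instSplitPre ⟨Γ', q, η ≫ FCtx.tensMap (𝟙 _) (fun i => i) (.id S _) fun i => famMap (θ i)⟩).e₀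
    (instSplitPre ⟨Γ', q, η ≫ FCtx.tensMap (𝟙 _) (fun i => i) (.id S _) fun i => famMap (θ i)⟩).e
  have key : ∀ (Ψ : Ctx S A (n + 1)) (Γ Γ' : Fin (Ψ 0).len → Ctx S A n) (θ : ∀ i, Γ i ⟶ Γ' i)
      (q : ∀ i, Q.at' (Γ' i) ((Ψ 0).get i)),
      (inst Q).act (𝟙 (fam Ψ)) (Ctx.tensorMap₀ (𝟙 (Ctx.tail Ψ)) θ)
        (Quot.mk _ ⟨Γ', q, (Ctx.tensIso (Ctx.tail Ψ) Γ').hom⟩) =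
      Quot.mk (InstRel Q (Ctx.tensor₀ (Ctx.tail Ψ) Γ) (fam Ψ)) ⟨Γ, fun i => Q.act (𝟙 _) (θ i) (q i),
        (Ctx.tensIso (Ctx.tail Ψ) Γ).hom⟩ := by
    intro Ψ Γ Γ' θ q
    rw [act_instMk]
    refine (Quot.sound (.of_eq θ (fun _ => rfl) ?_)).symm
    exact Ctx.famMap_tensorMap₀ (𝟙 (Ctx.tail Ψ)) θ
  have h₀ := key Θ₀ _ _ (fun i => θ (.inl i)) fun i => q (.inl i)
  have h₁ := fun j => key (Θ j) _ _ (fun i => θ (.inr ⟨j, i⟩)) fun i => q (.inr ⟨j, i⟩)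
  have hs := FCtx.shuffle_hom_naturality_id (A₀ := FCtx.tail (fam Θ₀))
    (A₁ := fun j => FCtx.tail (fam (Θ j))) (B := fun p => fam (Γ p)) (B' := fun p => fam (Γ' p))
    fun p => famMap (θ p)
  refine (congrArg₂ (fun e₀ e => Quot.mk _ (Split.mk _ _ _ e₀ e)) h₀.symm
    (funext fun j => (h₁ j).symm)).trans ((Quot.sound h).trans ?_)
  refine congrArg (fun ζ => Quot.mk _ (Split.mk _ _ ζ _ _)) (inv_square_comp ?_ hs)
  refine (FCtx.tensMap_comp _ _ _ _ _ _ _ _).trans (Eq.trans ?_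
    (FCtx.tensMap_comp _ _ _ _ _ _ _ _).symm)
  exact congrArg₂ (fun f g => FCtx.tensMap f (fun j => j) (.id S _) g)
    (Ctx.tensIso_inv_famMap_tensorMap₀ (𝟙 (Ctx.tail Θ₀)) fun i => θ (.inl i))
    (funext fun j => Ctx.tensIso_inv_famMap_tensorMap₀ (𝟙 (Ctx.tail (Θ j)))
      fun i => θ (.inr ⟨j, i⟩))

def instSplit (e : (inst Q).obj Δ (FCtx.tens (fam Θ₀) fun j => fam (Θ j))) :
    Quot (SplitRel (inst Q) Δ Θ₀ Θ) :=
  Quot.lift (fun x => Quot.mk _ (instSplitPre x)) (fun _ _ => instSplitPre_rel) e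

/-- The morphism inside each factor of `r` maps its context to the universal factor context and
pulls the universal element back to the given one. So a single relation step links `r` to the
splitting of its product. -/
theorem instSplit_instMul (r : (inst Q).Split Δ Θ₀ Θ) : instSplit (instMul r) = Quot.mk _ r := by
  obtain ⟨Δ₀, Δs, η, x₀, x, rfl⟩ := r.exists_rep
  rw [instMul_mk]
  show Quot.mk _ (instSplitPre (instMulPre η x₀ x)) = _
  have h := SplitRel.mk (E := inst Q) (Θ₀ := Θ₀) (Θ := Θ)
    (Ctx.ofTens (Γ₀ := Ctx.tail Θ₀) (k := (Θ₀ 0).len) (Γ := x₀.Γ) x₀.η)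
    (fun j => Ctx.ofTens (Γ₀ := Ctx.tail (Θ j)) (k := (Θ j 0).len) (Γ := (x j).Γ) (x j).η) η
    (instSplitPre (instMulPre η x₀ x)).e₀ (instSplitPre (instMulPre η x₀ x)).e
  have key : ∀ (Δ : Ctx S A n) (Ψ : Ctx S A (n + 1)) (x : InstPre Q Δ (fam Ψ)),
      (inst Q).act (𝟙 (fam Ψ)) (Ctx.ofTens (Γ₀ := Ctx.tail Ψ) (k := (Ψ 0).len) (Γ := x.Γ) x.η)
        (Quot.mk _ ⟨x.Γ, x.q, (Ctx.tensIso (Ctx.tail Ψ) (k := (Ψ 0).len) x.Γ).hom⟩) =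
      Quot.mk (InstRel Q Δ (fam Ψ)) x := by
    intro Δ Ψ x
    refine (act_instMk _ _).trans (congrArg (fun η => Quot.mk _ (InstPre.mk x.Γ x.q η)) ?_)
    exact Ctx.toTens_ofTens (Γ₀ := Ctx.tail Ψ) (k := (Ψ 0).len) (Γ := x.Γ) x.η
  have h₀ := key Δ₀ Θ₀ x₀
  have h₁ := fun j => key (Δs j) (Θ j) (x j)
  refine (Eq.trans ?_ (Quot.sound h).symm).trans ?_
  · refine congrArg (fun ζ => Quot.mk _ (Split.mk _ _ ζ _ _)) ?_
    refine (cancel_inner (s := FCtx.shuffle _ _ _)).trans (congrArg (fun f => η ≫ f) ?_)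
    exact FCtx.tensMap_comp _ _ _ _ _ _ _ _
  · exact congrArg₂ (fun e₀ e => Quot.mk _ (Split.mk Δ₀ Δs η e₀ e)) h₀ (funext h₁)

theorem instMul_instSplitPre (x : InstPre Q Δ (FCtx.tens (fam Θ₀) fun j => fam (Θ j))) :
    instMul (instSplitPre x) = Quot.mk _ x := by
  let θ : ∀ p, instMulΓ (Θ₀ := Θ₀) (Θ := Θ)
      ⟨fun i => x.Γ (.inl i), fun i => x.q (.inl i), (Ctx.tensIso (k := (Θ₀ 0).len) _ _).hom⟩
      (fun j => ⟨fun i => x.Γ (.inr ⟨j, i⟩), fun i => x.q (.inr ⟨j, i⟩),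
        (Ctx.tensIso (k := (Θ j 0).len) _ _).hom⟩) p ⟶ x.Γ p :=
    -- The regrouped contexts agree with the original ones only after a case split on the index, so
    -- the identity is given by cases.
    Sum.rec (fun i => 𝟙 (x.Γ (.inl i))) fun p => 𝟙 (x.Γ (.inr p))
  refine (instMul_mk _ _ _).trans (Quot.sound (.of_eq θ ?_ ?_))
  · rintro (i | ⟨j, i⟩)
    · exact (Q.act_id _).symm
    · exact (Q.act_id _).symm
  · have h := FCtx.shuffle_hom_naturality_id (A₀ := FCtx.tail (fam Θ₀))
      (A₁ := fun j => FCtx.tail (fam (Θ j))) (B' := fun p => fam (x.Γ p))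
      fun p => famMap (θ p)
    refine eq_comp_of_inverse ?_ ?_ h
    · refine (FCtx.tensMap_comp _ _ _ _ _ _ _ _).trans (Eq.trans ?_ (FCtx.tensMap_id _ _ (.id S _)))
      exact congrArg₂ (fun f g => FCtx.tensMap f (fun j => j) (.id S _) g)
        (Iso.inv_hom_id _) (funext fun j => Iso.inv_hom_id _)
    · refine Eq.trans ?_ (FCtx.tensMap_id _ _ (.id S _))
      exact congrArg₂ (fun f g => FCtx.tensMap f (fun j => j) (.id S _) g)
        (FCtx.tensMap_id _ _ (.id S _)) (funext fun j => FCtx.tensMap_id _ _ (.id S _))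

instance _root_.ITD.Fam.isEmpty_tens {C : Type u} {J : Type} [IsEmpty J] (X₀ : Fam S C)
    [IsEmpty X₀.I] (X : J → Fam S C) : IsEmpty (Fam.tens X₀ X).I :=
  inferInstanceAs (IsEmpty (X₀.I ⊕ (j : J) × (X j).I))

noncomputable def instMonoidal (Q : Dist S A n) : (inst Q).Monoidal where
  mul := instMul
  mul_rel h := by
    cases h with
    | @mk Δ₀ Δ₀' Δs Δs' θ₀ θ η e₀ e =>
    obtain ⟨x₀, rfl⟩ := instMk_surjective e₀
    choose x hx using fun j => instMk_surjective (e j)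
    obtain rfl : e = fun j => Quot.mk _ (x j) := funext fun j => (hx j).symm
    simp only [act_instMk]
    rw [instMul_mk, instMul_mk]
    refine congrArg (fun ζ => Quot.mk _ (InstPre.mk _ _ ζ)) ?_
    exact comp_comp_eq (FCtx.tensMap_comp (famMap θ₀) (fun j => j) (.id S _)
      (fun j => famMap (θ j)) x₀.η (fun j => j) (.id S _) fun j => (x j).η)
  mul_inj {k Δ Θ₀ Θ r r'} h := by rw [← instSplit_instMul, h, instSplit_instMul]
  mul_surj := by
    rintro k Δ Θ₀ Θ ⟨x⟩
    exact ⟨_, instMul_instSplitPre x⟩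
  act_mul {k k' Δ Δ' Θ₀ Θ₀' Θ Θ'} φ₀ α hα φ ζ r := by
    obtain ⟨Δ₀, Δs, η, x₀, x, rfl⟩ := r.exists_rep
    rw [instMul_mk]
    let ψ : FCtx.tens (fam Θ₀) (fun j => fam (Θ j)) ⟶ FCtx.tens (fam Θ₀') (fun j => fam (Θ' j)) :=
      FCtx.tensMap (famMap φ₀) α hα fun j => famMap (φ j)
    let y₀ := x₀.act (famMap φ₀) (𝟙 _)
    let y := fun j => (x (α j)).act (famMap (φ j)) (𝟙 _)
    let θ : ∀ p, ((instMulPre η x₀ x).act ψ ζ).Γ p ⟶ instMulΓ y₀ y p :=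
      Sum.rec (fun i => 𝟙 _) (fun p => 𝟙 _)
    refine Eq.trans (b := Quot.mk _ ((instMulPre η x₀ x).act ψ ζ)) rfl ?_
    refine Eq.trans ?_ (instMul_mk _ y₀ y).symm
    refine Quot.sound (.of_eq θ ?_ ?_)
    · rintro (i | ⟨j, i⟩)
      · exact (Q.act_id _).symm
      · exact (Q.act_id _).symm
    · have h := FCtx.shuffle_hom_naturality (A₁ := fun j => FCtx.tail (fam (Θ j)))
        (A₁' := fun j => FCtx.tail (fam (Θ' j))) (FCtx.tailMap (famMap φ₀)) α hα
        (fun j => FCtx.tailMap (famMap (φ j))) (famMap φ₀ 0).idx (famMap φ₀ 0).adm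
        (fun j => (famMap (φ j) 0).idx) (fun j => (famMap (φ j) 0).adm)
        (B := fun p => fam (instMulΓ x₀ x p)) (B' := fun p => fam (instMulΓ y₀ y p))
        fun p => famMap (θ p)
      -- The casewise identity `θ` is merged with the reindexing by `ψ`, giving the form in which
      -- naturality of `shuffle` is stated.
      have hT : FCtx.tensMap (FCtx.tailMap ψ) (ψ 0).idx (ψ 0).adm
            (Θ := fun p => fam (instMulΓ x₀ x p))
            (Ψ := fun p => fam (instMulΓ x₀ x ((ψ 0).idx p)))
            (fun p => 𝟙 (fam (instMulΓ x₀ x ((ψ 0).idx p)))) ≫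
          FCtx.tensMap (𝟙 _) (fun p => p) (.id S _)
            (Θ := fun p => fam (instMulΓ x₀ x ((ψ 0).idx p))) (Ψ := fun p => fam (instMulΓ y₀ y p))
            (fun p => famMap (θ p)) =
          FCtx.tensMap (FCtx.tailMap ψ) (ψ 0).idx (ψ 0).adm
            (Θ := fun p => fam (instMulΓ x₀ x p))
            (Ψ := fun p => fam (instMulΓ y₀ y p)) fun p => famMap (θ p) :=
        (FCtx.tensMap_comp (FCtx.tailMap ψ) (ψ 0).idx (ψ 0).adm
          (X := fun p => fam (instMulΓ x₀ x p))
          (Y := fun p => fam (instMulΓ x₀ x ((ψ 0).idx p)))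
          (Z := fun p => fam (instMulΓ y₀ y p))
          (fun p => 𝟙 (fam (instMulΓ x₀ x ((ψ 0).idx p)))) (𝟙 _) (fun p => p) (.id S _)
          (fun p => famMap (θ p))).trans (congrArg₂
          (fun f g => FCtx.tensMap f (ψ 0).idx (ψ 0).adm g) (Category.comp_id _)
          (funext fun p => Category.id_comp _))
      have hS := FCtx.tensMap_star_comp (X := fun j => fam (Δs j)) α hα x₀.η (fun j => (x j).η)
        (FCtx.tensMap (FCtx.tailMap (famMap φ₀)) (famMap φ₀ 0).idx (famMap φ₀ 0).adm
          fun i => 𝟙 (fam (x₀.Γ ((famMap φ₀ 0).idx i))))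
        (fun j => FCtx.tensMap (FCtx.tailMap (famMap (φ j))) (famMap (φ j) 0).idx
          (famMap (φ j) 0).adm fun i => 𝟙 (fam ((x (α j)).Γ ((famMap (φ j) 0).idx i))))
      exact three_squares (p := famMap ζ) (q := η) hS h hT
  subsingleton Δ Θ _ := ⟨fun e e' => by
    have : IsEmpty (Θ 0).I := inferInstance
    have : ∀ v, IsEmpty (FCtx.tail Θ v).I := fun v => inferInstanceAs (IsEmpty (Θ v.succ).I)
    obtain ⟨⟨Γ, q, η⟩, rfl⟩ := instMk_surjective e
    obtain ⟨⟨Γ', q', η'⟩, rfl⟩ := instMk_surjective e'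
    -- There is nothing to instantiate, and the remaining morphism goes into an empty context.
    refine Quot.sound (.of_eq (fun i => isEmptyElim i) (fun i => isEmptyElim i) ?_)
    funext v
    exact Subsingleton.elim (α := fam Δ v ⟶ Fam.tens (FCtx.tail Θ v) fun i => fam (Γ' i) v) _ _⟩
  toEmpty {Δ Θ _} e :=
    have : ∀ v, IsEmpty (FCtx.tail Θ v).I := fun v => inferInstanceAs (IsEmpty (Θ v.succ).I)
    Quot.lift (fun (x : InstPre Q Δ Θ) v => x.η v ≫
      (Fam.isoEmpty (Fam.tens (FCtx.tail Θ v) fun i => fam (x.Γ i) v)).hom)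
      (fun _ _ _ => funext fun v => Subsingleton.elim (α := fam Δ v ⟶ Fam.empty) _ _) e
  ofEmpty {Δ Θ _} e :=
    have : ∀ v, IsEmpty (FCtx.tail Θ v).I := fun v => inferInstanceAs (IsEmpty (Θ v.succ).I)
    Quot.mk _ ⟨fun i => isEmptyElim i, fun i => isEmptyElim i, fun v => e v ≫
      (Fam.isoEmpty (Fam.tens (FCtx.tail Θ v) fun i : (Θ 0).I => fam (isEmptyElim i) v)).inv⟩

end InstMonoidal

end Prof
end ITD

/-! ### Instantiation at single variables. -/

namespace ITD

namespace Fam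

variable {S : Resource} {C : Type u} [Category.{v} C]

theorem tensUniqueIso_hom_naturality {J : Type} [Unique J] {X₀ Y₀ : Fam S C} [IsEmpty X₀.I]
    [IsEmpty Y₀.I] (t : X₀ ⟶ Y₀) {X Y : J → Fam S C} (f : ∀ j, X j ⟶ Y j) :
    tensMap t (fun j => j) (.id S _) f ≫ (tensUniqueIso Y₀ Y).hom =
      (tensUniqueIso X₀ X).hom ≫ f default :=
  hom_ext (fun _ => rfl) fun i => comp_id_eq_id_comp_id_comp ((f default).map i)

theorem tensEmptyIso_hom_naturality {J : Type} [IsEmpty J] {X₀ Y₀ : Fam S C}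
    (t : X₀ ⟶ Y₀) {X Y : J → Fam S C} (α : J → J) (hα : S.Adm α) (f : ∀ j, X (α j) ⟶ Y j) :
    tensMap t α hα f ≫ (tensEmptyIso Y₀ Y).hom = (tensEmptyIso X₀ X).hom ≫ t :=
  hom_ext (fun _ => rfl) fun i => comp_id_eq_id_comp_id_comp (t.map i)

end Fam

variable {S : Resource} {A : Type u} [SmallCategory A] {n : ℕ}

namespace FCtx

/-- The index is a parameter, not a default element: the isomorphism is used at every index of the
one-element list when a relation between instantiations is built. -/
def tensSubsingletonIso {J : Type} [Subsingleton J] (d : J) (X₀ : FCtx S A n)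
    [∀ v, IsEmpty (X₀ v).I] (X : J → FCtx S A n) : tens X₀ X ≅ X d :=
  letI : Unique J := ⟨⟨d⟩, fun _ => Subsingleton.elim _ _⟩
  isoMk fun v => Fam.tensUniqueIso (X₀ v) fun j => X j v

theorem tensSubsingletonIso_hom_naturality {J : Type} [Subsingleton J] (d : J)
    {X₀ Y₀ : FCtx S A n} [∀ v, IsEmpty (X₀ v).I] [∀ v, IsEmpty (Y₀ v).I] (t : X₀ ⟶ Y₀)
    {X Y : J → FCtx S A n} (f : ∀ j, X j ⟶ Y j) :
    tensMap t (fun j => j) (.id S _) f ≫ (tensSubsingletonIso d Y₀ Y).hom =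
      (tensSubsingletonIso d X₀ X).hom ≫ f d :=
  letI : Unique J := ⟨⟨d⟩, fun _ => Subsingleton.elim _ _⟩
  funext fun v => Fam.tensUniqueIso_hom_naturality (t v) fun j => f j v

def tensEmptyIso {J : Type} [IsEmpty J] (X₀ : FCtx S A n) (X : J → FCtx S A n) :
    tens X₀ X ≅ X₀ :=
  isoMk fun v => Fam.tensEmptyIso (X₀ v) fun j => X j v

theorem tensEmptyIso_hom_naturality {J : Type} [IsEmpty J] {X₀ Y₀ : FCtx S A n}
    (t : X₀ ⟶ Y₀) {X Y : J → FCtx S A n} (α : J → J) (hα : S.Adm α) (f : ∀ j, X (α j) ⟶ Y j) :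
    tensMap t α hα f ≫ (tensEmptyIso Y₀ Y).hom = (tensEmptyIso X₀ X).hom ≫ t :=
  funext fun v => Fam.tensEmptyIso_hom_naturality (t v) α hα fun j => f j v

end FCtx

theorem eq_comp_of_square {C : Type u} [Category.{v} C] {a b c d e : C} {p : a ⟶ b}
    {s : b ≅ c} {r : d ≅ c} {s' : e ≅ c} {T : e ⟶ b} (h : T ≫ s.hom = s'.hom ≫ 𝟙 c) :
    p = (((p ≫ s.hom) ≫ r.inv) ≫ r.hom ≫ s'.inv) ≫ T := by
  have h' : s'.inv ≫ T = s.inv := by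
    rw [Iso.inv_comp_eq, ← cancel_mono s.hom, h]
    simp
  simp [h']

theorem comp_eq_of_squares {C : Type u} [Category.{v} C] {a b c d e f g x y : C} {p : a ⟶ b}
    {q : b ⟶ c} {s : c ⟶ d} {t : e ≅ d} {m : c ⟶ f} {s' : f ⟶ g} {u : d ⟶ g} {t' : x ≅ g}
    {t'' : y ≅ g} {T₁ : e ⟶ x} {T₂ : y ⟶ x} (h : m ≫ s' = s ≫ u)
    (h₂ : T₂ ≫ t'.hom = t''.hom ≫ 𝟙 g) (h₁ : T₁ ≫ t'.hom = t.hom ≫ u) :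
    p ≫ (q ≫ s ≫ t.inv) ≫ T₁ = ((p ≫ q ≫ m) ≫ s' ≫ t''.inv) ≫ T₂ := by
  rw [← cancel_mono t'.hom]
  simp only [Category.assoc, h₁, h₂]
  simp [← h]

theorem eq_id_comp_comp {C : Type u} [Category.{v} C] {a b c d : C} {p : a ⟶ b}
    {q : b ⟶ c} {r : c ⟶ d} {t : b ⟶ d} (h : q ≫ r = t) : p ≫ t = (𝟙 a ≫ p ≫ q) ≫ r := by
  simp [h]

theorem two_squares {C : Type u} [Category.{v} C] {a b x x' y : C} {f : b ⟶ a}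
    {s : x ≅ a} {s' : x' ≅ a} {r : y ≅ b} {t : x ⟶ x'} {T : y ⟶ x'}
    (h : t ≫ s'.hom = s.hom ≫ 𝟙 a) (h' : T ≫ s'.hom = r.hom ≫ f) :
    f ≫ s.inv ≫ t = r.inv ≫ T := by
  rw [Category.comp_id] at h
  rw [Iso.eq_inv_comp, ← cancel_mono s'.hom, h']
  simp [h]

namespace Dist

variable {P Q : Dist S A n}

theorem appMk_types_ofTens {Δ : Ctx S A n} {a : Ty S A} {as bs : SList S (Ty S A)} (φ : as ⟶ bs)
    (Γ₀ : Ctx S A n) (Γ : Fin as.len → Ctx S A n) (p : P.at' Γ₀ (Ty.arrow bs a))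
    (q : ∀ i, Q.at' (Γ i) (as.get i))
    (η : Ctx.fam Δ ⟶ FCtx.tens (Ctx.fam Γ₀) fun i => Ctx.fam (Γ i)) :
    appMk bs Γ₀ (fun i => Γ (φ.idx i)) p (fun i => Q.act (φ.map i) (𝟙 _) (q (φ.idx i)))
        (Ctx.ofTens (η ≫ FCtx.tensMap (𝟙 _) φ.idx φ.adm fun i => 𝟙 (Ctx.fam (Γ (φ.idx i))))) =
      appMk as Γ₀ Γ (P.act (Ty.arrowMap φ (𝟙 a)) (𝟙 _) p) q (Ctx.ofTens η) := by
  rw [Ctx.ofTens_comp_star, appMk_types]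

theorem appMk_contexts_ofTens {Δ : Ctx S A n} {a : Ty S A} {as : SList S (Ty S A)}
    {Γ₀ Γ₀' : Ctx S A n} {Γ Γ' : Fin as.len → Ctx S A n}
    (θ₀ : Γ₀ ⟶ Γ₀') (θ : ∀ i, Γ i ⟶ Γ' i) (p : P.at' Γ₀' (Ty.arrow as a))
    (q : ∀ i, Q.at' (Γ' i) (as.get i))
    (η : Ctx.fam Δ ⟶ FCtx.tens (Ctx.fam Γ₀) fun i => Ctx.fam (Γ i)) :
    appMk as Γ₀ Γ (P.act (𝟙 _) θ₀ p) (fun i => Q.act (𝟙 _) (θ i) (q i)) (Ctx.ofTens η) =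
      appMk as Γ₀' Γ' p q (Ctx.ofTens (η ≫ FCtx.tensMap (Ctx.famMap θ₀) (fun i => i) (.id S _)
        fun i => Ctx.famMap (θ i))) := by
  rw [Ctx.ofTens_comp_tensMap, appMk_contexts]

end Dist

namespace Prof

open Ctx (fam famMap famPre)

instance subsingleton_single_zero (a : Ty S A) :
    Subsingleton (fam (Ctx.single (0 : Fin (n + 1)) a) 0).I := by
  show Subsingleton (Fin (if (0 : Fin (n + 1)) = 0 then 1 else 0))
  rw [if_pos rfl]
  infer_instance

def singleZero (a : Ty S A) : (fam (Ctx.single (0 : Fin (n + 1)) a) 0).I :=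
  Fin.cast (if_pos rfl : (if (0 : Fin (n + 1)) = 0 then 1 else 0) = 1).symm (0 : Fin 1)

instance isEmpty_tail_single (a : Ty S A) (v : Fin n) :
    IsEmpty (FCtx.tail (fam (Ctx.single (0 : Fin (n + 1)) a)) v).I :=
  Ctx.isEmpty_tail_single_zero rfl a v

variable {Q : Dist S A n}

/-- The context of an instantiation of `⟨a⟩, ⟨⟩, …, ⟨⟩`. -/
def singleTensIso {a : Ty S A} (d : (fam (Ctx.single (0 : Fin (n + 1)) a) 0).I)
    (Γ : (fam (Ctx.single (0 : Fin (n + 1)) a) 0).I → Ctx S A n) :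
    (FCtx.tens (FCtx.tail (fam (Ctx.single (0 : Fin (n + 1)) a))) fun i => fam (Γ i)) ≅
      fam (Γ d) :=
  FCtx.tensSubsingletonIso d (FCtx.tail (fam (Ctx.single (0 : Fin (n + 1)) a))) fun i => fam (Γ i)

def instOfVarZero {Δ : Ctx S A n} {a : Ty S A} (q : Q.at' Δ a) :
    (inst Q).obj Δ (fam (Ctx.single (0 : Fin (n + 1)) a)) :=
  Quot.mk _ ⟨fun _ => Δ, fun _ => q, (singleTensIso (singleZero a) fun _ => Δ).inv⟩

/-- An instantiation of the single entry `a` is one element of `Q` over some `Γ` with a morphism `Δ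
⟶ Γ`; by co-Yoneda this is an element of `Q(Δ, a)`. -/
def varZeroOfInst {Δ : Ctx S A n} {a : Ty S A}
    (e : (inst Q).obj Δ (fam (Ctx.single (0 : Fin (n + 1)) a))) : Q.at' Δ a :=
  Quot.lift (fun x : InstPre Q Δ (fam (Ctx.single (0 : Fin (n + 1)) a)) =>
      Q.act (𝟙 a) (famPre (x.η ≫ (singleTensIso (singleZero a) x.Γ).hom)) (x.q (singleZero a)))
    (by
      rintro _ _ ⟨θ, q, η⟩
      refine (Q.act_act _ _ _ _ _).trans ?_
      have h := FCtx.tensSubsingletonIso_hom_naturality (singleZero a)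
        (𝟙 (FCtx.tail (fam (Ctx.single (0 : Fin (n + 1)) a)))) fun i => famMap (θ i)
      have h' : famPre (η ≫ (singleTensIso (singleZero a) _).hom) ≫ θ (singleZero a) =
          famPre ((η ≫ FCtx.tensMap (𝟙 _) (fun i => i) (.id S _) fun i => famMap (θ i)) ≫
            (singleTensIso (singleZero a) _).hom) :=
        congrArg famPre ((Category.assoc _ _ _).trans
          ((congrArg (fun f => η ≫ f) h.symm).trans (Category.assoc _ _ _).symm))
      exact congrArg₂ (fun f g => Q.act f g (q (singleZero a))) (Category.id_comp (𝟙 a)) h') e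

theorem varZeroOfInst_instOfVarZero {Δ : Ctx S A n} {a : Ty S A} (q : Q.at' Δ a) :
    varZeroOfInst (instOfVarZero q) = q := by
  refine Eq.trans (b := Q.act (𝟙 a) (famPre (𝟙 (fam Δ))) q)
    (congrArg (fun f : fam Δ ⟶ fam Δ => Q.act (𝟙 a) (famPre f) q) ?_) (Q.act_id q)
  exact (singleTensIso (singleZero a) fun _ => Δ).inv_hom_id

theorem eq_inv_comp_of_naturality {C : Type u} [Category.{v} C] {a b c d : C} {f : a ⟶ b}
    {s : c ≅ a} {s' : d ≅ b} {T : c ⟶ d} {η : a ⟶ d} (h : T ≫ s'.hom = s.hom ≫ f)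
    (h' : f = η ≫ s'.hom) : η = s.inv ≫ T := by
  rw [Iso.eq_inv_comp, ← cancel_mono s'.hom, h, h', Category.assoc]

theorem instOfVarZero_varZeroOfInst {Δ : Ctx S A n} {a : Ty S A}
    (e : (inst Q).obj Δ (fam (Ctx.single (0 : Fin (n + 1)) a))) :
    instOfVarZero (varZeroOfInst e) = e := by
  obtain ⟨⟨Γ, q, η⟩, rfl⟩ := instMk_surjective e
  -- The morphism that was used to pull `q` back is the one witnessing the relation.
  refine Quot.sound (.of_eq (fun i => famPre (η ≫ (singleTensIso i Γ).hom)) ?_ ?_)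
  · intro i
    obtain rfl : singleZero a = i := Subsingleton.elim _ _
    rfl
  · have h := FCtx.tensSubsingletonIso_hom_naturality (singleZero a)
      (𝟙 (FCtx.tail (fam (Ctx.single (0 : Fin (n + 1)) a)))) (X := fun _ => fam Δ)
      (Y := fun i => fam (Γ i)) fun i => η ≫ (singleTensIso i Γ).hom
    exact eq_inv_comp_of_naturality h rfl

/-- The instantiated variable is sent to the instance. -/
noncomputable def instAtVarZeroIso (Q : Dist S A n) (pos : Fin (n + 1) → Prop)
    (h : ∀ p, pos p ↔ p = 0) : Q ≅ (inst Q).atVar pos :=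
  Dist.isoOfBijective (fun Δ a q => ⟨⟨0, (h 0).2 rfl⟩, instOfVarZero q⟩)
    (fun Δ a => by
      constructor
      · intro q q' hq
        have hq' := congrArg varZeroOfInst (eq_of_heq (Sigma.mk.inj hq).2)
        rwa [varZeroOfInst_instOfVarZero, varZeroOfInst_instOfVarZero] at hq'
      · rintro ⟨⟨p, hp⟩, e⟩
        obtain rfl := (h _).1 hp
        exact ⟨varZeroOfInst e, congrArg (Sigma.mk _) (instOfVarZero_varZeroOfInst e)⟩)
    (by
      intro Δ Δ' a a' g ζ q
      refine congrArg (Sigma.mk _) (Quot.sound (.of_eq (fun _ => ζ) ?_ ?_))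
      · intro i
        refine Eq.trans ?_ (Q.act_act _ _ _ _ _).symm
        exact congrArg₂ (fun f g => Q.act f g q) (Category.comp_id g).symm
          (Category.comp_id ζ).symm
      · have h := FCtx.tensSubsingletonIso_hom_naturality (singleZero (n := n) a')
          (FCtx.tailMap (famMap (Ctx.singleMap (0 : Fin (n + 1)) g))) (X := fun _ => fam Δ)
          (Y := fun _ => fam Δ) fun _ => 𝟙 (fam Δ)
        have h' := FCtx.tensSubsingletonIso_hom_naturality (singleZero (n := n) a')
          (𝟙 (FCtx.tail (fam (Ctx.single (0 : Fin (n + 1)) a')))) (X := fun _ => fam Δ')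
          (Y := fun _ => fam Δ) fun _ => famMap ζ
        exact two_squares h h')

def instOfVarSucc {Δ : Ctx S A n} {a : Ty S A} {p : Fin n} (f : Δ ⟶ Ctx.single p a) :
    (inst Q).obj Δ (fam (Ctx.single p.succ a)) :=
  Quot.mk _ ⟨fun i => isEmptyElim i, fun i => isEmptyElim i,
    famMap f ≫ (Ctx.singleTailIso p a).hom ≫
      (FCtx.tensEmptyIso (FCtx.tail (fam (Ctx.single p.succ a)))
        fun i : (fam (Ctx.single p.succ a) 0).I => fam (isEmptyElim i)).inv⟩

/-- At another variable the list to be instantiated is empty, so only the morphism on the remaining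
variables survives. -/
def varSuccOfInst {Δ : Ctx S A n} {a : Ty S A} {p : Fin n}
    (e : (inst Q).obj Δ (fam (Ctx.single p.succ a))) : Δ ⟶ Ctx.single p a :=
  Quot.lift (fun x : InstPre Q Δ (fam (Ctx.single p.succ a)) =>
      famPre ((x.η ≫ (FCtx.tensEmptyIso _ _).hom) ≫ (Ctx.singleTailIso p a).inv))
    (by
      rintro _ _ ⟨θ, q, η⟩
      have h := FCtx.tensEmptyIso_hom_naturality (𝟙 (FCtx.tail (fam (Ctx.single p.succ a))))
        (fun i => i) (.id S _) fun i => famMap (θ i)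
      refine congrArg famPre (congrArg (fun f => f ≫ (Ctx.singleTailIso p a).inv) ?_)
      refine Eq.trans ?_ (Category.assoc _ _ _).symm
      exact congrArg (fun f => η ≫ f) (h.trans (Category.comp_id _)).symm) e

theorem varSuccOfInst_instOfVarSucc {Δ : Ctx S A n} {a : Ty S A} {p : Fin n}
    (f : Δ ⟶ Ctx.single p a) : varSuccOfInst (instOfVarSucc (Q := Q) f) = f := by
  show famPre (((famMap f ≫ (Ctx.singleTailIso p a).hom ≫ (FCtx.tensEmptyIso _ _).inv) ≫
    (FCtx.tensEmptyIso _ _).hom) ≫ (Ctx.singleTailIso p a).inv) = f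
  simp

theorem instOfVarSucc_varSuccOfInst {Δ : Ctx S A n} {a : Ty S A} {p : Fin n}
    (e : (inst Q).obj Δ (fam (Ctx.single p.succ a))) :
    instOfVarSucc (varSuccOfInst e) = e := by
  obtain ⟨⟨Γ, q, η⟩, rfl⟩ := instMk_surjective e
  refine Quot.sound (.of_eq (fun i => isEmptyElim i) (fun i => isEmptyElim i) ?_)
  let θ : ∀ i : (fam (Ctx.single p.succ a) 0).I, (isEmptyElim i : Ctx S A n) ⟶ Γ i :=
    fun i => isEmptyElim i
  have h := FCtx.tensEmptyIso_hom_naturality (𝟙 (FCtx.tail (fam (Ctx.single p.succ a))))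
    (fun i => i) (.id S _) fun i => famMap (θ i)
  exact eq_comp_of_square h

/-- The other variables are kept. -/
noncomputable def instAtVarSuccIso (Q : Dist S A n) (pos : Fin (n + 1) → Prop)
    (pos' : Fin n → Prop) (h₀ : ¬ pos 0) (h : ∀ p, pos p.succ ↔ pos' p) :
    Dist.var pos' ≅ (inst Q).atVar pos :=
  Dist.isoOfBijective (fun Δ a x => ⟨⟨(x.1 : Fin n).succ, (h _).2 x.1.2⟩, instOfVarSucc x.2⟩)
    (fun Δ a => by
      constructor
      · rintro ⟨⟨p, hp⟩, f⟩ ⟨⟨p', hp'⟩, f'⟩ hx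
        have hx1 := congrArg Sigma.fst hx
        simp only [Subtype.mk.injEq, Fin.succ_inj] at hx1
        subst hx1
        have hx2 := congrArg varSuccOfInst (eq_of_heq (Sigma.mk.inj hx).2)
        rw [varSuccOfInst_instOfVarSucc, varSuccOfInst_instOfVarSucc] at hx2
        exact congrArg (Sigma.mk _) hx2
      · rintro ⟨⟨p, hp⟩, e⟩
        obtain rfl | ⟨p, rfl⟩ := Fin.eq_zero_or_eq_succ p
        · exact absurd hp h₀
        · exact ⟨⟨⟨p, (h p).1 hp⟩, varSuccOfInst e⟩,
            congrArg (Sigma.mk _) (instOfVarSucc_varSuccOfInst e)⟩)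
    (by
      rintro Δ Δ' a a' g ζ ⟨⟨p, hp⟩, f⟩
      refine congrArg (Sigma.mk _) (Quot.sound (.of_eq (fun i => isEmptyElim i)
        (fun i => isEmptyElim i) ?_))
      -- The two empty families of instances are distinct expressions; a vacuous family of morphisms
      -- links them.
      let θ : ∀ i : (fam (Ctx.single p.succ a') 0).I, (isEmptyElim i : Ctx S A n) ⟶
          isEmptyElim (show (fam (Ctx.single p.succ a) 0).I from i) := fun i => isEmptyElim i
      have h := FCtx.tensEmptyIso_hom_naturality (𝟙 (FCtx.tail (fam (Ctx.single p.succ a'))))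
        (fun i => i) (.id S _) fun i => famMap (θ i)
      have h' := FCtx.tensEmptyIso_hom_naturality (J := (fam (Ctx.single p.succ a) 0).I)
        (FCtx.tailMap (famMap (Ctx.singleMap p.succ g))) (fun i => i) (.id S _)
        fun i => 𝟙 (fam (isEmptyElim i : Ctx S A n))
      exact comp_eq_of_squares (Ctx.singleTailIso_hom_naturality p g) h h')

/-! ### The β isomorphism. -/

section Beta

variable (P : Dist S A (n + 1)) (Q : Dist S A n)

/-- The body of the abstraction lives over `ext as Γ₀`, and the arguments with `η` are an
instantiation of that context. A relation on types becomes the coend relation for the first entry;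
one on contexts becomes the coend relation for `θ₀` and the relation of `inst` for the `θ i`. -/
def betaTo (Δ : Ctx S A n) (a : Ty S A) :
    (Dist.app (Dist.lam P) Q).at' Δ a → (comp P (inst Q)).at' Δ a :=
  Dist.appLift (fun x => compMk (P := P) (E := inst Q) (Ctx.ext x.as x.Γ₀) x.p
      (Quot.mk _ ⟨x.Γ, x.q, Ctx.toTens x.η⟩))
    (by
      intro as bs φ Γ₀ Γ p q η
      change P.at' (Ctx.ext bs Γ₀) a at p
      refine Eq.trans ?_ (compMk_act (P := P) (E := inst Q) (Ctx.extMap φ (𝟙 Γ₀)) p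
        (Quot.mk _ ⟨Γ, q, Ctx.toTens η⟩)).symm
      refine congrArg (compMk (P := P) (E := inst Q) (Ctx.ext bs Γ₀) p) ?_
      refine congrArg (fun ζ => Quot.mk _ (InstPre.mk _ _ ζ)) ?_
      exact (Ctx.toTens_comp_star η φ.idx φ.adm).trans (Category.id_comp _).symm)
    (by
      intro as Γ₀ Γ₀' Γ Γ' θ₀ θ p q η
      change P.at' (Ctx.ext as Γ₀') a at p
      refine (compMk_act (P := P) (E := inst Q) (Ctx.extMap (𝟙 as) θ₀) p
        (Quot.mk _ ⟨Γ, fun i => Q.act (𝟙 _) (θ i) (q i), Ctx.toTens η⟩)).trans ?_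
      refine congrArg (compMk (P := P) (E := inst Q) (Ctx.ext as Γ₀') p) ?_
      refine Quot.sound (.of_eq θ (fun i => Q.act_id _) ?_)
      refine (Ctx.toTens_comp_tensorMap₀ η θ₀ θ).trans ?_
      have h := FCtx.tensMap_comp (famMap θ₀) (fun j => j) (.id S _) (fun j => 𝟙 (fam (Γ j)))
        (𝟙 _) (fun j => j) (.id S _) fun j => famMap (θ j)
      simp only [Category.comp_id, Category.id_comp] at h
      exact eq_id_comp_comp h)

/-- `headMap` at the identity is a coercion: an arbitrary `Θ` is not definitionally the extension of
its tail by its first entry. -/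
def betaInvMk {Δ : Ctx S A n} {a : Ty S A} (Θ : Ctx S A (n + 1)) (p : P.at' Θ a)
    (e : (inst Q).obj Δ (fam Θ)) : (Dist.app (Dist.lam P) Q).at' Δ a :=
  Quot.lift (fun x : InstPre Q Δ (fam Θ) => Dist.appMk (P := Dist.lam P) (Q := Q) (Θ 0)
      (Ctx.tail Θ) x.Γ (P.act (𝟙 a) (Ctx.headMap (𝟙 (Θ 0))) p : P.at' (Ctx.ext (Θ 0) _) a) x.q
      (Ctx.ofTens x.η))
    (by
      rintro _ _ ⟨θ, q, η⟩
      let p' : (Dist.lam P).at' (Ctx.tail Θ) (Ty.arrow (Θ 0) a) :=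
        (P.act (𝟙 a) (Ctx.headMap (𝟙 (Θ 0))) p : P.at' (Ctx.ext (Θ 0) _) a)
      have h := Dist.appMk_contexts_ofTens (P := Dist.lam P) (Q := Q) (𝟙 (Ctx.tail Θ)) θ p' q η
      rw [Dist.act_id] at h
      exact h) e

/-- The morphism `θ` acts in two stages: its tail is absorbed by the relation on contexts of the
application, its head by the relation on types. -/
theorem betaInvMk_act {Δ : Ctx S A n} {a : Ty S A} {Θ Θ' : Ctx S A (n + 1)} (θ : Θ ⟶ Θ')
    (p : P.at' Θ' a) (e : (inst Q).obj Δ (fam Θ)) :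
    betaInvMk P Q Θ (P.act (𝟙 a) θ p) e =
      betaInvMk P Q Θ' p ((inst Q).act (famMap θ) (𝟙 Δ) e) := by
  obtain ⟨⟨Γ, q, η⟩, rfl⟩ := instMk_surjective e
  let p' : (Dist.lam P).at' (Ctx.tail Θ') (Ty.arrow (Θ' 0) a) :=
    (P.act (𝟙 a) (Ctx.headMap (𝟙 (Θ' 0))) p : P.at' (Ctx.ext (Θ' 0) _) a)
  let η' : fam Δ ⟶ FCtx.tens (fam (Ctx.tail Θ')) fun i => fam (Γ i) :=
    η ≫ FCtx.tensMap (famMap (Ctx.tailMap θ)) (fun i => i) (.id S _) fun i => famMap (𝟙 (Γ i))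
  have h₁ := Dist.appMk_types_ofTens (P := Dist.lam P) (Q := Q) (θ 0) (Ctx.tail Θ') Γ p' q η'
  have h₂ := Dist.appMk_contexts_ofTens (P := Dist.lam P) (Q := Q) (Ctx.tailMap θ)
    (fun i => 𝟙 (Γ i)) ((Dist.lam P).act (Ty.arrowMap (θ 0) (𝟙 a)) (𝟙 _) p') q η
  refine Eq.trans ?_ ((h₂.trans h₁.symm).trans ?_)
  · have hq : q = fun i => Q.act (𝟙 _) (𝟙 (Γ i)) (q i) := funext fun i => (Q.act_id (q i)).symm
    refine congrArg₂ (fun p q => Dist.appMk (P := Dist.lam P) (Q := Q) (Θ 0) (Ctx.tail Θ) Γ p q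
      (Ctx.ofTens η)) ?_ hq
    show P.act (𝟙 a) (Ctx.headMap (𝟙 (Θ 0))) (P.act (𝟙 a) θ p) =
      P.act (𝟙 a) (Ctx.extMap (𝟙 (Θ 0)) (Ctx.tailMap θ))
        (P.act (𝟙 a) (Ctx.extMap (θ 0) (𝟙 _)) (P.act (𝟙 a) (Ctx.headMap (𝟙 (Θ' 0))) p))
    rw [P.act_act, P.act_act, P.act_act, Category.assoc, Ctx.extMap_headMap, Ctx.headMap_comp]
    simp only [Category.comp_id, Category.id_comp]
  · refine congrArg (fun ζ => Dist.appMk (P := Dist.lam P) (Q := Q) (Θ' 0) (Ctx.tail Θ') _ p' _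
      (Ctx.ofTens ζ)) ?_
    have h := FCtx.tensMap_comp (famMap (Ctx.tailMap θ)) (fun i => i) (.id S _)
      (fun i => famMap (𝟙 (Γ i))) (𝟙 _) (θ 0).idx (θ 0).adm
      fun i => 𝟙 (fam (Γ ((θ 0).idx i)))
    simp only [Category.comp_id, Ctx.famMap_id] at h
    exact (Category.assoc _ _ _).trans ((congrArg (fun f => η ≫ f) h).trans
      (Category.id_comp _).symm)

def betaInv (Δ : Ctx S A n) (a : Ty S A) :
    (comp P (inst Q)).at' Δ a → (Dist.app (Dist.lam P) Q).at' Δ a :=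
  compLift (betaInvMk P Q) (betaInvMk_act P Q)

/-- An application of an abstraction is an instantiation. -/
def betaIso : Dist.app (Dist.lam P) Q ≅ comp P (inst Q) :=
  Dist.isoMk (fun Δ a =>
    { toFun := betaTo P Q Δ a
      invFun := betaInv P Q Δ a
      left_inv := by
        rintro ⟨as, Γ₀, Γ, p, q, η⟩
        change P.at' (Ctx.ext as Γ₀) a at p
        have hp : P.act (𝟙 a) (Ctx.headMap (Θ := Ctx.ext as Γ₀) (𝟙 as)) p = p := by
          refine Eq.trans ?_ (P.act_id p)
          exact congrArg (fun θ => P.act (𝟙 a) θ p)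
            ((Ctx.headMap_eq_extMap _).trans (Ctx.extMap_id as Γ₀))
        exact congrArg₂ (fun p η => Dist.appMk (P := Dist.lam P) (Q := Q) as Γ₀ Γ p q η) hp
          (Ctx.ofTens_toTens η)
      right_inv := by
        rintro ⟨Θ, p, ⟨Γ, q, η⟩⟩
        refine (compMk_act (P := P) (E := inst Q) (Ctx.headMap (𝟙 (Θ 0))) p
          (Quot.mk _ ⟨Γ, q, Ctx.toTens (Ctx.ofTens η)⟩)).trans ?_
        refine congrArg (compMk (P := P) (E := inst Q) Θ p) ?_
        refine congrArg₂ (fun q ζ => Quot.mk _ (InstPre.mk _ q ζ)) (funext fun i => Q.act_id _) ?_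
        refine (congrArg₂ (fun f g => 𝟙 (fam Δ) ≫ f ≫ g)
          (Ctx.toTens_ofTens (Γ₀ := Ctx.tail Θ) (Γ := Γ) η) (FCtx.tensMap_id _ _ (.id S _))).trans ?_
        exact (Category.id_comp _).trans (Category.comp_id _) })
    (by
      rintro Δ Δ' a a' g ζ ⟨as, Γ₀, Γ, p, q, η⟩
      change P.at' (Ctx.ext as Γ₀) a at p
      refine congrArg₂ (fun f e => compMk (P := P) (E := inst Q) (Ctx.ext as Γ₀) (P.act g f p) e)
        (Ctx.extMap_id as Γ₀) ?_
      refine Eq.trans ?_ (act_instMk (Q := Q) (Θ := fam (Ctx.ext as Γ₀)) ζ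
        ⟨Γ, q, Ctx.toTens η⟩).symm
      exact congrArg (fun t => Quot.mk _ (InstPre.mk (Q := Q) (Δ := Δ')
        (Θ := fam (Ctx.ext as Γ₀)) Γ q t)) (Ctx.toTens_comp ζ η))

end Beta

end Prof
end ITD

namespace ITD

/-! ### Denotations of substitutions -/

namespace Var

variable {n k : ℕ} (x : Fin n → ℕ)

/-- The innermost bound variable has position `0`, so passing a binder shifts all older positions by
one. These lemmas supply the positional side conditions of the inductions below. -/
theorem at_bound_zero (p : Fin (n + k + 1)) : (bound (k := k + 1) 0).At x p ↔ p = 0 := by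
  show p = _ ↔ _
  rw [Fin.ext_iff, Fin.ext_iff]
  simp

theorem at_bound_succ (i : Fin k) (p : Fin (n + k)) :
    (bound (k := k + 1) i.succ).At x p.succ ↔ (bound i).At x p := by
  show p.succ = _ ↔ p = _
  rw [Fin.ext_iff, Fin.ext_iff]
  simp

theorem not_at_bound_succ (i : Fin k) : ¬ (bound (k := k + 1) i.succ).At x (0 : Fin (n + k + 1)) := by
  show ¬ (0 : Fin (n + k + 1)) = _
  rw [Fin.ext_iff]
  simp

theorem at_free_succ (y : ℕ) (p : Fin (n + k)) :
    (free (k := k + 1) y).At x p.succ ↔ (free (k := k) y).At x p := by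
  refine exists_congr fun i => and_congr_right fun _ => ?_
  rw [Fin.ext_iff, Fin.ext_iff]
  simp [← add_assoc]

theorem not_at_free_zero (y : ℕ) : ¬ (free (k := k + 1) y).At x (0 : Fin (n + k + 1)) := by
  rintro ⟨i, _, h⟩
  rw [Fin.ext_iff] at h
  simp at h

end Var

variable {S : Resource} {A : Type u} [SmallCategory A] {m n : ℕ}

namespace Dist

/-- The weakening of a variable. -/
noncomputable def wkVarIso (pos : Fin n → Prop) (pos' : Fin (n + 1) → Prop) (h₀ : ¬ pos' 0)
    (h : ∀ p, pos' p.succ ↔ pos p) : (var (S := S) (A := A) pos).wk ≅ var pos' :=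
  (Prof.compWkIso _).symm ≪≫ Prof.compVarIso _ _ ≪≫ Prof.wkAtVarIso pos pos' h₀ h

end Dist

namespace Term

open Prof

variable (x : Fin n → ℕ)

/-- `E` is quantified inside the induction because a binder replaces it by `E.lift`. The hypotheses
on `E` concern variables only and pass to `E.lift`. Renaming comes before substitution because the
weakening it needs at a binder is that of a variable, known from `Dist.wkVarIso`. -/
theorem nonempty_comp_iso_rename {k : ℕ} (M : Term k) :
    ∀ {l : ℕ} (ρ : Fin k → Fin l) (E : Prof S A (n + k) (n + l)) (_ : E.Monoidal)
      (_ : ∀ y, Nonempty (E.atVar ((Var.free y : Var k).At x) ≅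
        Dist.var ((Var.free y : Var l).At x)))
      (_ : ∀ i, Nonempty (E.atVar ((Var.bound i).At x) ≅ Dist.var ((Var.bound (ρ i)).At x))),
      Nonempty (comp (denote S A x M) E ≅ denote S A x (M.rename ρ)) := by
  induction M with
  | @var k v =>
    intro l ρ E _ hf hb
    cases v with
    | free y => exact (hf y).map fun i => compVarIso _ _ ≪≫ i
    | bound i => exact (hb i).map fun i => compVarIso _ _ ≪≫ i
  | @lam k M ih =>
    intro l ρ E hE hf hb
    refine (ih (Fin.cons (α := fun _ => Fin (l + 1)) 0 fun i => (ρ i).succ) E.lift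
      (liftMonoidal hE) ?_ ?_).map fun i => compLamIso _ _ ≪≫ Dist.lamCongr i
    · intro y
      -- At an old variable the extended profunctor restricts to the weakening of what `E` restricts
      -- to.
      refine (hf y).map fun i => (liftAtVarSuccIso E _ _ (Var.not_at_free_zero x y)
        (Var.at_free_succ x y)).symm ≪≫ Dist.wkCongr i ≪≫
        Dist.wkVarIso _ _ (Var.not_at_free_zero x y) (Var.at_free_succ x y)
    · refine Fin.cases ?_ fun i => ?_
      · exact ⟨(liftAtVarZeroIso hE _ _ (Var.at_bound_zero x) (Var.at_bound_zero x)).symm⟩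
      · refine (hb i).map fun j => (liftAtVarSuccIso E _ _ (Var.not_at_bound_succ x i)
          (Var.at_bound_succ x i)).symm ≪≫ Dist.wkCongr j ≪≫
          Dist.wkVarIso _ _ (Var.not_at_bound_succ x (ρ i)) (Var.at_bound_succ x (ρ i))
  | @app k M N ihM ihN =>
    intro l ρ E hE hf hb
    obtain ⟨i⟩ := ihM ρ E hE hf hb
    obtain ⟨j⟩ := ihN ρ E hE hf hb
    exact ⟨Monoidal.compAppIso hE _ _ ≪≫ Dist.appCongr i j⟩

theorem nonempty_wk_iso_rename_succ {k : ℕ} (M : Term k) :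
    Nonempty ((denote S A x M).wk ≅ denote S A x (M.rename Fin.succ)) := by
  refine (nonempty_comp_iso_rename x M Fin.succ (wk S A (n + k)) (wkMonoidal S A (n + k))
    ?_ ?_).map fun i => (compWkIso _).symm ≪≫ i
  · exact fun y => ⟨wkAtVarIso _ _ (Var.not_at_free_zero x y) (Var.at_free_succ x y)⟩
  · exact fun i => ⟨wkAtVarIso _ _ (Var.not_at_bound_succ x i) (Var.at_bound_succ x i)⟩

theorem nonempty_comp_iso_subst {k : ℕ} (M : Term k) :
    ∀ {l : ℕ} (σ : Fin k → Term l) (E : Prof S A (n + k) (n + l)) (_ : E.Monoidal)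
      (_ : ∀ y, Nonempty (E.atVar ((Var.free y : Var k).At x) ≅
        Dist.var ((Var.free y : Var l).At x)))
      (_ : ∀ i, Nonempty (E.atVar ((Var.bound i).At x) ≅ denote S A x (σ i))),
      Nonempty (comp (denote S A x M) E ≅ denote S A x (M.subst σ)) := by
  induction M with
  | @var k v =>
    intro l σ E _ hf hb
    cases v with
    | free y => exact (hf y).map fun i => compVarIso _ _ ≪≫ i
    | bound i => exact (hb i).map fun i => compVarIso _ _ ≪≫ i
  | @lam k M ih =>
    intro l σ E hE hf hb
    refine (ih (Fin.cons (α := fun _ => Term (l + 1)) (.var (.bound 0))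
      fun i => (σ i).rename Fin.succ) E.lift (liftMonoidal hE) ?_ ?_).map
      fun i => compLamIso _ _ ≪≫ Dist.lamCongr i
    · intro y
      refine (hf y).map fun i => (liftAtVarSuccIso E _ _ (Var.not_at_free_zero x y)
        (Var.at_free_succ x y)).symm ≪≫ Dist.wkCongr i ≪≫
        Dist.wkVarIso _ _ (Var.not_at_free_zero x y) (Var.at_free_succ x y)
    · refine Fin.cases ?_ fun i => ?_
      · exact ⟨(liftAtVarZeroIso hE _ _ (Var.at_bound_zero x) (Var.at_bound_zero x)).symm⟩
      -- The only point where substitution goes beyond renaming: the weakening of an arbitrary term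
      -- is needed.
      · obtain ⟨j'⟩ := nonempty_wk_iso_rename_succ (S := S) (A := A) x (σ i)
        refine (hb i).map fun j => (liftAtVarSuccIso E _ _ (Var.not_at_bound_succ x i)
          (Var.at_bound_succ x i)).symm ≪≫ Dist.wkCongr j ≪≫ j'
  | @app k M N ihM ihN =>
    intro l σ E hE hf hb
    obtain ⟨i⟩ := ihM σ E hE hf hb
    obtain ⟨j⟩ := ihN σ E hE hf hb
    exact ⟨Monoidal.compAppIso hE _ _ ≪≫ Dist.appCongr i j⟩

/-- Soundness of the contraction of a redex. -/
theorem nonempty_app_lam_iso_inst {k : ℕ} (M : Term (k + 1)) (N : Term k) :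
    Nonempty (denote S A x (.app (.lam M) N) ≅ denote S A x (M.inst N)) := by
  refine (nonempty_comp_iso_subst x M (Fin.cons (α := fun _ => Term k) N fun i => .var (.bound i))
    (Prof.inst (denote S A x N)) (instMonoidal _) ?_ ?_).map fun i => betaIso _ _ ≪≫ i
  · exact fun y => ⟨(instAtVarSuccIso _ _ _ (Var.not_at_free_zero x y)
      (Var.at_free_succ x y)).symm⟩
  · refine Fin.cases ⟨(instAtVarZeroIso _ _ (Var.at_bound_zero x)).symm⟩ fun i => ?_
    exact ⟨(instAtVarSuccIso _ _ _ (Var.not_at_bound_succ x i) (Var.at_bound_succ x i)).symm⟩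

theorem Beta.nonempty_denote_iso {k : ℕ} {M N : Term k} (h : Beta M N) :
    Nonempty (denote S A x M ≅ denote S A x N) := by
  induction h with
  | beta M N => exact nonempty_app_lam_iso_inst x M N
  | lam _ ih => exact ih.map Dist.lamCongr
  | appL N _ ih => exact ih.map fun i => Dist.appCongr i (Iso.refl _)
  | appR M _ ih => exact ih.map fun i => Dist.appCongr (Iso.refl _) i

end Term

/-! ### Typing derivations and denotations -/

namespace Der

variable {x : Fin n → ℕ} {k : ℕ} {Δ : Ctx S A (n + k)} {a : Ty S A}

def toVar {v : Var k} : Der x Δ (.var v) a → (Dist.var (v.At x)).at' Δ a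
  | .var p hp f => ⟨⟨p, hp⟩, f⟩

def toLam {M : Term (k + 1)} : {a : Ty S A} → Der x Δ (.lam M) a →
    Dist.LamObj (typeDist S A x (k := k + 1) M) Δ a
  | _, .lam π => Quot.mk _ π

def toApp {M N : Term k} : Der x Δ (.app M N) a →
    (Dist.app (typeDist S A x M) (typeDist S A x N)).at' Δ a
  | .app as Γ₀ Γ π₀ π η => Dist.appMk (P := typeDist S A x M) (Q := typeDist S A x N) as Γ₀ Γ
      (Quot.mk _ π₀) (fun i => Quot.mk _ (π i)) η

/-- No generator or proper congruence rule concerns variables, so related derivations have the same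
image. The term is kept general, with an equation, so that induction on `Congr` is possible;
likewise in the next two lemmas. -/
theorem Congr.toVar_eq {M : Term k} {π ρ : Der x Δ M a} (h : Congr π ρ) :
    ∀ {v : Var k} (hM : M = .var v), toVar (hM ▸ π) = toVar (hM ▸ ρ) := by
  induction h with
  | refl => intro v hM; rfl
  | symm _ ih => intro v hM; exact (ih hM).symm
  | trans _ _ ih ih' => intro v hM; exact (ih hM).trans (ih' hM)
  | lam => intro v hM; cases hM
  | app => intro v hM; cases hM
  | types => intro v hM; cases hM
  | contexts => intro v hM; cases hM

theorem Congr.toLam_eq {M' : Term k} {π ρ : Der x Δ M' a} (h : Congr π ρ) :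
    ∀ {M : Term (k + 1)} (hM : M' = .lam M), toLam (hM ▸ π) = toLam (hM ▸ ρ) := by
  induction h with
  | refl => intro M hM; rfl
  | symm _ ih => intro M hM; exact (ih hM).symm
  | trans _ _ ih ih' => intro M hM; exact (ih hM).trans (ih' hM)
  | lam h _ => intro M hM; cases hM; exact Quot.sound h
  | app => intro M hM; cases hM
  | types => intro M hM; cases hM
  | contexts => intro M hM; cases hM

/-- The two generators are the two cowedge relations. The sides differ only by identity actions,
since a distributor acts on both sides at once while each generator uses one of `lact` and `ract`.
-/
theorem Congr.toApp_eq {M' : Term k} {π ρ : Der x Δ M' a} (h : Congr π ρ) :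
    ∀ {M N : Term k} (hM : M' = .app M N), toApp (hM ▸ π) = toApp (hM ▸ ρ) := by
  induction h with
  | refl => intro M N hM; rfl
  | symm _ ih => intro M N hM; exact (ih hM).symm
  | trans _ _ ih ih' => intro M N hM; exact (ih hM).trans (ih' hM)
  | lam h _ => intro M N hM; cases hM
  | @app k Δ M N a as Γ₀ Γ π₀ ρ₀ π ρ η h₀ h _ _ =>
    intro M' N' hM
    cases hM
    exact congrArg₂ (fun p q => Dist.appMk (P := typeDist S A x M) (Q := typeDist S A x N)
      _ _ _ p q η) (Quot.sound h₀) (funext fun i => Quot.sound (h i))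
  | @types k Δ M N a as bs φ Γ₀ Γ π₀ π η =>
    intro M' N' hM
    cases hM
    have h := Dist.appMk_types (P := typeDist S A x M) (Q := typeDist S A x N) φ Γ₀ Γ
      (Quot.mk _ π₀) (fun i => Quot.mk _ (π i)) η
    refine Eq.trans ?_ (h.trans ?_)
    · exact congrArg (fun q => Dist.appMk (P := typeDist S A x M) (Q := typeDist S A x N) bs Γ₀
        (fun i => Γ (φ.idx i)) (Quot.mk _ π₀) q (η ≫ Ctx.star φ.idx φ.adm Γ₀ Γ))
        (funext fun i => congrArg (Quot.mk _) (ract_id _).symm)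
    · exact congrArg (fun p => Dist.appMk (P := typeDist S A x M) (Q := typeDist S A x N) as Γ₀ Γ
        p (fun i => Quot.mk _ (π i)) η) (congrArg (Quot.mk _) (ract_id _))
  | @contexts k Δ M N a as Γ₀ Γ₀' Γ Γ' θ₀ θ π₀ π η =>
    intro M' N' hM
    cases hM
    have h := Dist.appMk_contexts (P := typeDist S A x M) (Q := typeDist S A x N) θ₀ θ
      (Quot.mk _ π₀) (fun i => Quot.mk _ (π i)) η
    refine Eq.trans ?_ h
    exact congrArg₂ (fun p q => Dist.appMk (P := typeDist S A x M) (Q := typeDist S A x N) as Γ₀ Γ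
        p q η) (congrArg (fun π => Quot.mk Congr (Der.ract π θ₀)) (lact_id π₀).symm)
        (funext fun i => congrArg (fun π => Quot.mk Congr (Der.ract π (θ i))) (lact_id (π i)).symm)

end Der

section TypeDist

open Der (toVar toLam toApp)

variable (S A) (x : Fin n → ℕ) {k : ℕ}

def typeDistVarIso (v : Var k) : typeDist S A x (.var v) ≅ Dist.var (v.At x) :=
  Dist.isoMk (fun Δ a =>
    { toFun := Quot.lift toVar fun _ _ h => h.toVar_eq rfl
      invFun := fun y => Quot.mk _ (.var y.1 y.1.2 y.2)
      left_inv := by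
        rintro ⟨π⟩
        cases π
        rfl
      right_inv := fun y => rfl })
    (by
      rintro Δ Δ' a a' g η ⟨π⟩
      cases π
      rfl)

def typeDistLamEquiv (M : Term (k + 1)) (Δ : Ctx S A (n + k)) :
    ∀ a, (typeDist S A x (.lam M)).at' Δ a ≃ Dist.LamObj (typeDist S A x (k := k + 1) M) Δ a
  | .atom _ =>
    { toFun := Quot.lift toLam fun _ _ h => h.toLam_eq rfl
      invFun := fun y => PEmpty.elim y
      left_inv := by
        rintro ⟨π⟩
        cases π
      right_inv := fun y => PEmpty.elim y }
  | .arr _ _ _ =>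
    { toFun := Quot.lift toLam fun _ _ h => h.toLam_eq rfl
      invFun := Quot.map Der.lam fun _ _ => .lam
      left_inv := by
        rintro ⟨π⟩
        cases π
        rfl
      right_inv := by
        rintro ⟨π⟩
        rfl }

def typeDistLamIso (M : Term (k + 1)) :
    typeDist S A x (.lam M) ≅ Dist.lam (typeDist S A x (k := k + 1) M) :=
  Dist.isoMk (fun Δ a => typeDistLamEquiv S A x M Δ a) (by
    rintro Δ Δ' a a' g η ⟨π⟩
    cases π with
    | lam π =>
      change Ty.Hom _ _ at g
      cases g with
      | arr α hα f g =>
        refine congrArg (Quot.mk _) ?_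
        refine (Der.ract_ract _ _ _).trans ?_
        refine congrArg (Der.ract _) ?_
        refine (Ctx.extMap_comp _ _ _ _).trans ?_
        rw [Category.id_comp, Category.comp_id]
        rfl)

variable {S A x} in
/-- The class of an application of derivations. -/
def appClass {M N : Term k} {Δ : Ctx S A (n + k)} {a : Ty S A} (as : SList S (Ty S A))
    (Γ₀ : Ctx S A (n + k)) (Γ : Fin as.len → Ctx S A (n + k)) (η : Δ ⟶ Ctx.tensor₀ Γ₀ Γ)
    (π₀ : Der x Γ₀ M (Ty.arrow as a)) (π : ∀ i, Der x (Γ i) N (as.get i)) :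
    (typeDist S A x (.app M N)).at' Δ a :=
  Quot.mk _ (Der.app as Γ₀ Γ π₀ π η)

variable {S A x} in
-- Closure of the congruence under application makes the class depend only on the classes of the
-- premises.
theorem quotLift₂_appClass {M N : Term k} {Δ : Ctx S A (n + k)} {a : Ty S A}
    (as : SList S (Ty S A))
    (Γ₀ : Ctx S A (n + k)) (Γ : Fin as.len → Ctx S A (n + k)) (η : Δ ⟶ Ctx.tensor₀ Γ₀ Γ)
    (π₀ : Der x Γ₀ M (Ty.arrow as a)) (π : ∀ i, Der x (Γ i) N (as.get i)) :
    quotLift₂ (appClass as Γ₀ Γ η) (Quot.mk Der.Congr π₀) (fun i => Quot.mk Der.Congr (π i)) =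
      appClass as Γ₀ Γ η π₀ π :=
  quotLift₂_mk .refl (fun _ => .refl) (fun _ _ _ _ h₀ h => Quot.sound (.app η h₀ h)) π₀ π

variable {S A x} in
theorem exists_rep {N : Term k} {m : ℕ} {Γ : Fin m → Ctx S A (n + k)} {as : Fin m → Ty S A}
    (q : ∀ i, (typeDist S A x N).at' (Γ i) (as i)) :
    ∃ π : ∀ i, Der x (Γ i) N (as i), q = fun i => Quot.mk Der.Congr (π i) :=
  ⟨fun i => (q i).out, funext fun i => (Quot.out_eq (q i)).symm⟩

noncomputable def typeDistAppInv (M N : Term k) (Δ : Ctx S A (n + k)) (a : Ty S A) :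
    (Dist.app (typeDist S A x M) (typeDist S A x N)).at' Δ a →
      (typeDist S A x (.app M N)).at' Δ a :=
  Dist.appLift (fun y => quotLift₂ (appClass y.as y.Γ₀ y.Γ y.η) y.p y.q)
    (by
      rintro as bs φ Γ₀ Γ ⟨π₀⟩ q η
      obtain ⟨π, rfl⟩ := exists_rep q
      refine (quotLift₂_appClass bs Γ₀ _ _ π₀
        fun i => Der.ract (Der.lact (φ.map i) (π (φ.idx i))) (𝟙 _)).trans ?_
      refine Eq.trans ?_ (quotLift₂_appClass as Γ₀ Γ η
        (Der.ract (Der.lact (Ty.arrowMap φ (𝟙 a)) π₀) (𝟙 _)) π).symm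
      simp only [Der.ract_id]
      exact Quot.sound (.types φ Γ₀ Γ π₀ π η))
    (by
      rintro as Γ₀ Γ₀' Γ Γ' θ₀ θ ⟨π₀⟩ q η
      obtain ⟨π, rfl⟩ := exists_rep q
      refine (quotLift₂_appClass as Γ₀ Γ η (Der.ract (Der.lact (𝟙 (Ty.arrow as a)) π₀) θ₀)
        fun i => Der.ract (Der.lact (𝟙 (as.get i)) (π i)) (θ i)).trans ?_
      refine Eq.trans ?_ (quotLift₂_appClass as Γ₀' Γ' _ π₀ π).symm
      simp only [Der.lact_id]
      exact Quot.sound (.contexts θ₀ θ π₀ π η))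

noncomputable def typeDistAppIso (M N : Term k) :
    typeDist S A x (.app M N) ≅ Dist.app (typeDist S A x M) (typeDist S A x N) :=
  Dist.isoMk (fun Δ a =>
    { toFun := Quot.lift toApp fun _ _ h => h.toApp_eq rfl
      invFun := typeDistAppInv S A x M N Δ a
      left_inv := by
        rintro ⟨π⟩
        cases π with
        | app as Γ₀ Γ π₀ π η => exact quotLift₂_appClass as Γ₀ Γ η π₀ π
      right_inv := by
        rintro ⟨as, Γ₀, Γ, ⟨π₀⟩, q, η⟩
        obtain ⟨π, rfl⟩ := exists_rep q
        exact congrArg (Quot.lift toApp fun _ _ h => h.toApp_eq rfl)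
          (quotLift₂_appClass as Γ₀ Γ η π₀ π) })
    (by
      rintro Δ Δ' a a' g η ⟨π⟩
      cases π with
      | app as Γ₀ Γ π₀ π ζ =>
        refine congrArg (fun p => Dist.appMk (P := typeDist S A x M) (Q := typeDist S A x N) as Γ₀
          Γ p (fun i => Quot.mk _ (π i)) (η ≫ ζ)) ?_
        exact congrArg (Quot.mk _) (Der.ract_id _).symm)

/-- The intersection type distributor is the denotation. -/
theorem nonempty_typeDist_iso_denote (M : Term k) :
    Nonempty (typeDist S A x M ≅ denote S A x M) := by
  induction M with
  | var v => exact ⟨typeDistVarIso S A x v⟩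
  | lam M ih => exact ih.map fun i => typeDistLamIso S A x M ≪≫ Dist.lamCongr i
  | app M N ihM ihN =>
    obtain ⟨i⟩ := ihM
    obtain ⟨j⟩ := ihN
    exact ⟨typeDistAppIso S A x M N ≪≫ Dist.appCongr i j⟩

end TypeDist

end ITD

/-! ### Invariance of both distributors under β-reduction. -/

theorem mainTheorem2 (S : ITD.Resource) (A : Type u) [CategoryTheory.SmallCategory A]
    (M N : ITD.Lam) (n : ℕ) (x : Fin n → ℕ) (hx : Function.Injective x)
    (hFV : M.FV ∪ N.FV ⊆ Set.range x) (h : ITD.Term.Beta M N) :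
    Nonempty (ITD.denote S A x M ≅ ITD.denote S A x N) ∧
      Nonempty (ITD.typeDist S A x M ≅ ITD.typeDist S A x N) := by
  obtain ⟨i⟩ := h.nonempty_denote_iso (S := S) (A := A) x
  obtain ⟨j⟩ := ITD.nonempty_typeDist_iso_denote S A x M
  obtain ⟨j'⟩ := ITD.nonempty_typeDist_iso_denote S A x N
  exact ⟨⟨i⟩, ⟨j ≪≫ i ≪≫ j'.symm⟩⟩
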